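/- For a metric space $(X,d_X)$ and an integer $q\ge 2$ let $$\mathrm{xt}_q(X)=\binom q2^{-1}\sup_{(x_1,\dots,x_q)\in X^q}\ \sum_{1\le i<j\le q} d_X(x_i,x_j)$$ denote its $q$-extent, and let $\bar B^X_\varepsilon(x)=\{y\in X: d_X(x,y)\le\varepsilon\}$ be the closed metric ball, equipped with the restriction of $d_X$. Let $n\ge 1$, let $(M,g)$ be a smooth $n$-dimensional Riemannian manifold, possibly with boundary, with Riemannian distance $d_M$ (the infimum of the lengths of paths), let $x$ be an interior point of $M$, and let $\operatorname{Scal}_g(x)$ be the scalar curvature at $x$ (the $g$-trace of the Ricci tensor, equal to $n(n-1)$ on the unit sphere $\mathbb S^n$). Then, as $\varepsilon\to 0^+$, $$\begin{aligned} \mathrm{xt}_{n+1}\big(\bar B^M_\varepsilon(x)\big) &=\mathrm{xt}_{n+1}\big(\bar B^{\mathbb R^n}_1(0)\big)\,\varepsilon-\frac16\sqrt{\frac{n+1}{2n^5}}\,\operatorname{Scal}_g(x)\,\varepsilon^3+O(\varepsilon^4)\\ &=\sqrt{\frac{2(n+1)}{n}}\;\varepsilon\left\{1-\frac{1}{12n^2}\operatorname{Scal}_g(x)\,\varepsilon^2+O(\varepsilon^3)\right\},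 \end{aligned}$$ where $\mathbb R^n$ carries the Euclidean distance, and the implied constants may depend on $(M,g)$ and $x$. -/

import Mathlib

open scoped ENNReal ContDiff Manifold Topology Bundle
open Asymptotics Bundle Filter Set

noncomputable section

/-- The `q`-extent of a metric space `X`: the largest possible mean of the pairwise distances of
`q` points of `X`, that is
`(q choose 2)⁻¹ * sup_{(x_1, …, x_q) ∈ X^q} ∑_{i < j} d(x_i, x_j)`.
It is defined for extended distances, so that `X` may be unbounded or disconnected. -/
def extent (q : ℕ) (X : Type*) [PseudoEMetricSpace X] : ℝ≥0∞ :=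
  ((q.choose 2 : ℕ) : ℝ≥0∞)⁻¹ *
    ⨆ p : Fin q → X, ∑ i : Fin q, ∑ j ∈ Finset.Ioi i, edist (p i) (p j)

/-! ### Scalar curvature in local coordinates

Let `M` be a manifold (possibly with boundary or corners) modelled on `ℝⁿ`, with a Riemannian
metric `g`. All quantities below are computed in the chart of `M` at a point `x`, as functions of
the coordinate `y` in the range of the model. Derivatives are taken within that range, which is a
neighbourhood of `y` as soon as `y` corresponds to an interior point. -/

namespace RiemannianCoord

variable {n : ℕ} {H : Type*} [TopologicalSpace H]
  (I : ModelWithCorners ℝ (EuclideanSpace ℝ (Fin n)) H)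
  {M : Type*} [TopologicalSpace M] [ChartedSpace H M]

/-- The partial derivative `∂_i f` at `y`, for `f` defined on the range of the model. -/
def pderiv (i : Fin n) (f : EuclideanSpace ℝ (Fin n) → ℝ) (y : EuclideanSpace ℝ (Fin n)) : ℝ :=
  fderivWithin ℝ f (range I) y (EuclideanSpace.single i 1)

/-- The coordinate vector field `∂_i` of the chart at `x`, at the point of coordinate `y`. -/
def coordField (x : M) (i : Fin n) (y : EuclideanSpace ℝ (Fin n)) :
    TangentSpace I ((extChartAt I x).symm y) :=
  mfderivWithin 𝓘(ℝ, EuclideanSpace ℝ (Fin n)) I (extChartAt I x).symm (range I) y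
    (EuclideanSpace.single i (1 : ℝ))

variable [RiemannianBundle (fun p : M ↦ TangentSpace I p)]

/-- The matrix `g_{ij}(y) = g(∂_i, ∂_j)` of the metric. -/
def metric (x : M) (y : EuclideanSpace ℝ (Fin n)) : Matrix (Fin n) (Fin n) ℝ :=
  Matrix.of fun i j ↦ inner ℝ (coordField I x i y) (coordField I x j y)

/-- The Christoffel symbols of the Levi-Civita connection,
`Γ^k_{ij} = ½ ∑_l g^{kl} (∂_i g_{jl} + ∂_j g_{il} - ∂_l g_{ij})`, where `∇_{∂_i} ∂_j = Γ^k_{ij} ∂_k`. -/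
def christoffel (x : M) (k i j : Fin n) (y : EuclideanSpace ℝ (Fin n)) : ℝ :=
  (1 / 2 : ℝ) * ∑ l, (metric I x y)⁻¹ k l *
    (pderiv I i (fun z ↦ metric I x z j l) y + pderiv I j (fun z ↦ metric I x z i l) y
      - pderiv I l (fun z ↦ metric I x z i j) y)

/-- The coefficient along `∂_l` of `R(∂_i, ∂_j) ∂_k`, where
`R(X, Y) Z = ∇_X ∇_Y Z - ∇_Y ∇_X Z - ∇_{[X, Y]} Z`. -/
def riemann (x : M) (l k i j : Fin n) (y : EuclideanSpace ℝ (Fin n)) : ℝ :=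
  pderiv I i (christoffel I x l j k) y - pderiv I j (christoffel I x l i k) y
    + ∑ m, (christoffel I x l i m y * christoffel I x m j k y
        - christoffel I x l j m y * christoffel I x m i k y)

/-- The Ricci tensor: `Ric(∂_j, ∂_k)` is the trace of `X ↦ R(X, ∂_j) ∂_k`. -/
def ricci (x : M) (j k : Fin n) (y : EuclideanSpace ℝ (Fin n)) : ℝ :=
  ∑ i, riemann I x i k i j y

end RiemannianCoord

/-- The scalar curvature at `x`, i.e. the trace `g^{jk} Ric_{jk}` of the Ricci tensor with respect
to the metric, computed in the chart at `x`. It is normalized so that the unit sphere of dimension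
`n` has scalar curvature `n (n - 1)`. -/
def scalarCurvature {n : ℕ} {H : Type*} [TopologicalSpace H]
    (I : ModelWithCorners ℝ (EuclideanSpace ℝ (Fin n)) H)
    {M : Type*} [TopologicalSpace M] [ChartedSpace H M]
    [RiemannianBundle (fun p : M ↦ TangentSpace I p)] (x : M) : ℝ :=
  ∑ j, ∑ k, (RiemannianCoord.metric I x (extChartAt I x x))⁻¹ j k *
    RiemannianCoord.ricci I x j k (extChartAt I x x)

end

/-! Near `x` the geometry is Euclidean up to a quadratic curvature correction. In the coordinates
`normalMap`, a cubic polynomial imitating the exponential map, the metric is `|w|² - R(w,z,z,w)/3`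
up to `O(|z|³|w|²)` (`normalMap_metric_expansion`). Hence points with coordinates `u, v` in the ball
of radius `ρ` have distance `|v-u| - R(v-u,u,u,v-u)/(6|v-u|)` up to `O(ρ³|v-u|)`
(`exists_distance_expansion`). The upper bound is the length of the coordinate segment. The lower
bound is a calibration: `planeWave` has gradient at most `1 + O(ρ³)`, and its increment from `u` to
`v` is exactly the expansion. No geodesics are needed.

Let `L` be the edge of the regular simplex inscribed in the unit sphere. For `n+1` points of the
unit ball, `simplexDefect_eq` writes `q² = 2L(n(n+1)L - ∑|v_j-v_i|)` as a sum of nonnegative terms.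
So the regular simplex is optimal, and any competitor has edges, Gram matrix and second moment
tensor within `O(q)` of the regular ones. A regular simplex has moment tensor `(n+1)/n` times the
identity; contracting the curvature with it twice gives `((n+1)/n)² Scal`, whatever the orientation.
This is why only the scalar curvature appears.

At radius `ρ` a competitor loses `ρq²/(2L)` to first order and gains at most `Cρ³q` from curvature;
completing the square leaves `O(ρ⁵)` (`exists_sum_distExpansion_le`). The maximal sum over ordered
pairs is therefore `n(n+1)Lρ - ((n+1)/n)² Scal ρ³/(6L)`, up to the `O(ρ⁴)` error of the distances.
Metric and coordinate balls have radii differing by `O(ε⁴)`, so dividing by `n(n+1)` and using `L² =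
2(n+1)/n` gives the theorem (`exists_extent_expansion`).

Independently, `scalarCurvature_eq_scalarContraction` identifies the scalar curvature defined by
Christoffel symbols with the contraction of `R` in an orthonormal frame. -/

section Taylor

/-! ### Taylor expansion and a criterion for cubic vanishing -/

variable {E F : Type*} [NormedAddCommGroup E] [NormedSpace ℝ E]
  [NormedAddCommGroup F] [NormedSpace ℝ F]

/-- Integrating a bound on the derivative gains one order of vanishing. -/
theorem isBigO_norm_pow_succ_of_fderiv {f : E → F} {k : ℕ}
    (hf : ∀ᶠ z in 𝓝 (0 : E), DifferentiableAt ℝ f z) (h0 : f 0 = 0)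
    (h : fderiv ℝ f =O[𝓝 0] fun z ↦ ‖z‖ ^ k) :
    f =O[𝓝 0] fun z ↦ ‖z‖ ^ (k + 1) := by
  obtain ⟨C, hC⟩ := h.bound
  obtain ⟨r, hr, hball⟩ := Metric.eventually_nhds_iff_ball.1 (hf.and hC)
  refine IsBigO.of_bound C ?_
  filter_upwards [Metric.ball_mem_nhds (0 : E) hr] with z hz
  have hz' : ‖z‖ < r := by simpa using hz
  have hsub : Metric.closedBall (0 : E) ‖z‖ ⊆ Metric.ball 0 r :=
    Metric.closedBall_subset_ball hz'
  have hCz : 0 ≤ C * ‖z‖ ^ k := by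
    have := (hball z hz).2
    rw [Real.norm_of_nonneg (by positivity)] at this
    exact (norm_nonneg _).trans this
  have key := (convex_closedBall (0 : E) ‖z‖).norm_image_sub_le_of_norm_fderiv_le (𝕜 := ℝ)
    (f := f) (C := C * ‖z‖ ^ k) (x := 0) (y := z) (fun y hy ↦ (hball y (hsub hy)).1)
    (fun y hy ↦ by
      have h1 := (hball y (hsub hy)).2
      rw [Real.norm_of_nonneg (by positivity)] at h1
      have hy' : ‖y‖ ≤ ‖z‖ := by simpa using hy
      -- The constant supplied by `IsBigO.bound` may be negative; the bound then forces `‖z‖ ^ k =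
      -- 0`.
      rcases le_or_gt 0 C with hC0 | hC0
      · exact h1.trans (by gcongr)
      · have hz0 : ‖z‖ ^ k ≤ 0 := by
          by_contra hcon
          push Not at hcon
          nlinarith
        have : ‖y‖ ^ k ≤ ‖z‖ ^ k := by gcongr
        have h2 : ‖y‖ ^ k = 0 := le_antisymm (this.trans hz0) (by positivity)
        have h3 : ‖z‖ ^ k = 0 := le_antisymm hz0 (by positivity)
        rw [h3, mul_zero]
        rwa [h2, mul_zero] at h1)
    (by simp) (by simp)
  rw [h0, sub_zero, sub_zero] at key
  rw [Real.norm_of_nonneg (by positivity), pow_succ, ← mul_assoc]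
  exact key

set_option synthInstance.maxHeartbeats 200000 in
/-- Second order Taylor expansion with cubic remainder. -/
theorem ContDiffAt.isBigO_sub_taylor_two {f : E → F} (hf : ContDiffAt ℝ 3 f 0) :
    (fun z ↦ f z - f 0 - fderiv ℝ f 0 z - (1 / 2 : ℝ) • fderiv ℝ (fderiv ℝ f) 0 z z)
      =O[𝓝 0] fun z ↦ ‖z‖ ^ 3 := by
  have hf1 : ContDiffAt ℝ 2 (fderiv ℝ f) 0 := hf.fderiv_right (by norm_num)
  have hf2 : ContDiffAt ℝ 1 (fderiv ℝ (fderiv ℝ f)) 0 := hf1.fderiv_right (by norm_num)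
  have hd0 : ∀ᶠ z in 𝓝 (0 : E), DifferentiableAt ℝ f z :=
    (hf.eventually (by simp)).mono fun z hz ↦ hz.differentiableAt (by simp)
  have hd1 : ∀ᶠ z in 𝓝 (0 : E), DifferentiableAt ℝ (fderiv ℝ f) z :=
    (hf1.eventually (by simp)).mono fun z hz ↦ hz.differentiableAt (by simp)
  set D := fderiv ℝ (fderiv ℝ f) 0 with hD
  have hsymm : ∀ v w, D v w = D w v := fun v w ↦
    (hf.isSymmSndFDerivAt (by simp; norm_num)).eq v w
  -- The order-gaining lemma is applied twice: here to the remainder of `f'`, whose derivative `f''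
  -- - f''(0)` is `O(‖z‖)` because `f''` is differentiable at `0`, and then to the remainder of `f`.
  have e1 : (fun z ↦ fderiv ℝ f z - fderiv ℝ f 0 - D z) =O[𝓝 0] fun z ↦ ‖z‖ ^ (1 + 1) := by
    apply isBigO_norm_pow_succ_of_fderiv
    · filter_upwards [hd1] with z hz
      fun_prop
    · simp
    · have : (fun z ↦ fderiv ℝ (fderiv ℝ f) z - D) =O[𝓝 0] fun z : E ↦ ‖z‖ ^ 1 := by
        have := (hf2.differentiableAt (by simp)).isBigO_sub
        simpa using this.norm_right
      refine this.congr' ?_ EventuallyEq.rfl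
      filter_upwards [hd1] with z hz
      have : HasFDerivAt (fun z ↦ fderiv ℝ f z - fderiv ℝ f 0 - D z)
          (fderiv ℝ (fderiv ℝ f) z - D) z :=
        (hz.hasFDerivAt.sub_const _).sub D.hasFDerivAt
      exact this.fderiv.symm
  apply isBigO_norm_pow_succ_of_fderiv (k := 2)
  · filter_upwards [hd0] with z hz
    fun_prop
  · simp
  · refine e1.congr' ?_ EventuallyEq.rfl
    filter_upwards [hd0] with z hz
    have hq : HasFDerivAt (fun z ↦ D z z) ((D z) + D.flip z) z := by
      have := D.hasFDerivAt.clm_apply (hasFDerivAt_id z)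
      refine this.congr_fderiv ?_
      ext v; simp
    have : HasFDerivAt (fun z ↦ f z - f 0 - fderiv ℝ f 0 z - (1 / 2 : ℝ) • D z z)
        (fderiv ℝ f z - fderiv ℝ f 0 - D z) z := by
      refine (((hz.hasFDerivAt.sub_const _).sub (fderiv ℝ f 0).hasFDerivAt).sub
        (hq.const_smul (1 / 2 : ℝ))).congr_fderiv ?_
      ext v
      simp only [sub_apply, smul_apply,
        add_apply, ContinuousLinearMap.flip_apply, hsymm v z]
      module
    exact this.fderiv.symm

/-- The coefficients are peeled off one at a time: the limit at `0` kills `a`, and dividing by `t`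
on the punctured neighbourhood reduces `b`, then `c`, to the same argument. -/
theorem eq_zero_of_isBigO_cube {a b c : F}
    (h : (fun t : ℝ ↦ a + t • b + t ^ 2 • c) =O[𝓝 0] fun t : ℝ ↦ t ^ 3) :
    a = 0 ∧ b = 0 ∧ c = 0 := by
  have ha : a = 0 := by
    have h1 : Tendsto (fun t : ℝ ↦ a + t • b + t ^ 2 • c) (𝓝 0) (𝓝 0) :=
      h.trans_tendsto (by simpa using (continuous_pow 3 (M := ℝ)).tendsto 0)
    have h2 : Tendsto (fun t : ℝ ↦ a + t • b + t ^ 2 • c) (𝓝 0) (𝓝 a) := by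
      have : Continuous (fun t : ℝ ↦ a + t • b + t ^ 2 • c) := by fun_prop
      simpa using this.tendsto 0
    exact tendsto_nhds_unique h2 h1
  have step : ∀ (p : ℝ → F) (k : ℕ), Continuous p →
      (fun t : ℝ ↦ t • p t) =O[𝓝 0] (fun t : ℝ ↦ t ^ (k + 2)) →
      p 0 = 0 := by
    intro p k hp hO
    have hO' : p =O[𝓝[≠] 0] fun t : ℝ ↦ t ^ (k + 1) := by
      have h3 := (isBigO_refl (fun t : ℝ ↦ t⁻¹) (𝓝[≠] 0)).smul (hO.mono nhdsWithin_le_nhds)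
      refine h3.congr' ?_ ?_
      · filter_upwards [self_mem_nhdsWithin] with t ht
        simp only [mem_compl_iff, mem_singleton_iff] at ht
        rw [smul_smul, inv_mul_cancel₀ ht, one_smul]
      · filter_upwards [self_mem_nhdsWithin] with t ht
        simp only [mem_compl_iff, mem_singleton_iff] at ht
        simp only [smul_eq_mul]
        field_simp
        ring
    have h1 : Tendsto p (𝓝[≠] 0) (𝓝 0) :=
      hO'.trans_tendsto
        ((by simpa using (continuous_pow (k + 1) (M := ℝ)).tendsto 0 :
          Tendsto (fun t : ℝ ↦ t ^ (k + 1)) (𝓝 0) (𝓝 0)).mono_left nhdsWithin_le_nhds)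
    exact tendsto_nhds_unique ((hp.tendsto 0).mono_left nhdsWithin_le_nhds) h1
  subst ha
  have hb : b = 0 := by
    have := step (fun t ↦ b + t • c) 1 (by fun_prop) (h.congr_left fun t ↦ by module)
    simpa using this
  subst hb
  refine ⟨rfl, rfl, ?_⟩
  have h3 : (fun t : ℝ ↦ t • c) =O[𝓝[≠] 0] fun t : ℝ ↦ t ^ 2 := by
    have h3 := (isBigO_refl (fun t : ℝ ↦ t⁻¹) (𝓝[≠] 0)).smul (h.mono nhdsWithin_le_nhds)
    refine h3.congr' ?_ ?_
    · filter_upwards [self_mem_nhdsWithin] with t ht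
      simp only [mem_compl_iff, mem_singleton_iff] at ht
      simp only [smul_zero, zero_add, add_zero, smul_smul]
      congr 1
      field_simp
    · filter_upwards [self_mem_nhdsWithin] with t ht
      simp only [mem_compl_iff, mem_singleton_iff] at ht
      simp only [smul_eq_mul]
      field_simp
  -- Both sides vanish at `t = 0`, so the bound extends from the punctured neighbourhood.
  have h4 : (fun t : ℝ ↦ t • c) =O[𝓝 0] fun t : ℝ ↦ t ^ 2 := by
    rw [← nhdsNE_sup_pure (0 : ℝ), isBigO_sup]
    exact ⟨h3, isBigO_pure.2 (by simp)⟩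
  simpa using step (fun _ ↦ c) 0 (by fun_prop) h4

/-- A `C^3` function that is cubically small along every line through `0` is cubically small. -/
theorem ContDiffAt.isBigO_norm_pow_three_of_lines {f : E → F} (hf : ContDiffAt ℝ 3 f 0)
    (h : ∀ z, (fun t : ℝ ↦ f (t • z)) =O[𝓝 0] fun t : ℝ ↦ t ^ 3) :
    f =O[𝓝 0] fun z ↦ ‖z‖ ^ 3 := by
  have hT := hf.isBigO_sub_taylor_two
  -- On each line the Taylor polynomial is itself `O(t³)`, so its coefficients vanish; the second
  -- derivative is needed only on the diagonal.
  have key : ∀ z, f 0 = 0 ∧ fderiv ℝ f 0 z = 0 ∧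
      (1 / 2 : ℝ) • fderiv ℝ (fderiv ℝ f) 0 z z = 0 := by
    intro z
    apply eq_zero_of_isBigO_cube
    have hlim : Tendsto (fun t : ℝ ↦ t • z) (𝓝 0) (𝓝 0) := by
      have : Continuous (fun t : ℝ ↦ t • z) := by fun_prop
      simpa using this.tendsto 0
    have h1 := hT.comp_tendsto hlim
    have h2 : (fun t : ℝ ↦ ‖t • z‖ ^ 3) =O[𝓝 0] fun t : ℝ ↦ t ^ 3 := by
      refine IsBigO.of_bound (‖z‖ ^ 3) (Eventually.of_forall fun t ↦ ?_)
      simp only [norm_smul, norm_pow, norm_mul, norm_norm]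
      rw [mul_pow, mul_comm]
    refine ((h z).sub (h1.trans h2)).congr_left fun t ↦ ?_
    simp only [Function.comp_apply, map_smul, smul_apply]
    module
  refine hT.congr_left fun z ↦ ?_
  obtain ⟨h0, h1, h2⟩ := key z
  rw [h0, h1, h2]; simp

end Taylor

noncomputable section

/-! ### Normal coordinates to third order and the metric in them -/

section NormalCoordinates

variable {n : ℕ}

local notation "⟪" x "," y "⟫" => inner ℝ x y

theorem EuclideanSpace.sum_smul_single (v : EuclideanSpace ℝ (Fin n)) :
    ∑ i, v i • EuclideanSpace.single i (1 : ℝ) = v := by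
  simpa using (EuclideanSpace.basisFun (Fin n) ℝ).sum_repr v

theorem LinearMap.apply_eq_sum_single {V : Type*} [AddCommGroup V] [Module ℝ V]
    (l : EuclideanSpace ℝ (Fin n) →ₗ[ℝ] V) (v : EuclideanSpace ℝ (Fin n)) : l v = ∑ i, v i • l (EuclideanSpace.single i 1) := by
  conv_lhs => rw [← EuclideanSpace.sum_smul_single v]
  simp only [map_sum, map_smul]

/-- Multilinear forms are kept as plain linear maps, so smoothness in all their slots is obtained by
expanding along the standard basis, one slot at a time. -/
theorem ContDiff.linearMap_apply {X : Type*} [NormedAddCommGroup X] [NormedSpace ℝ X]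
    {F : Type*} [NormedAddCommGroup F] [NormedSpace ℝ F]
    {l : X → (EuclideanSpace ℝ (Fin n)) →ₗ[ℝ] F} {A : X → (EuclideanSpace ℝ (Fin n))}
    {k : ℕ∞ω} (hl : ∀ v, ContDiff ℝ k fun z ↦ l z v)
    (hA : ContDiff ℝ k A) : ContDiff ℝ k fun z ↦ l z (A z) := by
  have : (fun z ↦ l z (A z)) = fun z ↦ ∑ i, A z i • l z (EuclideanSpace.single i 1) := by
    funext z
    exact LinearMap.apply_eq_sum_single (l z) (A z)
  rw [this]
  exact ContDiff.sum fun i _ ↦ ((contDiff_euclidean.1 hA i).smul (hl _))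

/-- The vector representing a linear form through the inner product. -/
def sharp : ((EuclideanSpace ℝ (Fin n)) →ₗ[ℝ] ℝ) →ₗ[ℝ] (EuclideanSpace ℝ (Fin n)) where
  toFun l := WithLp.toLp 2 fun i ↦ l (EuclideanSpace.single i 1)
  map_add' l l' := by ext; simp
  map_smul' c l := by ext; simp

theorem inner_sharp (l : (EuclideanSpace ℝ (Fin n)) →ₗ[ℝ] ℝ) (v : EuclideanSpace ℝ (Fin n)) :
    ⟪sharp l, v⟫ = l v := by
  rw [LinearMap.apply_eq_sum_single l v]
  simp [sharp, PiLp.inner_apply]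

/-- The Levi-Civita connection coefficients at a point where the metric is the inner product and
has first derivative `g₁`. -/
def leviCivita (g₁ : EuclideanSpace ℝ (Fin n) →ₗ[ℝ] EuclideanSpace ℝ (Fin n) →ₗ[ℝ]
      EuclideanSpace ℝ (Fin n) →ₗ[ℝ] ℝ) :
    EuclideanSpace ℝ (Fin n) →ₗ[ℝ] EuclideanSpace ℝ (Fin n) →ₗ[ℝ] EuclideanSpace ℝ (Fin n) :=
  LinearMap.mk₂ ℝ
    (fun a b ↦ sharp ((1 / 2 : ℝ) • (g₁ a b + g₁ b a - (g₁.flip a).flip b)))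
    (fun a a' b ↦ by rw [← map_add]; congr 1; ext; simp; ring)
    (fun c a b ↦ by rw [← map_smul]; congr 1; ext; simp; ring)
    (fun a b b' ↦ by rw [← map_add]; congr 1; ext; simp; ring)
    (fun c a b ↦ by rw [← map_smul]; congr 1; ext; simp; ring)

variable
  (g₁ : EuclideanSpace ℝ (Fin n) →ₗ[ℝ] EuclideanSpace ℝ (Fin n) →ₗ[ℝ]
    EuclideanSpace ℝ (Fin n) →ₗ[ℝ] ℝ)
  (g₂ : EuclideanSpace ℝ (Fin n) →ₗ[ℝ] EuclideanSpace ℝ (Fin n) →ₗ[ℝ]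
    EuclideanSpace ℝ (Fin n) →ₗ[ℝ] EuclideanSpace ℝ (Fin n) →ₗ[ℝ] ℝ)

theorem inner_leviCivita (a b c : EuclideanSpace ℝ (Fin n)) :
    ⟪leviCivita g₁ a b, c⟫ = 1 / 2 * (g₁ a b c + g₁ b a c - g₁ c a b) := by
  rw [leviCivita, LinearMap.mk₂_apply, inner_sharp]
  simp

variable {g₁} in
theorem leviCivita_comm (h₁ : ∀ a v w, g₁ a v w = g₁ a w v) (a b : EuclideanSpace ℝ (Fin n)) :
    leviCivita g₁ a b = leviCivita g₁ b a := by
  refine ext_inner_right ℝ fun c ↦ ?_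
  rw [inner_leviCivita, inner_leviCivita, h₁ c a b]
  ring

-- Metric compatibility of the connection; with the torsion-freeness of `leviCivita_comm` it is what
-- the jet computations below use.
variable {g₁} in
theorem inner_leviCivita_add (h₁ : ∀ a v w, g₁ a v w = g₁ a w v)
    (a b c : EuclideanSpace ℝ (Fin n)) :
    ⟪leviCivita g₁ a b, c⟫ + ⟪leviCivita g₁ a c, b⟫ = g₁ a b c := by
  rw [inner_leviCivita, inner_leviCivita, h₁ a c b, h₁ c a b, h₁ b a c]
  ring

/-- The Riemann tensor at a point where the metric is the inner product and has first and second
derivatives `g₁` and `g₂`. -/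
def curvatureOfJet (i j k p : EuclideanSpace ℝ (Fin n)) : ℝ :=
  1 / 2 * (g₂ i k j p - g₂ i p j k - g₂ j k i p + g₂ j p i k)
    - ⟪leviCivita g₁ j k, leviCivita g₁ i p⟫ + ⟪leviCivita g₁ i k, leviCivita g₁ j p⟫

/-- The linear form dual to the cubic term of normal coordinates. -/
def cubicForm (z : EuclideanSpace ℝ (Fin n)) : (EuclideanSpace ℝ (Fin n)) →ₗ[ℝ] ℝ :=
  -- The coefficients are exactly those for which the second-order part of the pulled-back metric
  -- reduces to the curvature in `normalMap_jet_two`.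
  (-(1 / 6) : ℝ) • (g₂ z z z - (1 / 2 : ℝ) • ((g₂ z).flip z).flip z
    - (innerₗ (EuclideanSpace ℝ (Fin n)) (leviCivita g₁ z z)).comp (leviCivita g₁ z)
    - (3 : ℝ) • innerₗ (EuclideanSpace ℝ (Fin n)) (leviCivita g₁ z (leviCivita g₁ z z)))

theorem cubicForm_apply (z p : EuclideanSpace ℝ (Fin n)) :
    cubicForm g₁ g₂ z p = -(1 / 6) * (g₂ z z z p - 1 / 2 * g₂ z p z z
      - ⟪leviCivita g₁ z z, leviCivita g₁ z p⟫
      - 3 * ⟪leviCivita g₁ z (leviCivita g₁ z z), p⟫) := by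
  simp [cubicForm]

/-- The derivative of `cubicForm` in the direction `w`. -/
def cubicFormDeriv (z w p : EuclideanSpace ℝ (Fin n)) : ℝ :=
  -(1 / 6) * (g₂ w z z p + g₂ z w z p + g₂ z z w p
    - 1 / 2 * (g₂ w p z z + g₂ z p w z + g₂ z p z w)
    - (⟪leviCivita g₁ w z + leviCivita g₁ z w, leviCivita g₁ z p⟫
      + ⟪leviCivita g₁ z z, leviCivita g₁ w p⟫)
    - 3 * ⟪leviCivita g₁ w (leviCivita g₁ z z)
      + leviCivita g₁ z (leviCivita g₁ w z + leviCivita g₁ z w), p⟫)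

/-- Normal coordinates up to order three. -/
def normalMap (z : EuclideanSpace ℝ (Fin n)) : (EuclideanSpace ℝ (Fin n)) :=
  z - (1 / 2 : ℝ) • leviCivita g₁ z z + sharp (cubicForm g₁ g₂ z)

theorem contDiff_leviCivita_diag {k : ℕ∞ω} : ContDiff ℝ k (fun z ↦ leviCivita g₁ z z) :=
  ContDiff.linearMap_apply (l := fun z ↦ leviCivita g₁ z)
    (fun v ↦ ContDiff.linearMap_apply (l := fun _ ↦ (leviCivita g₁).flip v)
      (fun _ ↦ contDiff_const) contDiff_id) contDiff_id

theorem contDiff_leviCivita_left {k : ℕ∞ω} (v : EuclideanSpace ℝ (Fin n)) :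
    ContDiff ℝ k (fun z ↦ leviCivita g₁ z v) :=
  ContDiff.linearMap_apply (l := fun _ ↦ (leviCivita g₁).flip v)
      (fun _ ↦ contDiff_const) contDiff_id

theorem contDiff_cubicForm {k : ℕ∞ω} (p : EuclideanSpace ℝ (Fin n)) :
    ContDiff ℝ k (fun z ↦ cubicForm g₁ g₂ z p) := by
  simp only [cubicForm_apply]
  have h1 : ContDiff ℝ k (fun z ↦ g₂ z z z p) :=
    ContDiff.linearMap_apply (l := fun z ↦ (g₂ z z).flip p) (fun c ↦
      ContDiff.linearMap_apply (l := fun z ↦ ((g₂ z).flip c).flip p) (fun b ↦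
        ContDiff.linearMap_apply (l := fun _ ↦ ((g₂.flip b).flip c).flip p)
        (fun _ ↦ contDiff_const) contDiff_id) contDiff_id) contDiff_id
  have h2 : ContDiff ℝ k (fun z ↦ g₂ z p z z) :=
    ContDiff.linearMap_apply (l := fun z ↦ g₂ z p z) (fun c ↦
      ContDiff.linearMap_apply (l := fun z ↦ (g₂ z p).flip c) (fun b ↦
        ContDiff.linearMap_apply (l := fun _ ↦ ((g₂.flip p).flip b).flip c)
        (fun _ ↦ contDiff_const) contDiff_id) contDiff_id) contDiff_id
  have h3 : ContDiff ℝ k (fun z ↦ ⟪leviCivita g₁ z z, leviCivita g₁ z p⟫) :=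
    (contDiff_leviCivita_diag g₁).inner ℝ (contDiff_leviCivita_left g₁ p)
  have h4 : ContDiff ℝ k (fun z ↦ ⟪leviCivita g₁ z (leviCivita g₁ z z), p⟫) :=
    (ContDiff.linearMap_apply (l := fun z ↦ leviCivita g₁ z) (contDiff_leviCivita_left g₁)
      (contDiff_leviCivita_diag g₁)).inner ℝ contDiff_const
  exact contDiff_const.mul (((h1.sub (contDiff_const.mul h2)).sub h3).sub (contDiff_const.mul h4))

theorem contDiff_normalMap {k : ℕ∞ω} : ContDiff ℝ k (normalMap g₁ g₂) := by
  have h : ContDiff ℝ k (fun z ↦ sharp (cubicForm g₁ g₂ z)) :=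
    contDiff_euclidean.2 fun i ↦ contDiff_cubicForm g₁ g₂ (EuclideanSpace.single i 1)
  exact (contDiff_id.sub ((contDiff_leviCivita_diag g₁).const_smul (1 / 2 : ℝ))).add h

/-- The form is a homogeneous cubic in its point, so the `s²` coefficient is the derivative with the
roles of `z` and `w` exchanged. The derivative of `normalMap` can then be read off as the
coefficient of `s`. -/
theorem cubicForm_line (z w p : EuclideanSpace ℝ (Fin n)) (s : ℝ) :
    cubicForm g₁ g₂ (z + s • w) p = cubicForm g₁ g₂ z p + s * cubicFormDeriv g₁ g₂ z w p
      + s ^ 2 * cubicFormDeriv g₁ g₂ w z p + s ^ 3 * cubicForm g₁ g₂ w p := by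
  simp only [cubicForm_apply, cubicFormDeriv, map_add, map_smul, LinearMap.add_apply,
    LinearMap.smul_apply, inner_add_left, inner_add_right, inner_smul_left, inner_smul_right,
    smul_eq_mul, conj_trivial, smul_add]
  ring

theorem inner_fderiv_normalMap (h₁ : ∀ a v w, g₁ a v w = g₁ a w v)
    (y w p : EuclideanSpace ℝ (Fin n)) :
    ⟪fderiv ℝ (normalMap g₁ g₂) y w, p⟫
      = ⟪w, p⟫ - ⟪leviCivita g₁ y w, p⟫ + cubicFormDeriv g₁ g₂ y w p := by
  have hc : HasDerivAt (fun s : ℝ ↦ y + s • w) w 0 := by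
    simpa using ((hasDerivAt_id (0 : ℝ)).smul_const w).const_add y
  have hd : HasFDerivAt (normalMap g₁ g₂) (fderiv ℝ (normalMap g₁ g₂) y) (y + (0 : ℝ) • w) := by
    simpa using ((contDiff_normalMap g₁ g₂ (k := 1)).differentiable (by simp) y).hasFDerivAt
  have hB := (hd.comp_hasDerivAt 0 hc).inner ℝ (hasDerivAt_const (0 : ℝ) p)
  -- Along the line the map is a cubic polynomial in `s`; torsion-freeness merges the two mixed
  -- quadratic terms.
  have hA : HasDerivAt (fun s : ℝ ↦ ⟪normalMap g₁ g₂ (y + s • w), p⟫)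
      (⟪w, p⟫ - ⟪leviCivita g₁ y w, p⟫ + cubicFormDeriv g₁ g₂ y w p) 0 := by
    have hpoly : ∀ a b c d : ℝ, HasDerivAt (fun s : ℝ ↦ a + s * b + s ^ 2 * c + s ^ 3 * d) b 0 := by
      intro a b c d
      have h1 := ((((hasDerivAt_id (0 : ℝ)).mul_const b).const_add a).fun_add
        (((hasDerivAt_id (0 : ℝ)).fun_pow 2).mul_const c)).fun_add
        (((hasDerivAt_id (0 : ℝ)).fun_pow 3).mul_const d)
      simpa using h1
    refine (hpoly ⟪normalMap g₁ g₂ y, p⟫ _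
      (-(1 / 2) * ⟪leviCivita g₁ w w, p⟫ + cubicFormDeriv g₁ g₂ w y p)
      (cubicForm g₁ g₂ w p)).congr_of_eventuallyEq (Eventually.of_forall fun s ↦ ?_)
    simp only [normalMap, inner_add_left, inner_sub_left, inner_sharp, cubicForm_line,
      map_add, map_smul, LinearMap.add_apply, LinearMap.smul_apply, inner_smul_left,
      leviCivita_comm h₁ w y, conj_trivial]
    ring
  have := hB.unique hA
  simpa using this

theorem fderiv_normalMap_zero (h₁ : ∀ a v w, g₁ a v w = g₁ a w v) :
    fderiv ℝ (normalMap g₁ g₂) 0 = ContinuousLinearMap.id ℝ (EuclideanSpace ℝ (Fin n)) := by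
  ext1 w
  refine ext_inner_right ℝ fun p ↦ ?_
  rw [inner_fderiv_normalMap g₁ g₂ h₁]
  simp [cubicFormDeriv]

theorem normalMap_zero : normalMap g₁ g₂ 0 = 0 := by
  refine ext_inner_right ℝ fun p ↦ ?_
  simp [normalMap, inner_sharp, cubicForm_apply]

theorem normalMap_smul (t : ℝ) (z : EuclideanSpace ℝ (Fin n)) :
    normalMap g₁ g₂ (t • z) = t • z + t ^ 2 • (-(1 / 2 : ℝ) • leviCivita g₁ z z)
      + t ^ 3 • sharp (cubicForm g₁ g₂ z) := by
  refine ext_inner_right ℝ fun p ↦ ?_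
  simp [normalMap, inner_add_left, inner_sub_left, inner_sharp, cubicForm_apply, inner_smul_left,
    inner_smul_right]
  ring

theorem fderiv_normalMap_apply (h₁ : ∀ a v w, g₁ a v w = g₁ a w v)
    (z w : EuclideanSpace ℝ (Fin n)) :
    ∃ X : (EuclideanSpace ℝ (Fin n)), (∀ p, ⟪X, p⟫ = cubicFormDeriv g₁ g₂ z w p) ∧
      ∀ t : ℝ, fderiv ℝ (normalMap g₁ g₂) (t • z) w
        = w + t • (-leviCivita g₁ z w) + t ^ 2 • X := by
  -- The derivative along a ray is quadratic in `t`; its top coefficient is found by subtracting the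
  -- lower ones at `t = 1`.
  refine ⟨fderiv ℝ (normalMap g₁ g₂) z w - (w - leviCivita g₁ z w), fun p ↦ ?_, fun t ↦ ?_⟩
  · rw [inner_sub_left, inner_fderiv_normalMap g₁ g₂ h₁, inner_sub_left]; ring
  · refine ext_inner_right ℝ fun p ↦ ?_
    rw [inner_fderiv_normalMap g₁ g₂ h₁, inner_add_left _ (t ^ 2 • _), inner_smul_left,
      inner_sub_left (fderiv ℝ _ _ _), inner_fderiv_normalMap g₁ g₂ h₁]
    simp [cubicFormDeriv, inner_sub_left, inner_add_left, inner_smul_left, inner_smul_right]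
    ring

theorem isBigO_pow_three_mul {q : ℝ → ℝ} (hq : Continuous q) :
    (fun t : ℝ ↦ t ^ 3 * q t) =O[𝓝 0] fun t : ℝ ↦ t ^ 3 := by
  simpa using (isBigO_refl (fun t : ℝ ↦ t ^ 3) (𝓝 0)).mul ((hq.tendsto 0).isBigO_one ℝ)

variable {g₁ g₂} in
/-- Expansion of a metric along a curve `t z + t² b + t³ c`. -/
theorem metric_curve_expansion
    {G : (EuclideanSpace ℝ (Fin n)) →
      (EuclideanSpace ℝ (Fin n)) →ₗ[ℝ] (EuclideanSpace ℝ (Fin n)) →ₗ[ℝ] ℝ}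
    (hsm : ∀ v w, ContDiffAt ℝ 3 (fun z ↦ G z v w) 0) (h0 : ∀ v w, G 0 v w = ⟪v, w⟫)
    (hg₁ : ∀ a v w, fderiv ℝ (fun z ↦ G z v w) 0 a = g₁ a v w)
    (hg₂ : ∀ a b v w, fderiv ℝ (fderiv ℝ fun z ↦ G z v w) 0 a b = g₂ a b v w)
    (z b c v w : EuclideanSpace ℝ (Fin n)) :
    (fun t : ℝ ↦ G (t • z + t ^ 2 • b + t ^ 3 • c) v w
      - (⟪v, w⟫ + t * g₁ z v w + t ^ 2 * (g₁ b v w + 1 / 2 * g₂ z z v w)))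
      =O[𝓝 0] fun t : ℝ ↦ t ^ 3 := by
  have hcont : Continuous (fun t : ℝ ↦ t • z + t ^ 2 • b + t ^ 3 • c) := by fun_prop
  have hlim : Tendsto (fun t : ℝ ↦ t • z + t ^ 2 • b + t ^ 3 • c) (𝓝 0) (𝓝 0) := by
    simpa using hcont.tendsto 0
  have h1 := (hsm v w).isBigO_sub_taylor_two.comp_tendsto hlim
  have h2 : (fun t : ℝ ↦ ‖t • z + t ^ 2 • b + t ^ 3 • c‖ ^ 3) =O[𝓝 0] fun t : ℝ ↦ t ^ 3 := by
    refine (IsBigO.norm_left ?_).pow 3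
    have h3 : (fun t : ℝ ↦ t • (z + t • b + t ^ 2 • c)) =O[𝓝 0] fun t : ℝ ↦ t • (1 : ℝ) := by
      refine (isBigO_refl (fun t : ℝ ↦ t) (𝓝 0)).smul ?_
      exact (Continuous.continuousAt (by fun_prop)).isBigO_one ℝ
    refine h3.congr (fun t ↦ by module) (fun t ↦ by simp)
  -- The added polynomial collects the terms of order at least three produced by substituting the
  -- curve into the second-order Taylor polynomial.
  have h4 := (h1.trans h2).add (isBigO_pow_three_mul (q := fun t ↦ g₁ c v w
    + 1 / 2 * (g₂ z b v w + g₂ b z v w)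
    + t * (1 / 2 * (g₂ b b v w + g₂ z c v w + g₂ c z v w))
    + t ^ 2 * (1 / 2 * (g₂ b c v w + g₂ c b v w))
    + t ^ 3 * (1 / 2 * g₂ c c v w)) (by fun_prop))
  refine h4.congr_left fun t ↦ ?_
  simp only [Function.comp_apply, hg₁, hg₂, h0, map_add, map_smul, LinearMap.add_apply,
    LinearMap.smul_apply, smul_eq_mul]
  ring

-- The coefficient of `t` in the metric pulled back along a ray; it vanishes by metric
-- compatibility.
variable {g₁ g₂} in
theorem normalMap_jet_one (h₁ : ∀ a v w, g₁ a v w = g₁ a w v) (z w : EuclideanSpace ℝ (Fin n)) :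
    g₁ z w w - 2 * ⟪leviCivita g₁ z w, w⟫ = 0 := by
  rw [← inner_leviCivita_add h₁ z w w]; ring

-- The coefficient of `t²` in the metric pulled back along a ray. The choice of `cubicForm` cancels
-- everything except the curvature.
variable {g₁ g₂} in
theorem normalMap_jet_two (h₁ : ∀ a v w, g₁ a v w = g₁ a w v)
    (h₂ : ∀ a b v w, g₂ a b v w = g₂ b a v w) (h₂' : ∀ a b v w, g₂ a b v w = g₂ a b w v)
    (z w : EuclideanSpace ℝ (Fin n)) :
    g₁ (-(1 / 2 : ℝ) • leviCivita g₁ z z) w w + 1 / 2 * g₂ z z w w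
      - 2 * g₁ z w (leviCivita g₁ z w) + ⟪leviCivita g₁ z w, leviCivita g₁ z w⟫
      + 2 * cubicFormDeriv g₁ g₂ z w w = - curvatureOfJet g₁ g₂ w z z w / 3 := by
  rw [map_smul, LinearMap.smul_apply, LinearMap.smul_apply, smul_eq_mul,
    ← inner_leviCivita_add h₁ (leviCivita g₁ z z) w w,
    ← inner_leviCivita_add h₁ z w (leviCivita g₁ z w), cubicFormDeriv, curvatureOfJet,
    leviCivita_comm h₁ w z, leviCivita_comm h₁ w (leviCivita g₁ z z), h₂ w z z w, h₂' z w z w]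
  simp only [inner_add_left, map_add]
  ring

/-- A form with the linearity and antisymmetries of a Riemann curvature tensor. -/
structure IsCurvatureLike
    (R : EuclideanSpace ℝ (Fin n) → EuclideanSpace ℝ (Fin n) → EuclideanSpace ℝ (Fin n) →
      EuclideanSpace ℝ (Fin n) → ℝ) : Prop where
  lin₁ : ∀ b c d, IsLinearMap ℝ fun a ↦ R a b c d
  lin₃ : ∀ a b d, IsLinearMap ℝ fun c ↦ R a b c d
  anti₁₂ : ∀ a b c d, R a b c d = -R b a c d
  anti₃₄ : ∀ a b c d, R a b c d = -R a b d c

theorem isCurvatureLike_curvatureOfJet : IsCurvatureLike (curvatureOfJet g₁ g₂) where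
  lin₁ b c d := by
    constructor <;> intros <;>
      simp only [curvatureOfJet, map_add, map_smul, LinearMap.add_apply, LinearMap.smul_apply,
        inner_add_left, inner_add_right, inner_smul_left, inner_smul_right, smul_eq_mul,
        conj_trivial] <;> ring
  lin₃ b c d := by
    constructor <;> intros <;>
      simp only [curvatureOfJet, map_add, map_smul, LinearMap.add_apply, LinearMap.smul_apply,
        inner_add_left, inner_add_right, inner_smul_left, inner_smul_right, smul_eq_mul,
        conj_trivial] <;> ring
  anti₁₂ a b c d := by simp only [curvatureOfJet]; ring
  anti₃₄ a b c d := by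
    simp only [curvatureOfJet]
    rw [real_inner_comm (leviCivita g₁ b c), real_inner_comm (leviCivita g₁ b d)]
    ring

namespace IsCurvatureLike

variable {R : EuclideanSpace ℝ (Fin n) → EuclideanSpace ℝ (Fin n) → EuclideanSpace ℝ (Fin n) →
      EuclideanSpace ℝ (Fin n) → ℝ} (hR : IsCurvatureLike R)

theorem lin₂ (hR : IsCurvatureLike R) (a c d) : IsLinearMap ℝ fun b ↦ R a b c d := by
  have h := hR.lin₁ a c d
  constructor
  · intro x y; rw [hR.anti₁₂, h.map_add, hR.anti₁₂ a x, hR.anti₁₂ a y]; ring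
  · intro s x; rw [hR.anti₁₂, h.map_smul, hR.anti₁₂ a x]; simp

theorem lin₄ (hR : IsCurvatureLike R) (a b c) : IsLinearMap ℝ fun d ↦ R a b c d := by
  have h := hR.lin₃ a b c
  constructor
  · intro x y; rw [hR.anti₃₄, h.map_add, hR.anti₃₄ a b c x, hR.anti₃₄ a b c y]; ring
  · intro s x; rw [hR.anti₃₄, h.map_smul, hR.anti₃₄ a b c x]; simp

theorem self₁₂ (hR : IsCurvatureLike R) (a c d) : R a a c d = 0 := by
  have := hR.anti₁₂ a a c d; linarith

theorem self₃₄ (hR : IsCurvatureLike R) (a b c) : R a b c c = 0 := by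
  have := hR.anti₃₄ a b c c; linarith

/-- The bilinear form in the outer arguments. -/
def outer (hR : IsCurvatureLike R) (b c : EuclideanSpace ℝ (Fin n)) :
    EuclideanSpace ℝ (Fin n) →ₗ[ℝ] EuclideanSpace ℝ (Fin n) →ₗ[ℝ] ℝ :=
  LinearMap.mk₂ ℝ (fun a d ↦ R a b c d) (fun x y d ↦ (hR.lin₁ b c d).map_add x y)
    (fun s x d ↦ (hR.lin₁ b c d).map_smul s x) (fun a x y ↦ (hR.lin₄ a b c).map_add x y)
    (fun s a x ↦ (hR.lin₄ a b c).map_smul s x)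

/-- The bilinear form in the inner arguments. -/
def inner₂₃ (hR : IsCurvatureLike R) (a d : EuclideanSpace ℝ (Fin n)) :
    EuclideanSpace ℝ (Fin n) →ₗ[ℝ] EuclideanSpace ℝ (Fin n) →ₗ[ℝ] ℝ :=
  LinearMap.mk₂ ℝ (fun b c ↦ R a b c d) (fun x y c ↦ (hR.lin₂ a c d).map_add x y)
    (fun s x c ↦ (hR.lin₂ a c d).map_smul s x) (fun b x y ↦ (hR.lin₃ a b d).map_add x y)
    (fun s b x ↦ (hR.lin₃ a b d).map_smul s x)

theorem add₁ (hR : IsCurvatureLike R) (a a' b c d) :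
    R (a + a') b c d = R a b c d + R a' b c d := (hR.lin₁ b c d).map_add a a'
theorem add₂ (hR : IsCurvatureLike R) (a b b' c d) :
    R a (b + b') c d = R a b c d + R a b' c d := (hR.lin₂ a c d).map_add b b'
theorem add₃ (hR : IsCurvatureLike R) (a b c c' d) :
    R a b (c + c') d = R a b c d + R a b c' d := (hR.lin₃ a b d).map_add c c'
theorem add₄ (hR : IsCurvatureLike R) (a b c d d') :
    R a b c (d + d') = R a b c d + R a b c d' := (hR.lin₄ a b c).map_add d d'
theorem smul₁ (hR : IsCurvatureLike R) (s : ℝ) (a b c d) :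
    R (s • a) b c d = s * R a b c d := (hR.lin₁ b c d).map_smul s a
theorem smul₂ (hR : IsCurvatureLike R) (s : ℝ) (a b c d) :
    R a (s • b) c d = s * R a b c d := (hR.lin₂ a c d).map_smul s b
theorem smul₃ (hR : IsCurvatureLike R) (s : ℝ) (a b c d) :
    R a b (s • c) d = s * R a b c d := (hR.lin₃ a b d).map_smul s c
theorem smul₄ (hR : IsCurvatureLike R) (s : ℝ) (a b c d) :
    R a b c (s • d) = s * R a b c d := (hR.lin₄ a b c).map_smul s d

end IsCurvatureLike

theorem abs_le_norm_mul_sum_of_linear (l : EuclideanSpace ℝ (Fin n) →ₗ[ℝ] ℝ)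
    (v : EuclideanSpace ℝ (Fin n)) :
    |l v| ≤ (∑ i, |l (EuclideanSpace.single i 1)|) * ‖v‖ := by
  rw [LinearMap.apply_eq_sum_single l v, Finset.sum_mul]
  refine (Finset.abs_sum_le_sum_abs _ _).trans (Finset.sum_le_sum fun i _ ↦ ?_)
  rw [smul_eq_mul, abs_mul, mul_comm]
  gcongr
  exact PiLp.norm_apply_le v i

theorem IsCurvatureLike.exists_bound
    {R : EuclideanSpace ℝ (Fin n) → EuclideanSpace ℝ (Fin n) → EuclideanSpace ℝ (Fin n) →
      EuclideanSpace ℝ (Fin n) → ℝ} (hR : IsCurvatureLike R) :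
    ∃ C, 0 ≤ C ∧ ∀ a b c d, |R a b c d| ≤ C * ‖a‖ * ‖b‖ * ‖c‖ * ‖d‖ := by
  let e : Fin n → EuclideanSpace ℝ (Fin n) := fun i ↦ EuclideanSpace.single i 1
  refine ⟨∑ i, ∑ j, ∑ k, ∑ l, |R (e l) (e k) (e j) (e i)|, by positivity, fun a b c d ↦ ?_⟩
  have h1 : ∀ b c d, |R a b c d| ≤ (∑ i, |R (e i) b c d|) * ‖a‖ := fun b c d ↦
    abs_le_norm_mul_sum_of_linear ((hR.lin₁ b c d).mk' _) a
  have h2 : ∀ x c d, |R x b c d| ≤ (∑ i, |R x (e i) c d|) * ‖b‖ := fun x c d ↦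
    abs_le_norm_mul_sum_of_linear ((hR.lin₂ x c d).mk' _) b
  have h3 : ∀ x y d, |R x y c d| ≤ (∑ i, |R x y (e i) d|) * ‖c‖ := fun x y d ↦
    abs_le_norm_mul_sum_of_linear ((hR.lin₃ x y d).mk' _) c
  have h4 : ∀ x y z, |R x y z d| ≤ (∑ i, |R x y z (e i)|) * ‖d‖ := fun x y z ↦
    abs_le_norm_mul_sum_of_linear ((hR.lin₄ x y z).mk' _) d
  calc |R a b c d| ≤ (∑ i, |R a b c (e i)|) * ‖d‖ := h4 a b c
    _ ≤ (∑ i, (∑ j, |R a b (e j) (e i)|) * ‖c‖) * ‖d‖ := by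
        gcongr with i; exact h3 _ _ _
    _ ≤ (∑ i, (∑ j, (∑ k, |R a (e k) (e j) (e i)|) * ‖b‖) * ‖c‖) * ‖d‖ := by
        gcongr with i _ j; exact h2 _ _ _
    _ ≤ (∑ i, (∑ j, (∑ k, (∑ l, |R (e l) (e k) (e j) (e i)|) * ‖a‖) * ‖b‖) * ‖c‖) * ‖d‖ := by
        gcongr with i _ j _ k; exact h1 _ _ _
    _ = _ := by simp only [← Finset.sum_mul]

/-- A pointwise cubic bound on a family of quadratic forms is uniform. -/
theorem exists_bound_of_quadratic_isBigO
    {B : EuclideanSpace ℝ (Fin n) →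
      EuclideanSpace ℝ (Fin n) →ₗ[ℝ] EuclideanSpace ℝ (Fin n) →ₗ[ℝ] ℝ}
    (h : ∀ w, (fun z ↦ B z w w) =O[𝓝 0] fun z ↦ ‖z‖ ^ 3) :
    ∃ C, 0 ≤ C ∧ ∀ᶠ z in 𝓝 0, ∀ w, |B z w w| ≤ C * ‖z‖ ^ 3 * ‖w‖ ^ 2 := by
  let e : Fin n → EuclideanSpace ℝ (Fin n) := fun i ↦ EuclideanSpace.single i 1
  -- Polarization: the values on `e i + e j`, `e i` and `e j` control the symmetrized entries. `B`
  -- need not be symmetric, but only these entries enter `B z w w`.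
  have hij : ∀ i j, ∃ C, 0 ≤ C ∧ ∀ᶠ z in 𝓝 0,
      |B z (e i) (e j) + B z (e j) (e i)| ≤ C * ‖z‖ ^ 3 := by
    intro i j
    have h1 : (fun z ↦ B z (e i) (e j) + B z (e j) (e i)) =O[𝓝 0] fun z ↦ ‖z‖ ^ 3 := by
      refine (((h (e i + e j)).sub (h (e i))).sub (h (e j))).congr_left fun z ↦ ?_
      simp only [map_add, LinearMap.add_apply]
      ring
    obtain ⟨C, hC, hb⟩ := h1.exists_nonneg
    refine ⟨C, hC, hb.bound.mono fun z hz ↦ ?_⟩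
    simpa using hz
  choose C hC0 hC using hij
  refine ⟨∑ i, ∑ j, C i j / 2, Finset.sum_nonneg fun i _ ↦ Finset.sum_nonneg fun j _ ↦ by
    linarith [hC0 i j], ?_⟩
  have hall : ∀ᶠ z in 𝓝 (0 : EuclideanSpace ℝ (Fin n)), ∀ i j,
      |B z (e i) (e j) + B z (e j) (e i)| ≤ C i j * ‖z‖ ^ 3 :=
    eventually_all.2 fun i ↦ eventually_all.2 fun j ↦ hC i j
  filter_upwards [hall] with z hz w
  have hexp : B z w w = ∑ i, ∑ j, w i * w j * ((B z (e i) (e j) + B z (e j) (e i)) / 2) := by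
    have h1 : B z w w = ∑ i, ∑ j, w i * w j * B z (e i) (e j) := by
      rw [LinearMap.apply_eq_sum_single (B z) w, LinearMap.sum_apply]
      refine Finset.sum_congr rfl fun i _ ↦ ?_
      rw [LinearMap.smul_apply, LinearMap.apply_eq_sum_single (B z _) w, Finset.smul_sum]
      refine Finset.sum_congr rfl fun j _ ↦ ?_
      simp only [smul_eq_mul, e]; ring
    have h2 : B z w w = ∑ i, ∑ j, w i * w j * B z (e j) (e i) := by
      rw [h1, Finset.sum_comm]
      refine Finset.sum_congr rfl fun i _ ↦ Finset.sum_congr rfl fun j _ ↦ by ring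
    have h3 : B z w w = (B z w w + B z w w) / 2 := by ring
    rw [h3]
    nth_rewrite 1 [h1]
    rw [h2, ← Finset.sum_add_distrib, Finset.sum_div]
    refine Finset.sum_congr rfl fun i _ ↦ ?_
    rw [← Finset.sum_add_distrib, Finset.sum_div]
    refine Finset.sum_congr rfl fun j _ ↦ by ring
  rw [hexp]
  refine (Finset.abs_sum_le_sum_abs _ _).trans ?_
  rw [Finset.sum_mul, Finset.sum_mul]
  refine Finset.sum_le_sum fun i _ ↦ ?_
  refine (Finset.abs_sum_le_sum_abs _ _).trans ?_
  rw [Finset.sum_mul, Finset.sum_mul]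
  refine Finset.sum_le_sum fun j _ ↦ ?_
  have hi : |w i| ≤ ‖w‖ := PiLp.norm_apply_le w i
  have hj : |w j| ≤ ‖w‖ := PiLp.norm_apply_le w j
  rw [abs_mul, abs_mul, abs_div, abs_two]
  calc |w i| * |w j| * (|B z (e i) (e j) + B z (e j) (e i)| / 2)
      ≤ ‖w‖ * ‖w‖ * (C i j * ‖z‖ ^ 3 / 2) := by
        gcongr; exact hz i j
    _ = _ := by ring

theorem ContDiffAt.linearMap_apply {X : Type*} [NormedAddCommGroup X] [NormedSpace ℝ X]
    {F : Type*} [NormedAddCommGroup F] [NormedSpace ℝ F] {x : X}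
    {l : X → EuclideanSpace ℝ (Fin n) →ₗ[ℝ] F} {A : X → EuclideanSpace ℝ (Fin n)} {k : ℕ∞ω}
    (hl : ∀ v, ContDiffAt ℝ k (fun z ↦ l z v) x)
    (hA : ContDiffAt ℝ k A x) : ContDiffAt ℝ k (fun z ↦ l z (A z)) x := by
  have : (fun z ↦ l z (A z)) = fun z ↦ ∑ i, A z i • l z (EuclideanSpace.single i 1) := by
    funext z
    exact LinearMap.apply_eq_sum_single (l z) (A z)
  rw [this]
  exact ContDiffAt.sum fun i _ ↦ ((contDiffAt_euclidean.1 hA i).smul (hl _))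

variable {g₁ g₂} in
/-- In the coordinates `normalMap`, the metric is `δ - R(·, z, z, ·) / 3` up to cubic terms. -/
theorem normalMap_metric_expansion
    {G : EuclideanSpace ℝ (Fin n) →
      EuclideanSpace ℝ (Fin n) →ₗ[ℝ] EuclideanSpace ℝ (Fin n) →ₗ[ℝ] ℝ}
    (hsm : ∀ v w, ContDiffAt ℝ 3 (fun z ↦ G z v w) 0) (hsymm : ∀ z v w, G z v w = G z w v)
    (h0 : ∀ v w, G 0 v w = ⟪v, w⟫)
    (hg₁ : ∀ a v w, fderiv ℝ (fun z ↦ G z v w) 0 a = g₁ a v w)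
    (hg₂ : ∀ a b v w, fderiv ℝ (fderiv ℝ fun z ↦ G z v w) 0 a b = g₂ a b v w) :
    ∃ C, 0 ≤ C ∧ ∀ᶠ z in 𝓝 0, ∀ w,
      |G (normalMap g₁ g₂ z) (fderiv ℝ (normalMap g₁ g₂) z w) (fderiv ℝ (normalMap g₁ g₂) z w)
        - (‖w‖ ^ 2 - curvatureOfJet g₁ g₂ w z z w / 3)| ≤ C * ‖z‖ ^ 3 * ‖w‖ ^ 2 := by
  have h₁ : ∀ a v w, g₁ a v w = g₁ a w v := by
    intro a v w
    rw [← hg₁, ← hg₁, show (fun z ↦ G z v w) = fun z ↦ G z w v from funext fun z ↦ hsymm z v w]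
  have h₂' : ∀ a b v w, g₂ a b v w = g₂ a b w v := by
    intro a b v w
    rw [← hg₂, ← hg₂, show (fun z ↦ G z v w) = fun z ↦ G z w v from funext fun z ↦ hsymm z v w]
  have h₂ : ∀ a b v w, g₂ a b v w = g₂ b a v w := by
    intro a b v w
    rw [← hg₂, ← hg₂]
    exact ((hsm v w).isSymmSndFDerivAt (by simp; norm_num)).eq a b
  set φ := normalMap g₁ g₂ with hφ
  have hR := isCurvatureLike_curvatureOfJet g₁ g₂
  set R := curvatureOfJet g₁ g₂ with hRdef
  -- The bilinear form whose diagonal is the error to be bounded.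
  let B : EuclideanSpace ℝ (Fin n) →
      EuclideanSpace ℝ (Fin n) →ₗ[ℝ] EuclideanSpace ℝ (Fin n) →ₗ[ℝ] ℝ := fun z ↦
    (G (φ z)).compl₁₂ (fderiv ℝ φ z : _ →ₗ[ℝ] _) (fderiv ℝ φ z : _ →ₗ[ℝ] _)
      - innerₗ _ + (1 / 3 : ℝ) • hR.outer z z
  have hB : ∀ z w, B z w w = G (φ z) (fderiv ℝ φ z w) (fderiv ℝ φ z w)
      - (‖w‖ ^ 2 - R w z z w / 3) := by
    intro z w
    simp [B, IsCurvatureLike.outer]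
    ring
  have hφc : ContDiff ℝ 4 φ := contDiff_normalMap g₁ g₂
  have hφ0 : φ 0 = 0 := normalMap_zero g₁ g₂
  suffices h : ∀ w, (fun z ↦ B z w w) =O[𝓝 0] fun z ↦ ‖z‖ ^ 3 by
    obtain ⟨C, hC0, hC⟩ := exists_bound_of_quadratic_isBigO h
    refine ⟨C, hC0, hC.mono fun z hz w ↦ ?_⟩
    rw [← hB]; exact hz w
  intro w
  simp only [hB]
  -- It remains to check the 2-jet of the error along each ray `t • z`.
  apply ContDiffAt.isBigO_norm_pow_three_of_lines
  · have hd : ContDiffAt ℝ 3 (fun z ↦ fderiv ℝ φ z w) 0 :=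
      ((hφc.contDiffAt (x := 0)).fderiv_right (m := 3) (by norm_num)).clm_apply contDiffAt_const
    have hGc : ∀ v w, ContDiffAt ℝ 3 (fun z ↦ G (φ z) v w) 0 := fun v w ↦
      ContDiffAt.comp (g := fun z ↦ G z v w) 0 (by rw [hφ0]; exact hsm v w)
        (hφc.contDiffAt.of_le (by norm_num))
    have hR' : ContDiffAt ℝ 3 (fun z ↦ R w z z w) 0 :=
      ContDiffAt.linearMap_apply (l := fun z ↦ hR.inner₂₃ w w z) (fun v ↦
        ContDiffAt.linearMap_apply (l := fun _ ↦ (hR.inner₂₃ w w).flip v)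
          (fun _ ↦ contDiffAt_const) contDiffAt_id) contDiffAt_id
    have hGG : ContDiffAt ℝ 3 (fun z ↦ G (φ z) (fderiv ℝ φ z w) (fderiv ℝ φ z w)) 0 :=
      ContDiffAt.linearMap_apply (l := fun z ↦ G (φ z) (fderiv ℝ φ z w)) (fun v ↦
        ContDiffAt.linearMap_apply (l := fun z ↦ (G (φ z)).flip v)
          (fun v' ↦ hGc v' v) hd) hd
    exact hGG.sub (contDiffAt_const.sub (hR'.div_const 3))
  · intro z
    obtain ⟨X, hX, hV⟩ := fderiv_normalMap_apply g₁ g₂ h₁ z w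
    set p := -leviCivita g₁ z w with hp
    set b := (-(1 / 2 : ℝ)) • leviCivita g₁ z z with hb
    set c := sharp (cubicForm g₁ g₂ z) with hc
    have J := fun v v' ↦ metric_curve_expansion hsm h0 hg₁ hg₂ z b c v v'
    set e := fun (v v' : EuclideanSpace ℝ (Fin n)) (t : ℝ) ↦
      G (t • z + t ^ 2 • b + t ^ 3 • c) v v'
      - (⟪v, v'⟫ + t * g₁ z v v' + t ^ 2 * (g₁ b v v' + 1 / 2 * g₂ z z v v')) with he
    have hJ : ∀ v v' (q : ℝ → ℝ), Continuous q →
        (fun t ↦ q t * e v v' t) =O[𝓝 0] fun t : ℝ ↦ t ^ 3 := by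
      intro v v' q hq
      exact (((hq.tendsto 0).isBigO_one ℝ).mul (J v v')).congr_right fun t ↦ by simp
    have hk1 : g₁ z w w + 2 * ⟪w, p⟫ = 0 := by
      have := normalMap_jet_one h₁ z w
      rw [hp, inner_neg_right, real_inner_comm]
      linarith
    have hk2 : g₁ b w w + 1 / 2 * g₂ z z w w + 2 * g₁ z w p + ⟪p, p⟫ + 2 * ⟪w, X⟫
        = - R w z z w / 3 := by
      have := normalMap_jet_two h₁ h₂ h₂' z w
      rw [← hRdef] at this
      rw [real_inner_comm X w, hX, ← this, hp, inner_neg_neg, map_neg]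
      ring
    let s1 := fun v v' ↦ g₁ z v v'
    let s2 := fun v v' ↦ g₁ b v v' + 1 / 2 * g₂ z z v v'
    -- Along the ray the derivative sends `w` to `w + t p + t² X`; the six terms are the remainders
    -- of the pairings of these three vectors.
    have hsum := (((((hJ w w (fun _ ↦ 1) (by fun_prop)).add
      (hJ w p (fun t ↦ 2 * t) (by fun_prop))).add
      (hJ p p (fun t ↦ t ^ 2) (by fun_prop))).add
      (hJ w X (fun t ↦ 2 * t ^ 2) (by fun_prop))).add
      (hJ p X (fun t ↦ 2 * t ^ 3) (by fun_prop))).add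
      (hJ X X (fun t ↦ t ^ 4) (by fun_prop))
    have hsum2 := hsum.add (isBigO_pow_three_mul (q := fun t ↦
      2 * s2 w p + (s1 p p + t * s2 p p) + 2 * (s1 w X + t * s2 w X)
      + 2 * (⟪p, X⟫ + t * s1 p X + t ^ 2 * s2 p X)
      + t * (⟪X, X⟫ + t * s1 X X + t ^ 2 * s2 X X)) (by fun_prop))
    refine hsum2.congr_left fun t ↦ ?_
    have hRt : R w (t • z) (t • z) w = t ^ 2 * R w z z w := by
      rw [hR.smul₂, hR.smul₃]; ring
    have hg : ∀ v v', G (φ (t • z)) v v' = e v v' t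
        + (⟪v, v'⟫ + t * s1 v v' + t ^ 2 * s2 v v') := by
      intro v v'
      rw [hφ, normalMap_smul]
      simp only [he, s1, s2]
      ring
    rw [hV, hRt]
    simp only [map_add, map_smul, LinearMap.add_apply, LinearMap.smul_apply, smul_eq_mul]
    rw [hsymm _ p w, hsymm _ X w, hsymm _ X p]
    simp only [hg]
    rw [← real_inner_self_eq_norm_sq w]
    simp only [s1, s2]
    -- Orders one and two vanish by the two jet identities.
    linear_combination (-t) * hk1 - t ^ 2 * hk2

end NormalCoordinates
end

noncomputable section

/-! ### The metric matrix in a chart: smoothness and positivity -/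

section ManifoldMetric

variable {n : ℕ} {H : Type*} [TopologicalSpace H]
  {I : ModelWithCorners ℝ (EuclideanSpace ℝ (Fin n)) H}
  {M : Type*} [TopologicalSpace M] [ChartedSpace H M] [IsManifold I ∞ M]
  [RiemannianBundle (fun p : M ↦ TangentSpace I p)]

open RiemannianCoord

theorem metric_symm (x : M) (y : EuclideanSpace ℝ (Fin n)) (i j : Fin n) :
    metric I x y i j = metric I x y j i := by
  simp only [metric, Matrix.of_apply]
  exact real_inner_comm _ _

/-- The differential of the inverse chart, expanded along the coordinate fields. -/
theorem mfderivWithin_extChartAt_symm_eq_sum (x : M) (y v : EuclideanSpace ℝ (Fin n)) :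
    mfderivWithin 𝓘(ℝ, EuclideanSpace ℝ (Fin n)) I (extChartAt I x).symm (range I) y v
      = ∑ i, v i • coordField I x i y := by
  exact LinearMap.apply_eq_sum_single (V := TangentSpace I ((extChartAt I x).symm y))
    (mfderivWithin 𝓘(ℝ, EuclideanSpace ℝ (Fin n)) I (extChartAt I x).symm (range I) y :
      EuclideanSpace ℝ (Fin n) →L[ℝ] TangentSpace I ((extChartAt I x).symm y)).toLinearMap v

theorem norm_sq_mfderivWithin_extChartAt_symm (x : M) (y v : EuclideanSpace ℝ (Fin n)) :
    ‖mfderivWithin 𝓘(ℝ, EuclideanSpace ℝ (Fin n)) I (extChartAt I x).symm (range I) y v‖ ^ 2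
      = ∑ i, ∑ j, metric I x y i j * v i * v j := by
  rw [mfderivWithin_extChartAt_symm_eq_sum, ← real_inner_self_eq_norm_sq, sum_inner]
  refine Finset.sum_congr rfl fun i _ ↦ ?_
  rw [inner_sum]
  refine Finset.sum_congr rfl fun j _ ↦ ?_
  rw [inner_smul_left, inner_smul_right]
  simp only [metric, Matrix.of_apply, conj_trivial]
  ring

/-- Each coordinate field is the tangent map of the inverse chart applied to a constant field, hence
a smooth section along it; the bundle metric then gives smooth inner products. -/
theorem contDiffAt_metric
    [IsContMDiffRiemannianBundle I ∞ (EuclideanSpace ℝ (Fin n)) (fun p : M ↦ TangentSpace I p)]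
    (x : M) {y : EuclideanSpace ℝ (Fin n)} (hy : y ∈ interior (extChartAt I x).target)
    (i j : Fin n) : ContDiffAt ℝ ∞ (fun z ↦ metric I x z i j) y := by
  set s := interior (extChartAt I x).target with hs
  have hso : IsOpen s := isOpen_interior
  have hsm : ContMDiffOn 𝓘(ℝ, EuclideanSpace ℝ (Fin n)) I ∞ (extChartAt I x).symm s :=
    (contMDiffOn_extChartAt_symm x).mono interior_subset
  have hT := hsm.contMDiffOn_tangentMapWithin (m := ∞) (by simp) hso.uniqueMDiffOn
  have hfield : ∀ i : Fin n, ContMDiffWithinAt 𝓘(ℝ, EuclideanSpace ℝ (Fin n)) I.tangent ∞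
      (fun z ↦ (⟨(extChartAt I x).symm z, coordField I x i z⟩ : TangentBundle I M)) s y := by
    intro i
    have hconst : ContMDiffWithinAt 𝓘(ℝ, EuclideanSpace ℝ (Fin n))
        (𝓘(ℝ, EuclideanSpace ℝ (Fin n))).tangent ∞
        (fun z ↦ (⟨z, (EuclideanSpace.single i (1 : ℝ) : EuclideanSpace ℝ (Fin n))⟩ :
          TangentBundle 𝓘(ℝ, EuclideanSpace ℝ (Fin n)) (EuclideanSpace ℝ (Fin n)))) s y :=
      contMDiffWithinAt_vectorSpace_iff_contDiffWithinAt.2 contDiffWithinAt_const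
    have hcomp := (hT ⟨y, (EuclideanSpace.single i (1 : ℝ) : EuclideanSpace ℝ (Fin n))⟩ hy).comp
      y hconst (fun z hz ↦ hz)
    refine hcomp.congr_of_mem (fun z hz ↦ ?_) hy
    -- At interior coordinates derivatives within `range I` and within `s` are both the unrestricted
    -- derivative.
    have hzr : range I ∈ 𝓝 z :=
      mem_of_superset (hso.mem_nhds hz) (interior_subset.trans (extChartAt_target_subset_range x))
    simp only [Function.comp_apply, tangentMapWithin, coordField]
    rw [mfderivWithin_of_mem_nhds (hso.mem_nhds hz), mfderivWithin_of_mem_nhds hzr]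
  have hin := ContMDiffWithinAt.inner_bundle (hfield i) (hfield j)
  exact (contMDiffWithinAt_iff_contDiffWithinAt.1 hin).contDiffAt (hso.mem_nhds hy)

theorem mfderivWithin_extChartAt_symm_injective (x : M) {y : EuclideanSpace ℝ (Fin n)}
    (hy : y ∈ (extChartAt I x).target) (v : EuclideanSpace ℝ (Fin n))
    (hv : mfderivWithin 𝓘(ℝ, EuclideanSpace ℝ (Fin n)) I (extChartAt I x).symm (range I) y v = 0) :
    v = 0 := by
  have h := mfderiv_extChartAt_comp_mfderivWithin_extChartAt_symm (I := I) hy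
  have h2 := congrArg (fun (L : EuclideanSpace ℝ (Fin n) →L[ℝ] EuclideanSpace ℝ (Fin n)) ↦ L v) h
  have h3 : mfderiv I 𝓘(ℝ, EuclideanSpace ℝ (Fin n)) (extChartAt I x) ((extChartAt I x).symm y)
    (mfderivWithin 𝓘(ℝ, EuclideanSpace ℝ (Fin n)) I (extChartAt I x).symm (range I) y v) = v := h2
  rw [hv, map_zero] at h3
  exact h3.symm

theorem posDef_metric (x : M) {y : EuclideanSpace ℝ (Fin n)}
    (hy : y ∈ (extChartAt I x).target) : (metric I x y).PosDef := by
  refine Matrix.PosDef.of_dotProduct_mulVec_pos ?_ ?_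
  · ext i j
    simp only [Matrix.conjTranspose_apply, star_trivial]
    exact metric_symm x y j i
  · intro v hv
    have h := norm_sq_mfderivWithin_extChartAt_symm (I := I) x y (WithLp.toLp 2 v)
    have h2 : star v ⬝ᵥ Matrix.mulVec (metric I x y) v =
        ‖mfderivWithin 𝓘(ℝ, EuclideanSpace ℝ (Fin n)) I (extChartAt I x).symm (range I) y
          (WithLp.toLp 2 v : EuclideanSpace ℝ (Fin n))‖ ^ 2 := by
      rw [h]
      simp only [dotProduct, Matrix.mulVec, Finset.mul_sum, Pi.star_apply, star_trivial]
      refine Finset.sum_congr rfl fun i _ ↦ Finset.sum_congr rfl fun j _ ↦ by ring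
    rw [h2]
    have h3 : ‖mfderivWithin 𝓘(ℝ, EuclideanSpace ℝ (Fin n)) I (extChartAt I x).symm (range I) y
          (WithLp.toLp 2 v : EuclideanSpace ℝ (Fin n))‖ ≠ 0 := by
      intro h0
      apply hv
      have := mfderivWithin_extChartAt_symm_injective (I := I) x hy (WithLp.toLp 2 v)
        (norm_eq_zero.1 h0)
      simpa using congrArg WithLp.ofLp this
    positivity

end ManifoldMetric
end

noncomputable section

/-! ### Lengths of paths in parametrized charts -/

section ManifoldPaths

open RiemannianCoord MeasureTheory Manifold

variable {n : ℕ} {H : Type*} [TopologicalSpace H]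
  {I : ModelWithCorners ℝ (EuclideanSpace ℝ (Fin n)) H}
  {M : Type*}

/-- The squared length of the image of `w` under a parametrization `Φ` of the chart at `x`. -/
def pullbackForm [TopologicalSpace M] [ChartedSpace H M]
    [RiemannianBundle (fun p : M ↦ TangentSpace I p)] (x : M)
    (Φ : EuclideanSpace ℝ (Fin n) → EuclideanSpace ℝ (Fin n)) (z w : EuclideanSpace ℝ (Fin n)) :
    ℝ :=
  ∑ i, ∑ j, metric I x (Φ z) i j * (fderiv ℝ Φ z w) i * (fderiv ℝ Φ z w) j

section Length

variable [TopologicalSpace M] [ChartedSpace H M] [IsManifold I ∞ M]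
  [RiemannianBundle (fun p : M ↦ TangentSpace I p)]

theorem norm_sq_mfderivWithin_chart_curve (x : M) {y : ℝ → EuclideanSpace ℝ (Fin n)}
    (hy : ContDiffOn ℝ 1 y (Icc 0 1)) (hyt : ∀ t ∈ Icc (0 : ℝ) 1, y t ∈ (extChartAt I x).target)
    {t : ℝ} (ht : t ∈ Icc (0 : ℝ) 1) :
    ‖mfderivWithin 𝓘(ℝ, ℝ) I ((extChartAt I x).symm ∘ y) (Icc 0 1) t (1 : ℝ)‖ ^ 2
      = ∑ i, ∑ j, metric I x (y t) i j * (derivWithin y (Icc 0 1) t) i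
        * (derivWithin y (Icc 0 1) t) j := by
  have hu : UniqueDiffWithinAt ℝ (Icc (0 : ℝ) 1) t := uniqueDiffOn_Icc zero_lt_one t ht
  have hcomp : mfderivWithin 𝓘(ℝ, ℝ) I ((extChartAt I x).symm ∘ y) (Icc 0 1) t =
      (mfderivWithin 𝓘(ℝ, EuclideanSpace ℝ (Fin n)) I (extChartAt I x).symm (range I) (y t)) ∘L
        (mfderivWithin 𝓘(ℝ, ℝ) 𝓘(ℝ, EuclideanSpace ℝ (Fin n)) y (Icc 0 1) t) := by
    apply mfderivWithin_comp
    · exact mdifferentiableWithinAt_extChartAt_symm (hyt t ht)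
    · exact (hy.differentiableOn one_ne_zero t ht).mdifferentiableWithinAt
    · exact fun s hs ↦ extChartAt_target_subset_range x (hyt s hs)
    · rwa [uniqueMDiffWithinAt_iff_uniqueDiffWithinAt]
  have hap : mfderivWithin 𝓘(ℝ, ℝ) I ((extChartAt I x).symm ∘ y) (Icc 0 1) t (1 : ℝ) =
      mfderivWithin 𝓘(ℝ, EuclideanSpace ℝ (Fin n)) I (extChartAt I x).symm (range I) (y t)
        (derivWithin y (Icc 0 1) t) := by
    rw [hcomp]
    change mfderivWithin 𝓘(ℝ, EuclideanSpace ℝ (Fin n)) I (extChartAt I x).symm (range I) (y t)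
      (mfderivWithin 𝓘(ℝ, ℝ) 𝓘(ℝ, EuclideanSpace ℝ (Fin n)) y (Icc 0 1) t (1 : ℝ)) = _
    rw [mfderivWithin_eq_fderivWithin]
    rfl
  rw [hap]
  exact norm_sq_mfderivWithin_extChartAt_symm x (y t) _

theorem pathELength_chart_curve (x : M) {y : ℝ → EuclideanSpace ℝ (Fin n)}
    (hy : ContDiffOn ℝ 1 y (Icc 0 1)) (hyt : ∀ t ∈ Icc (0 : ℝ) 1, y t ∈ (extChartAt I x).target) :
    pathELength I ((extChartAt I x).symm ∘ y) 0 1 = ∫⁻ t in Icc (0 : ℝ) 1, ENNReal.ofReal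
      √(∑ i, ∑ j, metric I x (y t) i j * (derivWithin y (Icc 0 1) t) i
        * (derivWithin y (Icc 0 1) t) j) := by
  rw [pathELength_eq_lintegral_mfderivWithin_Icc]
  refine setLIntegral_congr_fun measurableSet_Icc fun t ht ↦ ?_
  rw [← norm_sq_mfderivWithin_chart_curve x hy hyt ht, Real.sqrt_sq (norm_nonneg _)]
  exact (ofReal_norm _).symm

theorem pathELength_parametrized_curve (x : M)
    {Φ : EuclideanSpace ℝ (Fin n) → EuclideanSpace ℝ (Fin n)} (hΦ : ContDiff ℝ 1 Φ)
    {z : ℝ → EuclideanSpace ℝ (Fin n)} (hz : ContDiffOn ℝ 1 z (Icc 0 1))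
    (hzt : ∀ t ∈ Icc (0 : ℝ) 1, Φ (z t) ∈ (extChartAt I x).target) :
    pathELength I ((extChartAt I x).symm ∘ Φ ∘ z) 0 1 = ∫⁻ t in Icc (0 : ℝ) 1,
      ENNReal.ofReal √(pullbackForm (I := I) x Φ (z t) (derivWithin z (Icc 0 1) t)) := by
  rw [pathELength_chart_curve x (hΦ.comp_contDiffOn hz) hzt]
  refine setLIntegral_congr_fun measurableSet_Icc fun t ht ↦ ?_
  have hu : UniqueDiffWithinAt ℝ (Icc (0 : ℝ) 1) t := uniqueDiffOn_Icc zero_lt_one t ht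
  have hd : derivWithin (Φ ∘ z) (Icc 0 1) t = fderiv ℝ Φ (z t) (derivWithin z (Icc 0 1) t) :=
    (((hΦ.differentiable one_ne_zero (z t)).hasFDerivAt).comp_hasDerivWithinAt t
      ((hz.differentiableOn one_ne_zero t ht).hasDerivWithinAt)).derivWithin hu
  simp only [pullbackForm, hd, Function.comp_apply]

end Length

variable [EMetricSpace M] [ChartedSpace H M] [IsManifold I ∞ M]
  [RiemannianBundle (fun p : M ↦ TangentSpace I p)]

/-- The distance is at most the maximal speed of a parametrized segment. -/
theorem edist_le_of_pullbackForm_le [IsRiemannianManifold I M] (x : M)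
    {Φ : EuclideanSpace ℝ (Fin n) → EuclideanSpace ℝ (Fin n)} (hΦ : ContDiff ℝ 1 Φ)
    {u v : EuclideanSpace ℝ (Fin n)} {m : ℝ} (hm : 0 ≤ m)
    (hzt : ∀ t ∈ Icc (0 : ℝ) 1, Φ (u + t • (v - u)) ∈ (extChartAt I x).target)
    (hle : ∀ t ∈ Icc (0 : ℝ) 1,
      pullbackForm (I := I) x Φ (u + t • (v - u)) (v - u) ≤ m ^ 2) :
    edist ((extChartAt I x).symm (Φ u)) ((extChartAt I x).symm (Φ v)) ≤ ENNReal.ofReal m := by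
  set z : ℝ → EuclideanSpace ℝ (Fin n) := fun t ↦ u + t • (v - u) with hz
  have hzc : ContDiff ℝ 1 z := by fun_prop
  have hzd : ∀ t ∈ Icc (0 : ℝ) 1, derivWithin z (Icc 0 1) t = v - u := by
    intro t ht
    have : HasDerivAt z (v - u) t := by
      have := ((hasDerivAt_id t).smul_const (v - u)).const_add u
      rwa [one_smul] at this
    exact this.hasDerivWithinAt.derivWithin (uniqueDiffOn_Icc zero_lt_one t ht)
  have hγ : ContMDiffOn 𝓘(ℝ, ℝ) I 1 ((extChartAt I x).symm ∘ Φ ∘ z) (Icc 0 1) :=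
    (contMDiffOn_extChartAt_symm x).comp (hΦ.comp hzc).contMDiff.contMDiffOn hzt
  rw [IsRiemannianManifold.out (I := I)]
  refine (riemannianEDist_le_pathELength hγ (by simp [z]) (by simp [z]) zero_le_one).trans ?_
  rw [pathELength_parametrized_curve x hΦ hzc.contDiffOn hzt]
  calc _ ≤ ∫⁻ _ in Icc (0 : ℝ) 1, ENNReal.ofReal m := by
        refine setLIntegral_mono' measurableSet_Icc fun t ht ↦ ENNReal.ofReal_le_ofReal ?_
        rw [hzd t ht]
        exact Real.sqrt_le_iff.2 ⟨hm, hle t ht⟩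
    _ = ENNReal.ofReal m := by simp

/-- A parametrization of the chart at an interior point inverts near that point, and functions of
the parameter grow along paths at most like the length. -/
theorem exists_local_inverse_and_calibration (x : M) (hx : I.IsInteriorPoint x)
    {Φ : EuclideanSpace ℝ (Fin n) → EuclideanSpace ℝ (Fin n)} (hΦ : ContDiff ℝ 1 Φ)
    (hΦ0 : Φ 0 = extChartAt I x x)
    {Φ' : EuclideanSpace ℝ (Fin n) ≃L[ℝ] EuclideanSpace ℝ (Fin n)}
    (hΦ' : fderiv ℝ Φ 0 = Φ') {r : ℝ} (hr : 0 < r) :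
    ∃ (ζ : M → EuclideanSpace ℝ (Fin n)) (U : Set M), U ∈ 𝓝 x ∧
      (∀ p ∈ U, (extChartAt I x).symm (Φ (ζ p)) = p ∧ ‖ζ p‖ < r) ∧
      (∀ᶠ z in 𝓝 0, ζ ((extChartAt I x).symm (Φ z)) = z) ∧
      ∀ γ : ℝ → M, ContMDiffOn 𝓘(ℝ, ℝ) I 1 γ (Icc 0 1) → (∀ t ∈ Icc (0 : ℝ) 1, γ t ∈ U) →
        ∀ f : EuclideanSpace ℝ (Fin n) → ℝ, ContDiff ℝ 1 f → ∀ Λ : ℝ, 0 ≤ Λ →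
        (∀ t ∈ Icc (0 : ℝ) 1, ∀ w, |fderiv ℝ f (ζ (γ t)) w|
          ≤ Λ * √(pullbackForm (I := I) x Φ (ζ (γ t)) w)) →
        ENNReal.ofReal |f (ζ (γ 1)) - f (ζ (γ 0))|
          ≤ ENNReal.ofReal Λ * pathELength I γ 0 1 := by
  set y₀ := extChartAt I x x with hy₀
  have hfd : HasFDerivAt Φ (Φ' : _ →L[ℝ] _) 0 :=
    hΦ' ▸ (hΦ.differentiable one_ne_zero 0).hasFDerivAt
  have hcd : ContDiffAt ℝ 1 Φ 0 := hΦ.contDiffAt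
  have hstrict : HasStrictFDerivAt Φ (Φ' : _ →L[ℝ] _) 0 := hcd.hasStrictFDerivAt' hfd one_ne_zero
  set ζ₀ := hcd.localInverse hfd one_ne_zero with hζ₀
  have hζ₀c : ContDiffAt ℝ 1 ζ₀ y₀ := hΦ0 ▸ hcd.to_localInverse hfd one_ne_zero
  have hζ₀0 : ζ₀ y₀ = 0 := hΦ0 ▸ hcd.localInverse_apply_image hfd one_ne_zero
  have hright : ∀ᶠ y in 𝓝 y₀, Φ (ζ₀ y) = y := hΦ0 ▸ hstrict.eventually_right_inverse
  have hleft : ∀ᶠ z in 𝓝 0, ζ₀ (Φ z) = z := hstrict.eventually_left_inverse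
  have hnorm : ∀ᶠ y in 𝓝 y₀, ‖ζ₀ y‖ < r := by
    have := hζ₀c.continuousAt.norm
    rw [ContinuousAt, hζ₀0, norm_zero] at this
    exact this.eventually (gt_mem_nhds hr)
  have hcde : ∀ᶠ y in 𝓝 y₀, ContDiffAt ℝ 1 ζ₀ y := hζ₀c.eventually (by simp)
  have hV := hright.and (hnorm.and hcde)
  -- On `U` the local inverse is a right inverse of `Φ`, has small values and is `C¹`, so every `C¹`
  -- path in `U` has a `C¹` coordinate lift.
  set U : Set M := (extChartAt I x).source ∩ {p | Φ (ζ₀ (extChartAt I x p)) = extChartAt I x p ∧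
    ‖ζ₀ (extChartAt I x p)‖ < r ∧ ContDiffAt ℝ 1 ζ₀ (extChartAt I x p)} with hU
  have hsrc : (extChartAt I x).source ∈ 𝓝 x := extChartAt_source_mem_nhds x
  refine ⟨fun p ↦ ζ₀ (extChartAt I x p), U,
    inter_mem hsrc ((continuousAt_extChartAt x).eventually hV), ?_, ?_, ?_⟩
  · rintro p ⟨hp, h1, h2, -⟩
    exact ⟨by rw [h1, (extChartAt I x).left_inv hp], h2⟩
  · have htarget : ∀ᶠ z in 𝓝 0, Φ z ∈ (extChartAt I x).target := by
      refine hΦ.continuous.continuousAt.eventually_mem (?_ : (extChartAt I x).target ∈ 𝓝 (Φ 0))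
      rw [hΦ0]
      exact mem_interior_iff_mem_nhds.1 (I.isInteriorPoint_iff.1 hx)
    filter_upwards [hleft, htarget] with z hz hzt
    rw [(extChartAt I x).right_inv hzt, hz]
  · intro γ hγ hγU f hf Λ hΛ hbound
    set y : ℝ → EuclideanSpace ℝ (Fin n) := extChartAt I x ∘ γ with hy
    set z : ℝ → EuclideanSpace ℝ (Fin n) := ζ₀ ∘ y with hz
    have hyc : ContDiffOn ℝ 1 y (Icc 0 1) := by
      rw [← contMDiffOn_iff_contDiffOn]
      exact contMDiffOn_extChartAt.comp (I' := I) (t := (chartAt H x).source) hγ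
        (fun t ht ↦ by simpa using (hγU t ht).1)
    have hzc : ContDiffOn ℝ 1 z (Icc 0 1) := fun t ht ↦
      (hγU t ht).2.2.2.comp_contDiffWithinAt t (hyc t ht)
    have hΦz : ∀ t ∈ Icc (0 : ℝ) 1, Φ (z t) = y t := fun t ht ↦ (hγU t ht).2.1
    have hγe : EqOn γ ((extChartAt I x).symm ∘ Φ ∘ z) (Icc 0 1) := by
      intro t ht
      simp only [Function.comp_apply, hΦz t ht, hy]
      rw [(extChartAt I x).left_inv (hγU t ht).1]
    have hzt : ∀ t ∈ Icc (0 : ℝ) 1, Φ (z t) ∈ (extChartAt I x).target := by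
      intro t ht
      rw [hΦz t ht]
      exact (extChartAt I x).map_source (hγU t ht).1
    rw [pathELength_congr hγe, pathELength_parametrized_curve x hΦ hzc hzt,
      ← lintegral_const_mul' _ _ ENNReal.ofReal_ne_top]
    have hfz : ContDiffOn ℝ 1 (f ∘ z) (Icc 0 1) := hf.comp_contDiffOn hzc
    -- The increment of `f` along the lifted path is at most the integral of `|df(z')|`, and the
    -- hypothesis bounds that integrand by `Λ` times the speed.
    have h1 := enorm_sub_le_lintegral_derivWithin_Icc_of_contDiffOn_Icc hfz zero_le_one
    have h2 : ENNReal.ofReal |f (ζ₀ (extChartAt I x (γ 1))) - f (ζ₀ (extChartAt I x (γ 0)))|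
        = ‖(f ∘ z) 1 - (f ∘ z) 0‖ₑ := by
      rw [← Real.norm_eq_abs, ofReal_norm]
      rfl
    rw [h2]
    refine h1.trans (setLIntegral_mono' measurableSet_Icc fun t ht ↦ ?_)
    have hu : UniqueDiffWithinAt ℝ (Icc (0 : ℝ) 1) t := uniqueDiffOn_Icc zero_lt_one t ht
    have hd : derivWithin (f ∘ z) (Icc 0 1) t = fderiv ℝ f (z t) (derivWithin z (Icc 0 1) t) :=
      (((hf.differentiable one_ne_zero (z t)).hasFDerivAt).comp_hasDerivWithinAt t
        ((hzc.differentiableOn one_ne_zero t ht).hasDerivWithinAt)).derivWithin hu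
    rw [hd, ← ofReal_norm, ← ENNReal.ofReal_mul hΛ, Real.norm_eq_abs]
    exact ENNReal.ofReal_le_ofReal (hbound t ht _)

end ManifoldPaths
end

noncomputable section

/-! ### The calibrating functions -/

section Calibration

variable {n : ℕ}
  {R : EuclideanSpace ℝ (Fin n) → EuclideanSpace ℝ (Fin n) → EuclideanSpace ℝ (Fin n) →
      EuclideanSpace ℝ (Fin n) → ℝ}

/-- Approximate distance function to a far away hyperplane orthogonal to `a`. -/
def planeWave (R : EuclideanSpace ℝ (Fin n) → EuclideanSpace ℝ (Fin n) →
      EuclideanSpace ℝ (Fin n) → EuclideanSpace ℝ (Fin n) → ℝ)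
    (a z : EuclideanSpace ℝ (Fin n)) : ℝ :=
  inner ℝ a z * (1 - R z a a z / 6)

theorem IsCurvatureLike.contDiff_outer_diag (hR : IsCurvatureLike R)
    (a : EuclideanSpace ℝ (Fin n)) {k : ℕ∞ω} : ContDiff ℝ k fun z ↦ R z a a z :=
  ContDiff.linearMap_apply (l := fun z ↦ hR.outer a a z) (fun v ↦
    ContDiff.linearMap_apply (l := fun _ ↦ (hR.outer a a).flip v)
      (fun _ ↦ contDiff_const) contDiff_id) contDiff_id

theorem IsCurvatureLike.contDiff_planeWave (hR : IsCurvatureLike R)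
    (a : EuclideanSpace ℝ (Fin n)) {k : ℕ∞ω} : ContDiff ℝ k (planeWave R a) :=
  (contDiff_const.inner ℝ contDiff_id).mul
    (contDiff_const.sub ((hR.contDiff_outer_diag a).div_const 6))

theorem IsCurvatureLike.fderiv_planeWave (hR : IsCurvatureLike R)
    (a z w : EuclideanSpace ℝ (Fin n)) :
    fderiv ℝ (planeWave R a) z w = inner ℝ a w * (1 - R z a a z / 6)
      - inner ℝ a z * (R w a a z + R z a a w) / 6 := by
  have hc : HasDerivAt (fun s : ℝ ↦ z + s • w) w 0 := by
    have := ((hasDerivAt_id (0 : ℝ)).smul_const w).const_add z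
    rwa [one_smul] at this
  have hd : HasFDerivAt (planeWave R a) (fderiv ℝ (planeWave R a) z) (z + (0 : ℝ) • w) := by
    simpa using ((hR.contDiff_planeWave a (k := 1)).differentiable one_ne_zero z).hasFDerivAt
  have h1 := hd.comp_hasDerivAt 0 hc
  have hlin : HasDerivAt (fun s : ℝ ↦ inner ℝ a z + s * inner ℝ a w) (inner ℝ a w) 0 := by
    simpa using ((hasDerivAt_id (0 : ℝ)).mul_const (inner ℝ a w)).const_add (inner ℝ a z)
  have hquad : HasDerivAt (fun s : ℝ ↦ 1 - (R z a a z + s * (R w a a z + R z a a w)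
      + s ^ 2 * R w a a w) / 6) (-((R w a a z + R z a a w) / 6)) 0 := by
    have h2 := ((((hasDerivAt_id (0 : ℝ)).mul_const (R w a a z + R z a a w)).const_add
      (R z a a z)).fun_add (((hasDerivAt_id (0 : ℝ)).fun_pow 2).mul_const (R w a a w))).div_const 6
    simpa using h2.const_sub 1
  have h3 := hlin.fun_mul hquad
  have h4 : (planeWave R a) ∘ (fun s : ℝ ↦ z + s • w) = fun s : ℝ ↦
      (inner ℝ a z + s * inner ℝ a w) * (1 - (R z a a z + s * (R w a a z + R z a a w)
      + s ^ 2 * R w a a w) / 6) := by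
    funext s
    simp only [Function.comp_apply, planeWave, inner_add_right, inner_smul_right, hR.add₁, hR.add₄,
      hR.smul₁, hR.smul₄]
    ring
  rw [h4] at h1
  have h5 := h1.unique h3
  rw [h5]
  ring

/-- `α` and `β` stand for the components of a vector along `a` and orthogonal to it. The pure `α²`
terms of both sides agree to second order, since `(1 - k/6)²` is `1 - k/3` up to `k²/36`. The mixed
terms, of size `σ²|α|β`, are absorbed by the unspent `β²` at a cost of order `σ⁴α²`. -/
theorem calibration_arith {α β k m h c σ CR C₀ : ℝ} (hσ0 : 0 ≤ σ) (hσ1 : σ ≤ 1)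
    (hCR : 0 ≤ CR) (hC₀ : 0 ≤ C₀) (hβ : 0 ≤ β) (hsmall : CR * σ ^ 2 ≤ 1 / 2)
    (hk : |k| ≤ CR * σ ^ 2) (hm : |m| ≤ CR * σ ^ 2 * β)
    (hc : |c| ≤ 2 * (CR * σ ^ 2) * |α| * β + CR * σ ^ 2 * β ^ 2)
    (hh : α ^ 2 + β ^ 2 - (α ^ 2 * k + c) / 3 - C₀ * σ ^ 3 * (α ^ 2 + β ^ 2) ≤ h)
    (hh' : (α ^ 2 + β ^ 2) / 4 ≤ h) :
    |α * (1 - k / 6) - m| ≤ (1 + 4 * (13 * CR ^ 2 + C₀) * σ ^ 3) * √h := by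
  set q := CR * σ ^ 2 with hq
  have hq0 : 0 ≤ q := by positivity
  set A := |α| with hA
  have hA0 : 0 ≤ A := abs_nonneg _
  have hαA : α ^ 2 = A ^ 2 := (sq_abs α).symm
  have hq4 : q ^ 2 ≤ CR ^ 2 * σ ^ 3 := by
    rw [hq]
    have : σ ^ 4 ≤ σ ^ 3 := pow_le_pow_of_le_one hσ0 hσ1 (by norm_num)
    calc (CR * σ ^ 2) ^ 2 = CR ^ 2 * σ ^ 4 := by ring
      _ ≤ CR ^ 2 * σ ^ 3 := by gcongr
  have hk2 : k ^ 2 ≤ q ^ 2 := by rw [← sq_abs k]; gcongr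
  have hm2 : m ^ 2 ≤ q ^ 2 * β ^ 2 := by
    rw [← sq_abs m, ← mul_pow]; gcongr
  have hcross : -(2 * α * (1 - k / 6) * m) ≤ 4 * q * A * β := by
    have h1 : |1 - k / 6| ≤ 2 := by
      rw [abs_le] at hk ⊢
      constructor <;> linarith [hk.1, hk.2]
    calc -(2 * α * (1 - k / 6) * m) ≤ |2 * α * (1 - k / 6) * m| := neg_le_abs _
      _ = 2 * A * |1 - k / 6| * |m| := by simp [abs_mul, hA]
      _ ≤ 2 * A * 2 * (q * β) := by gcongr
      _ = 4 * q * A * β := by ring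
  have hc' : c ≤ 2 * q * A * β + q * β ^ 2 := (le_abs_self c).trans hc
  have hsq : (α * (1 - k / 6) - m) ^ 2 ≤ h + (13 * CR ^ 2 + C₀) * σ ^ 3 * (α ^ 2 + β ^ 2) := by
    -- Half of `β²` pays for the mixed terms and the other half for `hβ2`; the constant `13`
    -- dominates `25/2 + 1/36`.
    have hAMGM : 5 * q * A * β ≤ β ^ 2 / 2 + 25 / 2 * q ^ 2 * A ^ 2 := by
      nlinarith [sq_nonneg (β - 5 * q * A)]
    have hβ2 : q ^ 2 * β ^ 2 + q * β ^ 2 / 3 ≤ β ^ 2 / 2 := by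
      have h1 : q ^ 2 ≤ 1 / 4 := by nlinarith
      nlinarith [sq_nonneg β]
    have e1 : (α * (1 - k / 6) - m) ^ 2
        = α ^ 2 - α ^ 2 * k / 3 + α ^ 2 * k ^ 2 / 36 - 2 * α * (1 - k / 6) * m + m ^ 2 := by ring
    have e2 : α ^ 2 * k ^ 2 / 36 ≤ A ^ 2 * q ^ 2 / 36 := by rw [hαA]; gcongr
    have e3 : A ^ 2 * q ^ 2 ≤ A ^ 2 * (CR ^ 2 * σ ^ 3) := by gcongr
    have e4 : 0 ≤ CR ^ 2 * σ ^ 3 * β ^ 2 := by positivity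
    have e6 : 2 * q * A * β / 3 + 4 * q * A * β ≤ 5 * q * A * β := by
      have : 0 ≤ q * A * β := by positivity
      linarith
    rw [e1]
    rw [hαA] at hh e2 ⊢
    have e5 : (13 * CR ^ 2 + C₀) * σ ^ 3 * (A ^ 2 + β ^ 2) = 13 * (A ^ 2 * (CR ^ 2 * σ ^ 3))
      + 13 * (CR ^ 2 * σ ^ 3 * β ^ 2) + C₀ * σ ^ 3 * (A ^ 2 + β ^ 2) := by ring
    have e7 : 0 ≤ A ^ 2 * (CR ^ 2 * σ ^ 3) := by positivity
    rw [e5]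
    linarith
  -- Turns the absolute error into a relative one and accounts for the factor `4` in the final
  -- constant.
  have hD : α ^ 2 + β ^ 2 ≤ 4 * h := by linarith
  have hh0 : 0 ≤ h := by nlinarith [sq_nonneg α, sq_nonneg β]
  set K := 4 * (13 * CR ^ 2 + C₀) * σ ^ 3 with hK
  have hK0 : 0 ≤ K := by positivity
  have hfin : (α * (1 - k / 6) - m) ^ 2 ≤ ((1 + K) * √h) ^ 2 := by
    rw [mul_pow, Real.sq_sqrt hh0]
    have h1 : (13 * CR ^ 2 + C₀) * σ ^ 3 * (α ^ 2 + β ^ 2)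
        ≤ (13 * CR ^ 2 + C₀) * σ ^ 3 * (4 * h) := by
      gcongr
    nlinarith [mul_nonneg hK0 hh0, mul_nonneg (mul_nonneg hK0 hK0) hh0]
  exact abs_le_of_sq_le_sq hfin (by positivity)

/-- An approximate eikonal inequality. Write `w = α a + b` with `b ⊥ a`: antisymmetry removes the
`a`-component from `R(w,a,a,z)` and `R(z,a,a,w)`, so all corrections beyond the pure `α` term
involve `b`, as `calibration_arith` requires. -/
theorem IsCurvatureLike.abs_fderiv_planeWave_le (hR : IsCurvatureLike R) {CR : ℝ} (hCR : 0 ≤ CR)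
    (hbound : ∀ a b c d, |R a b c d| ≤ CR * ‖a‖ * ‖b‖ * ‖c‖ * ‖d‖) {C₀ σ : ℝ} (hC₀ : 0 ≤ C₀)
    (hσ1 : σ ≤ 1) (hsmall : CR * σ ^ 2 ≤ 1 / 2) {a z w : EuclideanSpace ℝ (Fin n)} (ha : ‖a‖ = 1)
    (hz : ‖z‖ ≤ σ) {h : ℝ} (hh : ‖w‖ ^ 2 - R w z z w / 3 - C₀ * σ ^ 3 * ‖w‖ ^ 2 ≤ h)
    (hh' : ‖w‖ ^ 2 / 4 ≤ h) :
    |fderiv ℝ (planeWave R a) z w| ≤ (1 + 4 * (13 * CR ^ 2 + C₀) * σ ^ 3) * √h := by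
  have hσ0 : 0 ≤ σ := (norm_nonneg z).trans hz
  set α := inner ℝ a w with hα
  set b := w - α • a with hb
  have haa : inner ℝ a a = (1 : ℝ) := by rw [real_inner_self_eq_norm_sq, ha]; norm_num
  have hw : w = b + α • a := by rw [hb]; abel
  have hab : inner ℝ a b = (0 : ℝ) := by
    rw [hb, inner_sub_right, inner_smul_right, haa, ← hα]; ring
  have hnorm : ‖w‖ ^ 2 = α ^ 2 + ‖b‖ ^ 2 := by
    rw [← real_inner_self_eq_norm_sq w, ← real_inner_self_eq_norm_sq b]
    nth_rewrite 1 [hw]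
    nth_rewrite 1 [hw]
    simp only [inner_add_left, inner_add_right, inner_smul_left, inner_smul_right, haa, hab,
      real_inner_comm a b, conj_trivial]
    ring
  have hw1 : R w a a z = R b a a z := by
    rw [hw, hR.add₁, hR.smul₁, hR.self₁₂]; simp
  have hw4 : R z a a w = R z a a b := by
    rw [hw, hR.add₄, hR.smul₄, hR.self₃₄]; simp
  have hsw : R a z z a = R z a a z := by
    rw [hR.anti₁₂, hR.anti₃₄]; ring
  have hRw : R w z z w = α ^ 2 * R z a a z
      + (α * (R a z z b + R b z z a) + R b z z b) := by
    rw [hw]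
    simp only [hR.add₁, hR.add₄, hR.smul₁, hR.smul₄, hsw]
    ring
  rw [hR.fderiv_planeWave, hw1, hw4, ← hα]
  have hz2 : ‖z‖ * ‖z‖ ≤ σ ^ 2 := by rw [sq]; gcongr
  have hiz : |inner ℝ a z| ≤ σ := by
    have := abs_real_inner_le_norm a z
    rw [ha, one_mul] at this
    exact this.trans hz
  refine calibration_arith (β := ‖b‖) (c := α * (R a z z b + R b z z a) + R b z z b)
    (m := inner ℝ a z * (R b a a z + R z a a b) / 6) hσ0 hσ1 hCR hC₀ (norm_nonneg _) hsmall
    ?_ ?_ ?_ ?_ ?_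
  · have := hbound z a a z
    rw [ha] at this
    calc |R z a a z| ≤ CR * (‖z‖ * ‖z‖) := by linarith
      _ ≤ CR * σ ^ 2 := by gcongr
  · have h1 := hbound b a a z
    have h2 := hbound z a a b
    rw [ha] at h1 h2
    have h3 : |R b a a z + R z a a b| ≤ 2 * CR * σ * ‖b‖ := by
      calc |R b a a z + R z a a b| ≤ |R b a a z| + |R z a a b| := abs_add_le _ _
        _ ≤ 2 * CR * ‖z‖ * ‖b‖ := by linarith
        _ ≤ 2 * CR * σ * ‖b‖ := by gcongr
    rw [abs_div, abs_mul, abs_of_pos (by norm_num : (0 : ℝ) < 6)]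
    calc |inner ℝ a z| * |R b a a z + R z a a b| / 6 ≤ σ * (2 * CR * σ * ‖b‖) / 6 := by gcongr
      _ ≤ CR * σ ^ 2 * ‖b‖ := by
        have : 0 ≤ CR * σ ^ 2 * ‖b‖ := by positivity
        linarith
  · have h1 := hbound a z z b
    have h2 := hbound b z z a
    have h3 := hbound b z z b
    rw [ha] at h1 h2
    have h4 : |R a z z b + R b z z a| ≤ 2 * CR * (‖z‖ * ‖z‖) * ‖b‖ :=
      (abs_add_le _ _).trans (by linarith)
    calc |α * (R a z z b + R b z z a) + R b z z b|
        ≤ |α| * |R a z z b + R b z z a| + |R b z z b| := by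
          rw [← abs_mul]; exact abs_add_le _ _
      _ ≤ |α| * (2 * CR * (‖z‖ * ‖z‖) * ‖b‖) + CR * (‖z‖ * ‖z‖) * ‖b‖ ^ 2 := by
          gcongr; linarith
      _ ≤ |α| * (2 * CR * σ ^ 2 * ‖b‖) + CR * σ ^ 2 * ‖b‖ ^ 2 := by gcongr
      _ = _ := by ring
  · rw [hRw, hnorm] at hh
    exact hh
  · rw [hnorm] at hh'; exact hh'

/-- By antisymmetry the curvature factor is constant along lines in direction `a`, so the increment
is exact and, for `a` the direction of `v - u`, equals `distExpansion`. -/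
theorem IsCurvatureLike.planeWave_sub (hR : IsCurvatureLike R) {a u : EuclideanSpace ℝ (Fin n)}
    (ha : ‖a‖ = 1) (N : ℝ) :
    planeWave R a (u + N • a) - planeWave R a u = N * (1 - R a u u a / 6) := by
  have haa : inner ℝ a a = (1 : ℝ) := by rw [real_inner_self_eq_norm_sq, ha]; norm_num
  have hsw : R u a a u = R a u u a := by
    rw [hR.anti₁₂, hR.anti₃₄]; ring
  simp only [planeWave, inner_add_right, inner_smul_right, haa, hR.add₁, hR.add₄, hR.smul₁,
    hR.smul₄, hR.self₁₂, hR.self₃₄, hsw]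
  ring

end Calibration
end

noncomputable section

/-! ### Expansion of the Riemannian distance -/

section DistanceExpansion

open RiemannianCoord MeasureTheory Manifold

variable {n : ℕ} {H : Type*} [TopologicalSpace H]
  {I : ModelWithCorners ℝ (EuclideanSpace ℝ (Fin n)) H}
  {M : Type*} [EMetricSpace M] [ChartedSpace H M] [IsManifold I ∞ M]
  [RiemannianBundle (fun p : M ↦ TangentSpace I p)]

/-- Confines a short path to a small ball about its starting point, so that near-minimizing paths
never leave the chart. -/
theorem edist_le_pathELength [IsRiemannianManifold I M] {γ : ℝ → M}
    (hγ : ContMDiffOn 𝓘(ℝ, ℝ) I 1 γ (Icc 0 1)) {t : ℝ} (ht : t ∈ Icc (0 : ℝ) 1) :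
    edist (γ 0) (γ t) ≤ pathELength I γ 0 1 := by
  rw [IsRiemannianManifold.out (I := I)]
  exact (riemannianEDist_le_pathELength (hγ.mono (Icc_subset_Icc_right ht.2)) rfl rfl ht.1).trans
    (pathELength_mono le_rfl ht.2)

/-- The quantity `‖w‖ - R(w, u, u, w) / (6 ‖w‖)`, the expansion of the distance between the points
of normal coordinates `u` and `u + w`. -/
def distExpansion (R : EuclideanSpace ℝ (Fin n) → EuclideanSpace ℝ (Fin n) →
      EuclideanSpace ℝ (Fin n) → EuclideanSpace ℝ (Fin n) → ℝ)
    (u v : EuclideanSpace ℝ (Fin n)) : ℝ :=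
  -- For `u = v` the quotient has denominator zero and reads `0`, the right value of the distance.
  ‖v - u‖ - R (v - u) u u (v - u) / (6 * ‖v - u‖)

variable {R : EuclideanSpace ℝ (Fin n) → EuclideanSpace ℝ (Fin n) → EuclideanSpace ℝ (Fin n) →
      EuclideanSpace ℝ (Fin n) → ℝ}

/-- Polar form: with `a` the unit direction and `κ = R(a,u,u,a)`, the distance estimates become
inequalities between scalars. -/
theorem IsCurvatureLike.distExpansion_eq (hR : IsCurvatureLike R) {CR : ℝ}
    (hbound : ∀ a b c d, |R a b c d| ≤ CR * ‖a‖ * ‖b‖ * ‖c‖ * ‖d‖)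
    {u v : EuclideanSpace ℝ (Fin n)} (hw : v - u ≠ 0) :
    ∃ (a : EuclideanSpace ℝ (Fin n)) (κ : ℝ), ‖a‖ = 1 ∧ v = u + ‖v - u‖ • a ∧
      κ = R a u u a ∧ |κ| ≤ CR * ‖u‖ ^ 2 ∧
      R (v - u) u u (v - u) = ‖v - u‖ ^ 2 * κ ∧
      distExpansion R u v = ‖v - u‖ * (1 - κ / 6) := by
  have hN : ‖v - u‖ ≠ 0 := norm_ne_zero_iff.2 hw
  set N := ‖v - u‖ with hNdef
  refine ⟨N⁻¹ • (v - u), R (N⁻¹ • (v - u)) u u (N⁻¹ • (v - u)), ?_, ?_, rfl, ?_, ?_, ?_⟩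
  · rw [norm_smul, norm_inv, norm_norm, ← hNdef, inv_mul_cancel₀ hN]
  · rw [smul_smul, mul_inv_cancel₀ hN, one_smul]; abel
  · have h1 := hbound (N⁻¹ • (v - u)) u u (N⁻¹ • (v - u))
    have h2 : ‖N⁻¹ • (v - u)‖ = 1 := by
      rw [norm_smul, norm_inv, norm_norm, ← hNdef, inv_mul_cancel₀ hN]
    rw [h2] at h1
    linarith
  · rw [hR.smul₁, hR.smul₄]; field_simp
  · rw [distExpansion, hR.smul₁, hR.smul₄, ← hNdef]; field_simp

/-- Upper bound on the distance from the length of a coordinate segment. -/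
theorem edist_le_distExpansion [IsRiemannianManifold I M] (x : M)
    {Φ : EuclideanSpace ℝ (Fin n) → EuclideanSpace ℝ (Fin n)} (hΦ : ContDiff ℝ 1 Φ)
    (hR : IsCurvatureLike R) {CR C₀ ρ : ℝ} (hC₀ : 0 ≤ C₀)
    (hbound : ∀ a b c d, |R a b c d| ≤ CR * ‖a‖ * ‖b‖ * ‖c‖ * ‖d‖)
    (hCR : 0 ≤ CR) (hsmall : CR * ρ ^ 2 ≤ 1 / 2)
    (htarget : ∀ z, ‖z‖ ≤ ρ → Φ z ∈ (extChartAt I x).target)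
    (hexp : ∀ z, ‖z‖ ≤ ρ → ∀ w, |pullbackForm (I := I) x Φ z w - (‖w‖ ^ 2 - R w z z w / 3)|
      ≤ C₀ * ‖z‖ ^ 3 * ‖w‖ ^ 2)
    {u v : EuclideanSpace ℝ (Fin n)} (hu : ‖u‖ ≤ ρ) (hv : ‖v‖ ≤ ρ) :
    edist ((extChartAt I x).symm (Φ u)) ((extChartAt I x).symm (Φ v))
      ≤ ENNReal.ofReal (distExpansion R u v + C₀ * ρ ^ 3 * ‖v - u‖) := by
  by_cases hw : v - u = 0
  · rw [sub_eq_zero.1 hw]; simp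
  have hρ0 : 0 ≤ ρ := (norm_nonneg u).trans hu
  obtain ⟨a, κ, ha, hva, -, hκ, hRκ, hdist⟩ := hR.distExpansion_eq hbound hw
  set N := ‖v - u‖ with hN
  have hκ' : |κ| ≤ 1 / 2 := hκ.trans (le_trans (by gcongr) hsmall)
  rw [abs_le] at hκ'
  have hE : 0 ≤ C₀ * ρ ^ 3 := by positivity
  have hN0 : 0 ≤ N := norm_nonneg _
  have hseg : ∀ t ∈ Icc (0 : ℝ) 1, ‖u + t • (v - u)‖ ≤ ρ := by
    intro t ht
    have h1 : u + t • (v - u) = (1 - t) • u + t • v := by module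
    rw [h1]
    calc ‖(1 - t) • u + t • v‖ ≤ ‖(1 - t) • u‖ + ‖t • v‖ := norm_add_le _ _
      _ = (1 - t) * ‖u‖ + t * ‖v‖ := by
        rw [norm_smul, norm_smul, Real.norm_of_nonneg ht.1,
          Real.norm_of_nonneg (sub_nonneg.2 ht.2)]
      _ ≤ (1 - t) * ρ + t * ρ := by
        have := ht.1; have := sub_nonneg.2 ht.2; gcongr
      _ = ρ := by ring
  rw [hdist]
  refine edist_le_of_pullbackForm_le x hΦ ?_ (fun t ht ↦ htarget _ (hseg t ht)) fun t ht ↦ ?_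
  · have : 0 ≤ N * (1 - κ / 6) := mul_nonneg hN0 (by linarith)
    positivity
  · have h1 := (abs_le.1 (hexp _ (hseg t ht) (v - u))).2
    -- Antisymmetry makes the curvature term independent of `t`, so the segment has almost constant
    -- speed.
    have h2 : R (v - u) (u + t • (v - u)) (u + t • (v - u)) (v - u) = N ^ 2 * κ := by
      rw [hR.add₂, hR.add₃, hR.smul₂, hR.smul₃, hR.self₁₂, hR.self₃₄, hRκ]; ring
    rw [h2, ← hN] at h1
    have h3 : C₀ * ‖u + t • (v - u)‖ ^ 3 * N ^ 2 ≤ C₀ * ρ ^ 3 * N ^ 2 := by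
      have := hseg t ht
      gcongr
    have h4 : (N * (1 - κ / 6) + C₀ * ρ ^ 3 * N) ^ 2
        = N ^ 2 * ((1 - κ / 6 + C₀ * ρ ^ 3) ^ 2) := by ring
    -- Holds because `(1 - κ/6)² ≥ 1 - κ/3` and, as `|κ| ≤ 1/2`, the cross term exceeds `C₀ * ρ ^
    -- 3`.
    have h5 : 1 - κ / 3 + C₀ * ρ ^ 3 ≤ (1 - κ / 6 + C₀ * ρ ^ 3) ^ 2 := by
      nlinarith [sq_nonneg κ, sq_nonneg (C₀ * ρ ^ 3)]
    rw [h4]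
    have h6 := mul_le_mul_of_nonneg_left h5 (sq_nonneg N)
    linarith

set_option maxHeartbeats 1000000 in
/-- In normal coordinates at an interior point, the distance is `distExpansion` up to an error of
relative size `ρ ^ 3` on the ball of radius `ρ`. -/
theorem exists_distance_expansion [IsRiemannianManifold I M] (x : M) (hx : I.IsInteriorPoint x)
    {Φ : EuclideanSpace ℝ (Fin n) → EuclideanSpace ℝ (Fin n)} (hΦ : ContDiff ℝ 1 Φ)
    (hΦ0 : Φ 0 = extChartAt I x x)
    {Φ' : EuclideanSpace ℝ (Fin n) ≃L[ℝ] EuclideanSpace ℝ (Fin n)} (hΦ' : fderiv ℝ Φ 0 = Φ')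
    (hR : IsCurvatureLike R) {C₀ : ℝ} (hC₀ : 0 ≤ C₀)
    (hexp : ∀ᶠ z in 𝓝 0, ∀ w, |pullbackForm (I := I) x Φ z w - (‖w‖ ^ 2 - R w z z w / 3)|
      ≤ C₀ * ‖z‖ ^ 3 * ‖w‖ ^ 2) :
    ∃ ψ : EuclideanSpace ℝ (Fin n) → M, ψ 0 = x ∧ ∃ r₀ > 0, ∃ C ≥ 0,
      (∀ ρ ≤ r₀, ∀ u v, ‖u‖ ≤ ρ → ‖v‖ ≤ ρ → edist (ψ u) (ψ v) ≠ ⊤ ∧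
        |(edist (ψ u) (ψ v)).toReal - distExpansion R u v| ≤ C * ρ ^ 3 * ‖v - u‖) ∧
      ∀ ρ > 0, ∃ δ > (0 : ℝ), ∀ p, edist x p < ENNReal.ofReal δ → ∃ z, ‖z‖ < ρ ∧ ψ z = p := by
  obtain ⟨CR, hCR, hbound⟩ := hR.exists_bound
  have htarget : ∀ᶠ z in 𝓝 0, Φ z ∈ (extChartAt I x).target := by
    refine hΦ.continuous.continuousAt.eventually_mem (?_ : (extChartAt I x).target ∈ 𝓝 (Φ 0))
    rw [hΦ0]
    exact mem_interior_iff_mem_nhds.1 (I.isInteriorPoint_iff.1 hx)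
  obtain ⟨r, hr, hball⟩ := Metric.eventually_nhds_iff_ball.1 (hexp.and htarget)
  -- Small enough that below `s` the curvature and remainder terms leave at least a quarter of the
  -- Euclidean form (`hlow`).
  set s := 1 / (4 * (1 + CR + C₀)) with hs
  have hs0 : 0 < s := by positivity
  have hs1 : s * (4 * (1 + CR + C₀)) = 1 := by rw [hs]; field_simp
  set r₁ := min r s with hr₁
  have hr₁0 : 0 < r₁ := lt_min hr hs0
  have hr₁s : r₁ ≤ s := min_le_right _ _
  have hsle : s ≤ 1 / 4 := by nlinarith
  have hball' : ∀ z : EuclideanSpace ℝ (Fin n), ‖z‖ < r₁ →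
      (∀ w, |pullbackForm (I := I) x Φ z w - (‖w‖ ^ 2 - R w z z w / 3)|
        ≤ C₀ * ‖z‖ ^ 3 * ‖w‖ ^ 2) ∧ Φ z ∈ (extChartAt I x).target := fun z hz ↦
    hball z (by simpa using hz.trans_le (min_le_left _ _))
  have hCRs : ∀ σ, 0 ≤ σ → σ ≤ r₁ → CR * σ ^ 2 ≤ 1 / 2 ∧ C₀ * σ ^ 3 ≤ 1 / 4 := by
    intro σ h0 h1
    have h2 : σ ≤ s := h1.trans hr₁s
    have h3 : σ ^ 2 ≤ s := by nlinarith
    have h4 : σ ^ 3 ≤ s := by nlinarith [pow_nonneg h0 2]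
    constructor
    · calc CR * σ ^ 2 ≤ CR * s := by gcongr
        _ ≤ 1 / 2 := by nlinarith
    · calc C₀ * σ ^ 3 ≤ C₀ * s := by gcongr
        _ ≤ 1 / 4 := by nlinarith
  have hlow : ∀ z : EuclideanSpace ℝ (Fin n), ‖z‖ < r₁ → ∀ w,
      ‖w‖ ^ 2 / 4 ≤ pullbackForm (I := I) x Φ z w := by
    intro z hz w
    have h1 := (abs_le.1 ((hball' z hz).1 w)).1
    obtain ⟨h2, h3⟩ := hCRs ‖z‖ (norm_nonneg _) hz.le
    have h4 := (le_abs_self _).trans (hbound w z z w)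
    have h5 : C₀ * ‖z‖ ^ 3 * ‖w‖ ^ 2 ≤ 1 / 4 * ‖w‖ ^ 2 := by gcongr
    have h6 : CR * ‖z‖ ^ 2 * ‖w‖ ^ 2 ≤ 1 / 2 * ‖w‖ ^ 2 := by gcongr
    have h7 : R w z z w ≤ CR * ‖z‖ ^ 2 * ‖w‖ ^ 2 := h4.trans_eq (by ring)
    nlinarith [sq_nonneg ‖w‖]
  obtain ⟨ζ, U, hU, hUψ, hζψ, hcal⟩ :=
    exists_local_inverse_and_calibration (I := I) x hx hΦ hΦ0 hΦ' hr₁0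
  set ψ : EuclideanSpace ℝ (Fin n) → M := fun z ↦ (extChartAt I x).symm (Φ z) with hψ
  have hψ0 : ψ 0 = x := by simp [hψ, hΦ0]
  have hζx : ζ x = 0 := by
    have := hζψ.self_of_nhds
    rwa [show (extChartAt I x).symm (Φ 0) = x from hψ0] at this
  obtain ⟨r₂, hr₂, hζψ'⟩ := Metric.eventually_nhds_iff_ball.1 hζψ
  obtain ⟨δ', hδ'0, hδ'U⟩ := EMetric.mem_nhds_iff.1 hU
  obtain ⟨δ, hδ0, hδ⟩ : ∃ δ : ℝ, 0 < δ ∧ ENNReal.ofReal δ ≤ δ' := by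
    obtain ⟨c, hc0, hc⟩ := ENNReal.lt_iff_exists_nnreal_btwn.1 hδ'0
    refine ⟨c, by exact_mod_cast hc0, by simpa using hc.le⟩
  have hδU : ∀ p, edist x p < ENNReal.ofReal δ → p ∈ U := fun p hp ↦
    hδ'U (by rw [Metric.mem_eball, edist_comm]; exact hp.trans_le hδ)
  -- first, a rough bound on the coordinates of nearby points
  have hrough : ∀ c ≤ δ, ∀ p, edist x p < ENNReal.ofReal c → ‖ζ p‖ ≤ 2 * c := by
    intro c hc p hp
    have hc0 : 0 ≤ c := by
      by_contra h
      rw [ENNReal.ofReal_of_nonpos (by linarith)] at hp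
      exact absurd hp (by simp)
    by_cases hp0 : ζ p = 0
    · rw [hp0, norm_zero]; linarith
    have hp' := hp
    rw [IsRiemannianManifold.out (I := I)] at hp'
    obtain ⟨γ, hγ0, hγ1, hγ, hlen⟩ := exists_lt_of_riemannianEDist_lt hp'
    have hγU : ∀ t ∈ Icc (0 : ℝ) 1, γ t ∈ U := fun t ht ↦ hδU _ <| by
      rw [← hγ0]
      exact (edist_le_pathELength hγ ht).trans_lt (hlen.trans_le (ENNReal.ofReal_le_ofReal hc))
    set a := ‖ζ p‖⁻¹ • ζ p with ha
    have han : ‖a‖ = 1 := by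
      rw [ha, norm_smul, norm_inv, norm_norm, inv_mul_cancel₀ (norm_ne_zero_iff.2 hp0)]
    have hfd : ∀ z w, fderiv ℝ (fun z ↦ inner ℝ a z) z w = inner ℝ a w := by
      intro z w
      have : (fun z ↦ inner ℝ a z) = (innerSL ℝ a : EuclideanSpace ℝ (Fin n) → ℝ) := by
        funext z; simp
      rw [this, ContinuousLinearMap.fderiv]; simp
    -- The linear function `⟨a, ·⟩` has slope at most `2`, since the metric is at least a quarter of
    -- the Euclidean one.
    have key := hcal γ hγ hγU (fun z ↦ inner ℝ a z) (contDiff_const.inner ℝ contDiff_id) 2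
      (by norm_num) (fun t ht w ↦ by
        rw [hfd]
        have h1 := abs_real_inner_le_norm a w
        rw [han, one_mul] at h1
        have h2 := hlow _ (hUψ _ (hγU t ht)).2 w
        refine h1.trans ?_
        have h3 : ‖w‖ / 2 ≤ √(pullbackForm (I := I) x Φ (ζ (γ t)) w) :=
          Real.le_sqrt_of_sq_le (by linarith [show (‖w‖ / 2) ^ 2 = ‖w‖ ^ 2 / 4 by ring])
        linarith)
    rw [hγ0, hγ1, hζx, inner_zero_right, sub_zero] at key
    have h4 : inner ℝ a (ζ p) = ‖ζ p‖ := by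
      rw [ha, inner_smul_left, real_inner_self_eq_norm_sq]
      simp only [conj_trivial]
      field_simp [norm_ne_zero_iff.2 hp0]
    rw [h4, abs_of_nonneg (norm_nonneg _)] at key
    have h5 : ENNReal.ofReal ‖ζ p‖ ≤ ENNReal.ofReal (2 * c) := by
      rw [ENNReal.ofReal_mul (by norm_num)]
      exact key.trans (by gcongr)
    exact (ENNReal.ofReal_le_ofReal_iff (by linarith)).1 h5
  -- A path used for the lower bound stays within `8ρ` of `x`, hence within coordinate radius `16ρ`.
  -- The choice of `r₀` keeps `8ρ ≤ δ` and `16ρ ≤ r₁`, and makes the local inverse valid at `u` and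
  -- `v`.
  set r₀ := min (min (r₁ / 17) (δ / 8)) (r₂ / 2) with hr₀
  have hr₀0 : 0 < r₀ := lt_min (lt_min (by positivity) (by positivity)) (by positivity)
  have hr₀1 : 17 * r₀ ≤ r₁ := by
    have : r₀ ≤ r₁ / 17 := (min_le_left _ _).trans (min_le_left _ _)
    linarith
  have hr₀δ : 8 * r₀ ≤ δ := by
    have : r₀ ≤ δ / 8 := (min_le_left _ _).trans (min_le_right _ _)
    linarith
  have hr₀2 : r₀ < r₂ := by
    have : r₀ ≤ r₂ / 2 := min_le_right _ _
    linarith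
  -- The constant of `calibration_arith` at `σ = 16ρ`. It is doubled in the final error because the
  -- relative error multiplies `d ≤ 2N`.
  set C₁ := 4 * (13 * CR ^ 2 + C₀) * 16 ^ 3 with hC₁
  have hC₁0 : 0 ≤ C₁ := by positivity
  refine ⟨ψ, hψ0, r₀, hr₀0, C₀ + 2 * C₁, by positivity, ?_, ?_⟩
  · intro ρ hρ u v hu hv
    have hρ0 : 0 ≤ ρ := (norm_nonneg u).trans hu
    have hρ1 : ρ ≤ r₁ := by linarith
    have hρlt : ρ < r₁ := by linarith
    obtain ⟨hs1', hs2'⟩ := hCRs ρ hρ0 hρ1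
    have hupper : ∀ u v : EuclideanSpace ℝ (Fin n), ‖u‖ ≤ ρ → ‖v‖ ≤ ρ →
        edist (ψ u) (ψ v) ≤ ENNReal.ofReal (distExpansion R u v + C₀ * ρ ^ 3 * ‖v - u‖) :=
      fun u v hu hv ↦ edist_le_distExpansion x hΦ hR hC₀ hbound hCR hs1'
        (fun z hz ↦ (hball' z (hz.trans_lt hρlt)).2) (fun z hz ↦ (hball' z (hz.trans_lt hρlt)).1)
        hu hv
    have htwo : ∀ u v : EuclideanSpace ℝ (Fin n), ‖u‖ ≤ ρ → ‖v‖ ≤ ρ →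
        edist (ψ u) (ψ v) ≤ ENNReal.ofReal (2 * ‖v - u‖) := by
      intro u v hu hv
      refine (hupper u v hu hv).trans (ENNReal.ofReal_le_ofReal ?_)
      by_cases hw : v - u = 0
      · simp [hw, distExpansion]
      obtain ⟨a, κ, ha, hva, -, hκ, hRκ, hdist⟩ := hR.distExpansion_eq hbound hw
      rw [hdist]
      have hκ' : |κ| ≤ 1 / 2 := hκ.trans (le_trans (by gcongr) hs1')
      rw [abs_le] at hκ'
      nlinarith [norm_nonneg (v - u)]
    have hdle := htwo u v hu hv
    have hfin : edist (ψ u) (ψ v) ≠ ⊤ := ne_top_of_le_ne_top ENNReal.ofReal_ne_top hdle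
    refine ⟨hfin, ?_⟩
    by_cases hw : v - u = 0
    · rw [sub_eq_zero.1 hw]; simp [distExpansion]
    have hN0 : 0 < ‖v - u‖ := norm_pos_iff.2 hw
    obtain ⟨a, κ, ha, hva, hκR, hκ, hRκ, hdist⟩ := hR.distExpansion_eq hbound hw
    have hup := hupper u v hu hv
    set N := ‖v - u‖ with hN
    have hκ' : |κ| ≤ 1 / 2 := hκ.trans (le_trans (by gcongr) hs1')
    rw [abs_le] at hκ'
    set d := (edist (ψ u) (ψ v)).toReal with hd
    have hdE : edist (ψ u) (ψ v) = ENNReal.ofReal d := (ENNReal.ofReal_toReal hfin).symm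
    have hd0 : 0 ≤ d := ENNReal.toReal_nonneg
    have hNρ : N ≤ 2 * ρ := by
      have := norm_sub_le v u
      linarith
    have hρpos : 0 < ρ := by linarith
    have hd2 : d ≤ 2 * N := by
      rw [hdE] at hdle
      exact (ENNReal.ofReal_le_ofReal_iff (by positivity)).1 hdle
    have hdup : d ≤ distExpansion R u v + C₀ * ρ ^ 3 * N := by
      rw [hdE] at hup
      refine (ENNReal.ofReal_le_ofReal_iff ?_).1 hup
      rw [hdist]
      have : 0 ≤ N * (1 - κ / 6) := mul_nonneg hN0.le (by linarith)
      positivity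
    -- the calibration bound
    have hcalib : ∀ c, d < c → c ≤ 5 * ρ → N * (1 - κ / 6) ≤ (1 + C₁ * ρ ^ 3) * c := by
      intro c hc hcρ
      have hc0 : 0 < c := hd0.trans_lt hc
      have hlt : edist (ψ u) (ψ v) < ENNReal.ofReal c := by
        rw [hdE]; exact (ENNReal.ofReal_lt_ofReal_iff hc0).2 hc
      rw [IsRiemannianManifold.out (I := I)] at hlt
      obtain ⟨γ, hγ0, hγ1, hγ, hlen⟩ := exists_lt_of_riemannianEDist_lt hlt
      have hxu : edist x (ψ u) ≤ ENNReal.ofReal (2 * ρ) := by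
        have := htwo 0 u (by simpa using hρ0) hu
        rw [hψ0, sub_zero] at this
        exact this.trans (ENNReal.ofReal_le_ofReal (by linarith))
      have hγx : ∀ t ∈ Icc (0 : ℝ) 1, edist x (γ t) < ENNReal.ofReal (8 * ρ) := by
        intro t ht
        calc edist x (γ t) ≤ edist x (ψ u) + edist (ψ u) (γ t) := edist_triangle _ _ _
          _ ≤ ENNReal.ofReal (2 * ρ) + ENNReal.ofReal c := by
              refine add_le_add hxu ?_
              rw [← hγ0]
              exact (edist_le_pathELength hγ ht).trans hlen.le
          _ = ENNReal.ofReal (2 * ρ + c) := (ENNReal.ofReal_add (by linarith) hc0.le).symm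
          _ < ENNReal.ofReal (8 * ρ) :=
              (ENNReal.ofReal_lt_ofReal_iff (by linarith)).2 (by linarith)
      have hγU : ∀ t ∈ Icc (0 : ℝ) 1, γ t ∈ U := fun t ht ↦
        hδU _ ((hγx t ht).trans_le (ENNReal.ofReal_le_ofReal (by linarith)))
      have hγz : ∀ t ∈ Icc (0 : ℝ) 1, ‖ζ (γ t)‖ ≤ 16 * ρ := fun t ht ↦
        (hrough (8 * ρ) (by linarith) _ (hγx t ht)).trans_eq (by ring)
      have h16 : 16 * ρ ≤ r₁ := by linarith
      obtain ⟨hs3, -⟩ := hCRs (16 * ρ) (by linarith) h16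
      have hΛ : 0 ≤ 1 + C₁ * ρ ^ 3 := by positivity
      have key := hcal γ hγ hγU (planeWave R a) (hR.contDiff_planeWave a) (1 + C₁ * ρ ^ 3) hΛ
        (fun t ht w ↦ by
          have hz := hγz t ht
          have hzr := (hUψ _ (hγU t ht)).2
          have h1 := (abs_le.1 ((hball' _ hzr).1 w)).1
          have h2 : C₀ * ‖ζ (γ t)‖ ^ 3 * ‖w‖ ^ 2 ≤ C₀ * (16 * ρ) ^ 3 * ‖w‖ ^ 2 := by gcongr
          have := hR.abs_fderiv_planeWave_le hCR hbound hC₀ (σ := 16 * ρ) (by linarith) hs3 ha hz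
            (h := pullbackForm (I := I) x Φ (ζ (γ t)) w) (by linarith) (hlow _ hzr w)
          refine this.trans_eq ?_
          rw [hC₁]; ring)
      have hζu : ζ (ψ u) = u := hζψ' u (by simpa using hu.trans_lt (hρ.trans_lt hr₀2))
      have hζv : ζ (ψ v) = v := hζψ' v (by simpa using hv.trans_lt (hρ.trans_lt hr₀2))
      rw [hγ0, hγ1, hζu, hζv] at key
      have hdiff : planeWave R a v - planeWave R a u = N * (1 - κ / 6) := by
        rw [hκR, ← hR.planeWave_sub ha N, ← hva]
      rw [hdiff] at key
      have h5 : ENNReal.ofReal |N * (1 - κ / 6)| ≤ ENNReal.ofReal ((1 + C₁ * ρ ^ 3) * c) := by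
        rw [ENNReal.ofReal_mul hΛ]
        exact key.trans (by gcongr)
      exact (le_abs_self _).trans ((ENNReal.ofReal_le_ofReal_iff (by positivity)).1 h5)
    have hcal' : N * (1 - κ / 6) ≤ (1 + C₁ * ρ ^ 3) * d := by
      have hΛ : 0 < 1 + C₁ * ρ ^ 3 := by positivity
      -- The infimum of lengths need not be attained, so the calibration is applied at `d + e'`. As
      -- `d ≤ 2N ≤ 4ρ`, taking `e' ≤ ρ` respects the limit `5ρ`.
      refine le_of_forall_pos_lt_add fun e he ↦ ?_
      set e' := min (e / 2 / (1 + C₁ * ρ ^ 3)) ρ with he'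
      have he'0 : 0 < e' := lt_min (by positivity) hρpos
      have h1 := hcalib (d + e') (by linarith) (by
        have : e' ≤ ρ := min_le_right _ _
        linarith)
      have h2 : (1 + C₁ * ρ ^ 3) * e' ≤ e / 2 := by
        calc (1 + C₁ * ρ ^ 3) * e' ≤ (1 + C₁ * ρ ^ 3) * (e / 2 / (1 + C₁ * ρ ^ 3)) := by
              gcongr; exact min_le_left _ _
          _ = e / 2 := by field_simp
      linarith
    have hE : 0 ≤ C₁ * ρ ^ 3 := by positivity
    have hC₀ρ : 0 ≤ C₀ * ρ ^ 3 * N := by positivity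
    rw [hdist] at hdup ⊢
    rw [abs_le]
    constructor
    · have h1 : C₁ * ρ ^ 3 * d ≤ C₁ * ρ ^ 3 * (2 * N) := by gcongr
      linarith
    · have : 0 ≤ C₁ * ρ ^ 3 * N := by positivity
      linarith
  · intro ρ hρ
    refine ⟨min δ (ρ / 4), lt_min hδ0 (by positivity), fun p hp ↦ ⟨ζ p, ?_, ?_⟩⟩
    · have := hrough (min δ (ρ / 4)) (min_le_left _ _) p hp
      have h2 : min δ (ρ / 4) ≤ ρ / 4 := min_le_right _ _
      linarith
    · exact (hUψ p (hδU p (hp.trans_le (ENNReal.ofReal_le_ofReal (min_le_left _ _))))).1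

end DistanceExpansion
end

noncomputable section

/-! ### Pairwise sums and the extent -/

/-- Passing to ordered pairs replaces the binomial normalization by `q(q-1)`, and the curvature sums
factor over the two indices. -/
theorem sum_sum_Ioi_eq_half {q : ℕ} {f : Fin q → Fin q → ℝ} (hsymm : ∀ i j, f i j = f j i)
    (hdiag : ∀ i, f i i = 0) :
    ∑ i, ∑ j ∈ Finset.Ioi i, f i j = 1 / 2 * ∑ i, ∑ j, f i j := by
  have h1 : ∀ i, ∑ j, f i j = ∑ j ∈ Finset.Ioi i, f i j + ∑ j ∈ Finset.Iio i, f i j := by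
    intro i
    rw [← Finset.sum_filter_add_sum_filter_not Finset.univ (fun j ↦ i < j)]
    congr 1
    · exact Finset.sum_congr (by ext; simp) fun _ _ ↦ rfl
    · have h2 : Finset.univ.filter (fun j ↦ ¬ i < j) = insert i (Finset.Iio i) := by
        ext j; simp [le_iff_eq_or_lt]
      rw [h2, Finset.sum_insert (by simp), hdiag, zero_add]
  have h3 : ∑ i, ∑ j ∈ Finset.Iio i, f i j = ∑ i, ∑ j ∈ Finset.Ioi i, f i j := by
    rw [Finset.sum_comm' (t' := Finset.univ) (s' := fun j ↦ Finset.Ioi j) (by simp)]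
    exact Finset.sum_congr rfl fun i _ ↦ Finset.sum_congr rfl fun j _ ↦ hsymm j i
  simp_rw [h1, Finset.sum_add_distrib, h3]
  ring

theorem sum_sum_Ioi_edist {X : Type*} [PseudoEMetricSpace X] {q : ℕ} (p : Fin q → X)
    (hfin : ∀ i j, edist (p i) (p j) ≠ ⊤) :
    ∑ i, ∑ j ∈ Finset.Ioi i, edist (p i) (p j)
      = ENNReal.ofReal (1 / 2 * ∑ i, ∑ j, (edist (p i) (p j)).toReal) := by
  rw [← sum_sum_Ioi_eq_half (f := fun i j ↦ (edist (p i) (p j)).toReal)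
    (fun i j ↦ by rw [edist_comm]) (fun i ↦ by simp),
    ENNReal.ofReal_sum_of_nonneg fun _ _ ↦ Finset.sum_nonneg fun _ _ ↦ ENNReal.toReal_nonneg]
  refine Finset.sum_congr rfl fun i _ ↦ ?_
  rw [ENNReal.ofReal_sum_of_nonneg fun _ _ ↦ ENNReal.toReal_nonneg]
  exact Finset.sum_congr rfl fun j _ ↦ (ENNReal.ofReal_toReal (hfin i j)).symm

theorem inv_choose_two_eq_ofReal {q : ℕ} (hq : 2 ≤ q) :
    ((q.choose 2 : ℕ) : ℝ≥0∞)⁻¹ = ENNReal.ofReal (2 / ((q : ℝ) * (q - 1))) := by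
  have hpos : (0 : ℝ) < (q.choose 2 : ℕ) := by exact_mod_cast Nat.choose_pos hq
  rw [← ENNReal.ofReal_natCast, ← ENNReal.ofReal_inv_of_pos hpos, Nat.cast_choose_two, inv_div]

theorem extent_le_ofReal {X : Type*} [PseudoEMetricSpace X] [Nonempty X] {q : ℕ}
    (hq : 2 ≤ q) {B : ℝ}
    (h : ∀ p : Fin q → X, (∀ i j, edist (p i) (p j) ≠ ⊤) ∧
      ∑ i, ∑ j, (edist (p i) (p j)).toReal ≤ q * (q - 1) * B) :
    0 ≤ B ∧ extent q X ≤ ENNReal.ofReal B := by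
  have hq' : (2 : ℝ) ≤ q := by exact_mod_cast hq
  have hpos : (0 : ℝ) < q * (q - 1) := by nlinarith
  -- A constant tuple already forces `B` to be nonnegative; this is needed later to return from
  -- `ℝ≥0∞` to real bounds.
  refine ⟨nonneg_of_mul_nonneg_right ((h fun _ ↦ Classical.arbitrary X).2.trans' (by positivity))
    hpos, ?_⟩
  rw [extent, inv_choose_two_eq_ofReal hq, ENNReal.mul_iSup]
  refine iSup_le fun p ↦ ?_
  rw [sum_sum_Ioi_edist p (h p).1, ← ENNReal.ofReal_mul (by positivity)]
  apply ENNReal.ofReal_le_ofReal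
  rw [div_mul_eq_mul_div, div_le_iff₀ hpos]
  linarith [(h p).2]

theorem ofReal_le_extent {X : Type*} [PseudoEMetricSpace X] {q : ℕ} (hq : 2 ≤ q) {B : ℝ}
    (p : Fin q → X) (hfin : ∀ i j, edist (p i) (p j) ≠ ⊤)
    (h : q * (q - 1) * B ≤ ∑ i, ∑ j, (edist (p i) (p j)).toReal) :
    ENNReal.ofReal B ≤ extent q X := by
  have hq' : (2 : ℝ) ≤ q := by exact_mod_cast hq
  have hpos : (0 : ℝ) < q * (q - 1) := by nlinarith
  rw [extent, inv_choose_two_eq_ofReal hq, ENNReal.mul_iSup]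
  refine le_iSup_of_le p ?_
  rw [sum_sum_Ioi_edist p hfin, ← ENNReal.ofReal_mul (by positivity)]
  apply ENNReal.ofReal_le_ofReal
  rw [div_mul_eq_mul_div, le_div_iff₀ hpos]
  linarith

/-! ### Regular simplices and their stability -/

/-- The edge length of the regular `n`-simplex inscribed in the unit sphere of `ℝⁿ`. -/
def simplexEdge (n : ℕ) : ℝ := √(2 * (((n : ℝ) + 1) / n))

theorem simplexEdge_sq {n : ℕ} : simplexEdge n ^ 2 = 2 * (((n : ℝ) + 1) / n) :=
  Real.sq_sqrt (by positivity)

theorem simplexEdge_pos {n : ℕ} (hn : 1 ≤ n) : 0 < simplexEdge n := by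
  have : (0 : ℝ) < n := by exact_mod_cast hn
  exact Real.sqrt_pos.2 (by positivity)

theorem simplexEdge_le_two {n : ℕ} (hn : 1 ≤ n) : simplexEdge n ≤ 2 := by
  have : (1 : ℝ) ≤ n := by exact_mod_cast hn
  refine abs_le_of_sq_le_sq' ?_ (by norm_num) |>.2
  rw [simplexEdge_sq, ← mul_div_assoc, div_le_iff₀ (by linarith)]
  linarith

/-- Project the standard basis of `ℝⁿ⁺¹` to the hyperplane orthogonal to `(1, …, 1)`, identify it
isometrically with `ℝⁿ`, and rescale to unit length. -/
theorem exists_regular_simplex {n : ℕ} (hn : 1 ≤ n) :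
    ∃ b : Fin (n + 1) → EuclideanSpace ℝ (Fin n),
      ∀ i j, inner ℝ (b i) (b j) = if i = j then 1 else -1 / (n : ℝ) := by
  have hn0 : (0 : ℝ) < n := by exact_mod_cast hn
  set o : EuclideanSpace ℝ (Fin (n + 1)) := WithLp.toLp 2 fun _ ↦ 1 with ho
  have ho0 : o ≠ 0 := by
    intro h
    have := congrArg (fun z : EuclideanSpace ℝ (Fin (n + 1)) ↦ z 0) h
    simp [ho] at this
  have : Fact (Module.finrank ℝ (EuclideanSpace ℝ (Fin (n + 1))) = n + 1) := ⟨by simp⟩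
  have hdim : Module.finrank ℝ (ℝ ∙ o)ᗮ = n := Submodule.finrank_orthogonal_span_singleton ho0
  let e := ((stdOrthonormalBasis ℝ (ℝ ∙ o)ᗮ).reindex (finCongr hdim)).repr
  have hoo : inner ℝ o o = (n : ℝ) + 1 := by
    rw [real_inner_self_eq_norm_sq, EuclideanSpace.norm_sq_eq]; simp [ho]
  have hos : ∀ i, inner ℝ o (EuclideanSpace.single i (1 : ℝ)) = 1 := by
    intro i; simp [ho, EuclideanSpace.inner_single_right]
  have hso : ∀ i, inner ℝ (EuclideanSpace.single i (1 : ℝ)) o = 1 := by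
    intro i; rw [real_inner_comm, hos]
  have hss : ∀ i j : Fin (n + 1), inner ℝ (EuclideanSpace.single i (1 : ℝ))
      (EuclideanSpace.single j (1 : ℝ)) = if i = j then 1 else 0 := by
    intro i j
    rw [EuclideanSpace.inner_single_left]; simp
  let t : Fin (n + 1) → (ℝ ∙ o)ᗮ := fun i ↦
    ⟨EuclideanSpace.single i (1 : ℝ) - ((n : ℝ) + 1)⁻¹ • o, by
      rw [Submodule.mem_orthogonal_singleton_iff_inner_right, inner_sub_right, inner_smul_right,
        hos, hoo, inv_mul_cancel₀ (by positivity), sub_self]⟩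
  refine ⟨fun i ↦ √(((n : ℝ) + 1) / n) • e (t i), fun i j ↦ ?_⟩
  rw [inner_smul_left, inner_smul_right, LinearIsometryEquiv.inner_map_map, Submodule.coe_inner,
    ← mul_assoc]
  simp only [t, inner_sub_left, inner_sub_right, inner_smul_left, inner_smul_right, hoo, hos, hso,
    hss]
  simp only [conj_trivial]
  rw [Real.mul_self_sqrt (by positivity)]
  split_ifs <;> field_simp <;> ring

theorem norm_eq_one_of_simplex {n : ℕ} {b : Fin (n + 1) → EuclideanSpace ℝ (Fin n)}
    (hb : ∀ i j, inner ℝ (b i) (b j) = if i = j then 1 else -1 / (n : ℝ)) (i : Fin (n + 1)) :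
    ‖b i‖ = 1 := by
  have := hb i i
  rw [if_pos rfl, real_inner_self_eq_norm_sq] at this
  exact (pow_eq_one_iff_of_nonneg (norm_nonneg _) two_ne_zero).1 this

theorem sum_norm_sub_simplex {n : ℕ} (hn : 1 ≤ n) {b : Fin (n + 1) → EuclideanSpace ℝ (Fin n)}
    (hb : ∀ i j, inner ℝ (b i) (b j) = if i = j then 1 else -1 / (n : ℝ)) :
    ∑ i, ∑ j, ‖b j - b i‖ = n * (n + 1) * simplexEdge n := by
  have hn0 : (0 : ℝ) < n := by exact_mod_cast hn
  have h1 : ∀ i j, ‖b j - b i‖ = simplexEdge n - if i = j then simplexEdge n else 0 := by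
    intro i j
    split_ifs with h
    · simp [h]
    · rw [sub_zero, ← sq_eq_sq₀ (norm_nonneg _) (simplexEdge_pos hn).le, simplexEdge_sq,
        norm_sub_sq_real, norm_eq_one_of_simplex hb, norm_eq_one_of_simplex hb, hb,
        if_neg (Ne.symm h)]
      field_simp
      ring
  simp_rw [h1, Finset.sum_sub_distrib]
  simp only [Finset.sum_const, Finset.sum_ite_eq, Finset.mem_univ, if_true, Finset.card_univ,
    Fintype.card_fin, nsmul_eq_mul]
  push_cast
  ring

/-- `2 L` times the total defect of the distances of `n + 1` points of `ℝⁿ` from those of the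
regular simplex. -/
def simplexDefect {n : ℕ} (v : Fin (n + 1) → EuclideanSpace ℝ (Fin n)) : ℝ :=
  2 * simplexEdge n * (n * (n + 1) * simplexEdge n - ∑ i, ∑ j, ‖v j - v i‖)

/-- Expand the squares `(L - |v_j-v_i|)²` and use `∑|v_j-v_i|² = 2(n+1)∑|v_i|² - 2|∑v_i|²` together
with `nL² = 2(n+1)`. In the unit ball every term is nonnegative, which gives both optimality of the
regular simplex and its quantitative stability. -/
theorem simplexDefect_eq {n : ℕ} (hn : 1 ≤ n) (v : Fin (n + 1) → EuclideanSpace ℝ (Fin n)) :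
    simplexDefect v = 2 * (n + 1) * ∑ i, (1 - ‖v i‖ ^ 2) + 2 * ‖∑ i, v i‖ ^ 2
      + ∑ i, ∑ j, (if i = j then 0 else (simplexEdge n - ‖v j - v i‖) ^ 2) := by
  have hn0 : (0 : ℝ) < n := by exact_mod_cast hn
  have hL := simplexEdge_sq (n := n)
  have h1 : ∀ i j, (if i = j then 0 else (simplexEdge n - ‖v j - v i‖) ^ 2)
      = (simplexEdge n ^ 2 - 2 * simplexEdge n * ‖v j - v i‖ + ‖v j‖ ^ 2
        - 2 * inner ℝ (v j) (v i) + ‖v i‖ ^ 2) - (if i = j then simplexEdge n ^ 2 else 0) := by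
    intro i j
    split_ifs with h
    · subst h; simp; ring
    · rw [sub_zero]
      linear_combination norm_sub_sq_real (v j) (v i)
  have h2 : ‖∑ i, v i‖ ^ 2 = ∑ i, ∑ j, inner ℝ (v j) (v i) := by
    rw [← real_inner_self_eq_norm_sq, sum_inner, Finset.sum_comm]
    exact Finset.sum_congr rfl fun i _ ↦ by rw [inner_sum]
  simp only [h1, Finset.sum_sub_distrib, Finset.sum_add_distrib, ← Finset.mul_sum, h2,
    simplexDefect]
  simp only [Finset.sum_const, Finset.sum_ite_eq, Finset.mem_univ, if_true, Finset.card_univ,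
    Fintype.card_fin, nsmul_eq_mul, ← Finset.mul_sum]
  have h3 : (n : ℝ) * simplexEdge n ^ 2 = 2 * (n + 1) := by rw [hL]; field_simp
  push_cast
  linear_combination ((n : ℝ) + 1) * h3

theorem simplexDefect_nonneg {n : ℕ} (hn : 1 ≤ n) {v : Fin (n + 1) → EuclideanSpace ℝ (Fin n)}
    (hv : ∀ i, ‖v i‖ ≤ 1) : 0 ≤ simplexDefect v := by
  rw [simplexDefect_eq hn]
  have : 0 ≤ ∑ i, (1 - ‖v i‖ ^ 2) := Finset.sum_nonneg fun i _ ↦ by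
    nlinarith [hv i, norm_nonneg (v i)]
  have h2 : 0 ≤ ∑ i, ∑ j, (if i = j then 0 else (simplexEdge n - ‖v j - v i‖) ^ 2) :=
    Finset.sum_nonneg fun i _ ↦ Finset.sum_nonneg fun j _ ↦ by split_ifs <;> positivity
  positivity

theorem sq_edge_sub_le_simplexDefect {n : ℕ} (hn : 1 ≤ n)
    {v : Fin (n + 1) → EuclideanSpace ℝ (Fin n)} (hv : ∀ i, ‖v i‖ ≤ 1) {i j : Fin (n + 1)}
    (hij : i ≠ j) : (simplexEdge n - ‖v j - v i‖) ^ 2 ≤ simplexDefect v := by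
  rw [simplexDefect_eq hn]
  have : 0 ≤ ∑ i, (1 - ‖v i‖ ^ 2) := Finset.sum_nonneg fun i _ ↦ by
    nlinarith [hv i, norm_nonneg (v i)]
  have h2 : (simplexEdge n - ‖v j - v i‖) ^ 2
      ≤ ∑ i, ∑ j, (if i = j then 0 else (simplexEdge n - ‖v j - v i‖) ^ 2) := by
    refine le_trans ?_ (Finset.single_le_sum (fun i _ ↦ Finset.sum_nonneg fun j _ ↦ ?_)
      (Finset.mem_univ i))
    · refine le_trans ?_ (Finset.single_le_sum (fun j _ ↦ ?_) (Finset.mem_univ j))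
      · rw [if_neg hij]
      · split_ifs <;> positivity
    · split_ifs <;> positivity
  have h3 : 0 ≤ 2 * ((n : ℝ) + 1) * ∑ i, (1 - ‖v i‖ ^ 2) := by positivity
  nlinarith [sq_nonneg ‖∑ i, v i‖]

theorem one_sub_norm_sq_le_simplexDefect {n : ℕ} (hn : 1 ≤ n)
    {v : Fin (n + 1) → EuclideanSpace ℝ (Fin n)} (hv : ∀ i, ‖v i‖ ≤ 1) (i : Fin (n + 1)) :
    1 - ‖v i‖ ^ 2 ≤ simplexDefect v := by
  rw [simplexDefect_eq hn]
  have h0 : ∀ i, 0 ≤ 1 - ‖v i‖ ^ 2 := fun i ↦ by nlinarith [hv i, norm_nonneg (v i)]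
  have h1 : 1 - ‖v i‖ ^ 2 ≤ ∑ i, (1 - ‖v i‖ ^ 2) :=
    Finset.single_le_sum (f := fun i ↦ 1 - ‖v i‖ ^ 2) (fun i _ ↦ h0 i) (Finset.mem_univ i)
  have h2 : 0 ≤ ∑ i, ∑ j, (if i = j then 0 else (simplexEdge n - ‖v j - v i‖) ^ 2) :=
    Finset.sum_nonneg fun i _ ↦ Finset.sum_nonneg fun j _ ↦ by split_ifs <;> positivity
  have h3 : (0 : ℝ) ≤ n := n.cast_nonneg
  nlinarith [sq_nonneg ‖∑ i, v i‖, h0 i]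

/-- The second moment tensor `∑ vᵢ ⊗ vᵢ` minus its value `(n + 1) / n` on a regular simplex. -/
def momentDefect {n : ℕ} (v : Fin (n + 1) → EuclideanSpace ℝ (Fin n)) (a b : Fin n) : ℝ :=
  ∑ i, v i a * v i b - if a = b then ((n : ℝ) + 1) / n else 0

/-- The moment tensor and the Gram matrix, `VVᵀ` and `VᵀV`, have the same trace and Frobenius norm.
Closeness of the Gram matrix to the regular one thus controls the moment tensor without comparing
the points to an actual regular simplex. -/
theorem sum_sq_momentDefect {n : ℕ} (hn : 1 ≤ n) (v : Fin (n + 1) → EuclideanSpace ℝ (Fin n)) :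
    ∑ a, ∑ b, momentDefect v a b ^ 2 = ∑ i, ∑ j,
      (inner ℝ (v i) (v j) - if i = j then 1 else -1 / (n : ℝ)) ^ 2
        - 2 / n * ‖∑ i, v i‖ ^ 2 := by
  have hn0 : (0 : ℝ) < n := by exact_mod_cast hn
  have hin : ∀ x y : EuclideanSpace ℝ (Fin n), inner ℝ x y = ∑ a, x a * y a := by
    intro x y
    rw [PiLp.inner_apply]
    exact Finset.sum_congr rfl fun a _ ↦ by simp [mul_comm]
  have hT : ∑ a, ∑ b, (∑ i, v i a * v i b) ^ 2 = ∑ i, ∑ j, inner ℝ (v i) (v j) ^ 2 := by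
    simp_rw [hin, sq, Finset.sum_mul_sum]
    calc _ = ∑ a, ∑ i, ∑ b, ∑ j, v i a * v i b * (v j a * v j b) :=
          Finset.sum_congr rfl fun a _ ↦ Finset.sum_comm
      _ = ∑ i, ∑ a, ∑ j, ∑ b, v i a * v i b * (v j a * v j b) := by
          rw [Finset.sum_comm]
          exact Finset.sum_congr rfl fun i _ ↦ Finset.sum_congr rfl fun a _ ↦ Finset.sum_comm
      _ = _ := by
          refine Finset.sum_congr rfl fun i _ ↦ ?_
          rw [Finset.sum_comm]
          refine Finset.sum_congr rfl fun j _ ↦ Finset.sum_congr rfl fun a _ ↦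
            Finset.sum_congr rfl fun b _ ↦ by ring
  have htr : ∑ a, ∑ i, v i a * v i a = ∑ i, inner ℝ (v i) (v i) := by
    rw [Finset.sum_comm]; exact Finset.sum_congr rfl fun i _ ↦ (hin _ _).symm
  have h2 : ‖∑ i, v i‖ ^ 2 = ∑ i, ∑ j, inner ℝ (v i) (v j) := by
    rw [← real_inner_self_eq_norm_sq, sum_inner]
    exact Finset.sum_congr rfl fun i _ ↦ by rw [inner_sum]
  have hl : ∀ a b, momentDefect v a b ^ 2 = (∑ i, v i a * v i b) ^ 2
      + (if a = b then (((n : ℝ) + 1) / n) ^ 2 - 2 * (((n : ℝ) + 1) / n) * ∑ i, v i a * v i b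
        else 0) := by
    intro a b
    rw [momentDefect]
    split_ifs <;> ring
  have hr : ∀ i j, (inner ℝ (v i) (v j) - if i = j then 1 else -1 / (n : ℝ)) ^ 2
      = inner ℝ (v i) (v j) ^ 2 + 2 / n * inner ℝ (v i) (v j) + 1 / n ^ 2
        + if i = j then 1 - 1 / n ^ 2 - 2 * (((n : ℝ) + 1) / n) * inner ℝ (v i) (v j) else 0 := by
    intro i j
    split_ifs <;> field_simp <;> ring
  simp_rw [hl, hr, Finset.sum_add_distrib, h2, hT, Finset.sum_ite_eq, Finset.mem_univ, if_true,
    Finset.sum_sub_distrib, ← Finset.mul_sum, htr]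
  simp only [Finset.sum_const, Finset.card_univ, Fintype.card_fin, nsmul_eq_mul]
  push_cast
  field_simp
  ring

/-- Each of the `(n+1)²` squared Gram errors is at most `36` times the defect; the term `-2/n ‖∑ v
i‖²` only helps. -/
theorem abs_momentDefect_le {n : ℕ} (hn : 1 ≤ n) {v : Fin (n + 1) → EuclideanSpace ℝ (Fin n)}
    (hv : ∀ i, ‖v i‖ ≤ 1) (a b : Fin n) :
    |momentDefect v a b| ≤ 6 * (n + 1) * √(simplexDefect v) := by
  have hn0 : (0 : ℝ) < n := by exact_mod_cast hn
  have hD := simplexDefect_nonneg hn hv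
  have hL2 := simplexEdge_le_two hn
  have hL0 := simplexEdge_pos hn
  have hα : ∀ i, 0 ≤ 1 - ‖v i‖ ^ 2 ∧ 1 - ‖v i‖ ^ 2 ≤ 1 := fun i ↦ by
    constructor <;> nlinarith [hv i, norm_nonneg (v i)]
  have hpair : ∀ i j, (inner ℝ (v i) (v j) - if i = j then 1 else -1 / (n : ℝ)) ^ 2
      ≤ 36 * simplexDefect v := by
    intro i j
    have hi := one_sub_norm_sq_le_simplexDefect hn hv i
    have hj := one_sub_norm_sq_le_simplexDefect hn hv j
    have hαi : (1 - ‖v i‖ ^ 2) ^ 2 ≤ simplexDefect v := by nlinarith [hα i]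
    have hαj : (1 - ‖v j‖ ^ 2) ^ 2 ≤ simplexDefect v := by nlinarith [hα j]
    split_ifs with h
    · subst h
      rw [real_inner_self_eq_norm_sq]
      nlinarith
    · have hd := sq_edge_sub_le_simplexDefect hn hv h
      have hdd : ‖v j - v i‖ ≤ 2 := (norm_sub_le _ _).trans (by linarith [hv i, hv j])
      have hd0 := norm_nonneg (v j - v i)
      -- Polarization expresses the Gram error through the edge error and the two radial errors,
      -- each controlled by the defect.
      have key : inner ℝ (v i) (v j) - -1 / (n : ℝ)
          = 1 / 2 * ((simplexEdge n - ‖v j - v i‖) * (simplexEdge n + ‖v j - v i‖)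
            - (1 - ‖v i‖ ^ 2) - (1 - ‖v j‖ ^ 2)) := by
        have h1 := norm_sub_sq_real (v j) (v i)
        have h2 := simplexEdge_sq (n := n)
        have h3 : 2 * (((n : ℝ) + 1) / n) = 2 + 2 * (1 / n) := by field_simp
        rw [real_inner_comm]
        linear_combination -1 / 2 * h2 + 1 / 2 * h1 - 1 / 2 * h3
      rw [key]
      have h4 : ((simplexEdge n - ‖v j - v i‖) * (simplexEdge n + ‖v j - v i‖)) ^ 2
          ≤ 16 * simplexDefect v := by
        rw [mul_pow]
        have : (simplexEdge n + ‖v j - v i‖) ^ 2 ≤ 16 := by nlinarith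
        nlinarith [sq_nonneg (simplexEdge n - ‖v j - v i‖)]
      set X := (simplexEdge n - ‖v j - v i‖) * (simplexEdge n + ‖v j - v i‖)
      nlinarith [sq_nonneg (X + (1 - ‖v i‖ ^ 2)), sq_nonneg (X + (1 - ‖v j‖ ^ 2)),
        sq_nonneg ((1 - ‖v i‖ ^ 2) - (1 - ‖v j‖ ^ 2))]
  have hsum := sum_sq_momentDefect hn v
  have h1 : momentDefect v a b ^ 2 ≤ ∑ a, ∑ b, momentDefect v a b ^ 2 :=
    le_trans (Finset.single_le_sum (f := fun b ↦ momentDefect v a b ^ 2)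
      (fun _ _ ↦ sq_nonneg _) (Finset.mem_univ b))
      (Finset.single_le_sum (f := fun a ↦ ∑ b, momentDefect v a b ^ 2)
        (fun _ _ ↦ Finset.sum_nonneg fun _ _ ↦ sq_nonneg _) (Finset.mem_univ a))
  have h2 : ∑ i, ∑ j, (inner ℝ (v i) (v j) - if i = j then 1 else -1 / (n : ℝ)) ^ 2
      ≤ ∑ _i : Fin (n + 1), ∑ _j : Fin (n + 1), 36 * simplexDefect v :=
    Finset.sum_le_sum fun i _ ↦ Finset.sum_le_sum fun j _ ↦ hpair i j
  simp only [Finset.sum_const, Finset.card_univ, Fintype.card_fin, nsmul_eq_mul] at h2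
  push_cast at h2
  have h3 : 0 ≤ 2 / (n : ℝ) * ‖∑ i, v i‖ ^ 2 := by positivity
  apply abs_le_of_sq_le_sq _ (by positivity)
  rw [mul_pow, Real.sq_sqrt hD]
  linarith

/-! ### The second order term -/

/-- The full contraction `∑ R(e_a, e_b, e_b, e_a)`. -/
def scalarContraction {n : ℕ} (R : EuclideanSpace ℝ (Fin n) → EuclideanSpace ℝ (Fin n) →
    EuclideanSpace ℝ (Fin n) → EuclideanSpace ℝ (Fin n) → ℝ) : ℝ :=
  ∑ a, ∑ b, R (EuclideanSpace.single a 1) (EuclideanSpace.single b 1)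
    (EuclideanSpace.single b 1) (EuclideanSpace.single a 1)

end

noncomputable section

/-! ### Curvature sums over nearly regular simplices -/

section SecondOrder

variable {n : ℕ} {R : EuclideanSpace ℝ (Fin n) → EuclideanSpace ℝ (Fin n) →
  EuclideanSpace ℝ (Fin n) → EuclideanSpace ℝ (Fin n) → ℝ}

/-- The sum is the pairing of `B` with `∑ vᵢ ⊗ vᵢ`, split into its isotropic part, which yields the
trace, and the moment defect. -/
theorem sum_bilin_eq_momentDefect
    (B : EuclideanSpace ℝ (Fin n) →ₗ[ℝ] EuclideanSpace ℝ (Fin n) →ₗ[ℝ] ℝ)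
    (v : Fin (n + 1) → EuclideanSpace ℝ (Fin n)) :
    ∑ i, B (v i) (v i) = ((n : ℝ) + 1) / n
        * ∑ a, B (EuclideanSpace.single a 1) (EuclideanSpace.single a 1)
      + ∑ a, ∑ b, momentDefect v a b
        * B (EuclideanSpace.single a 1) (EuclideanSpace.single b 1) := by
  have h1 : ∀ i, B (v i) (v i) = ∑ a, ∑ b, v i a * v i b
      * B (EuclideanSpace.single a 1) (EuclideanSpace.single b 1) := by
    intro i
    rw [LinearMap.apply_eq_sum_single B (v i), LinearMap.sum_apply]
    refine Finset.sum_congr rfl fun a _ ↦ ?_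
    rw [LinearMap.smul_apply, LinearMap.apply_eq_sum_single (B _) (v i), Finset.smul_sum]
    exact Finset.sum_congr rfl fun b _ ↦ by simp only [smul_eq_mul]; ring
  simp_rw [h1, momentDefect, sub_mul, Finset.sum_sub_distrib, Finset.sum_mul, ite_mul, zero_mul,
    Finset.sum_ite_eq, Finset.mem_univ, if_true, ← Finset.mul_sum]
  rw [add_sub_cancel, Finset.sum_comm]
  exact Finset.sum_congr rfl fun a _ ↦ Finset.sum_comm

/-- The curvature sum over the pairs of `n + 1` points in the unit ball is close to that of the
regular simplex. -/
theorem IsCurvatureLike.exists_abs_sum_sub_le (hn : 1 ≤ n) (hR : IsCurvatureLike R) :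
    ∃ C, 0 ≤ C ∧ ∀ v : Fin (n + 1) → EuclideanSpace ℝ (Fin n), (∀ i, ‖v i‖ ≤ 1) →
      |∑ i, ∑ j, R (v j) (v i) (v i) (v j) - (((n : ℝ) + 1) / n) ^ 2 * scalarContraction R|
        ≤ C * √(simplexDefect v) := by
  obtain ⟨CR, hCR, hb⟩ := hR.exists_bound
  set K : ℝ := 6 * (n + 1) with hK
  set c : ℝ := ((n : ℝ) + 1) / n with hc
  have hc0 : 0 ≤ c := by positivity
  refine ⟨(n + 1) * (n * n * (K * CR)) + c * (n * (n * n * (K * CR))), by positivity,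
    fun v hv ↦ ?_⟩
  set Q := √(simplexDefect v)
  have hQ : 0 ≤ Q := Real.sqrt_nonneg _
  have hE : ∀ a b, |momentDefect v a b| ≤ K * Q := fun a b ↦ abs_momentDefect_le hn hv a b
  let e : Fin n → EuclideanSpace ℝ (Fin n) := fun a ↦ EuclideanSpace.single a 1
  have he : ∀ a, ‖e a‖ = 1 := fun a ↦ by simp [e]
  have herr : ∀ f : Fin n → Fin n → ℝ, (∀ a b, |f a b| ≤ CR) →
      |∑ a, ∑ b, momentDefect v a b * f a b| ≤ n * n * (K * CR) * Q := by
    intro f hf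
    refine (Finset.abs_sum_le_sum_abs _ _).trans ?_
    have : ∀ a ∈ Finset.univ, |∑ b, momentDefect v a b * f a b| ≤ n * (K * CR * Q) := by
      intro a _
      refine (Finset.abs_sum_le_sum_abs _ _).trans ?_
      refine (Finset.sum_le_card_nsmul _ _ (K * CR * Q) fun b _ ↦ ?_).trans ?_
      · rw [abs_mul]
        calc _ ≤ (K * Q) * CR := mul_le_mul (hE a b) (hf a b) (abs_nonneg _) (by positivity)
          _ = _ := by ring
      · simp
    refine (Finset.sum_le_card_nsmul _ _ _ this).trans ?_
    simp only [Finset.card_univ, Fintype.card_fin, nsmul_eq_mul]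
    exact le_of_eq (by ring)
  have h1 : ∀ i, ∑ j, R (v j) (v i) (v i) (v j)
      = c * ∑ a, R (e a) (v i) (v i) (e a)
        + ∑ a, ∑ b, momentDefect v a b * R (e a) (v i) (v i) (e b) := fun i ↦
    sum_bilin_eq_momentDefect (hR.outer (v i) (v i)) v
  have h2 : ∀ a, ∑ i, R (e a) (v i) (v i) (e a) = c * ∑ b, R (e a) (e b) (e b) (e a)
        + ∑ b, ∑ d, momentDefect v b d * R (e a) (e b) (e d) (e a) := fun a ↦
    sum_bilin_eq_momentDefect (hR.inner₂₃ (e a) (e a)) v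
  -- The outer points are averaged first and the inner ones next; each averaging gives a factor
  -- `(n+1)/n` and one error linear in the moment defect.
  have h3 : ∑ i, ∑ j, R (v j) (v i) (v i) (v j) - c ^ 2 * scalarContraction R
      = ∑ i, (∑ a, ∑ b, momentDefect v a b * R (e a) (v i) (v i) (e b))
        + c * ∑ a, ∑ b, ∑ d, momentDefect v b d * R (e a) (e b) (e d) (e a) := by
    simp_rw [h1, Finset.sum_add_distrib, ← Finset.mul_sum]
    rw [Finset.sum_comm (f := fun i a ↦ R (e a) (v i) (v i) (e a))]
    simp_rw [h2, Finset.sum_add_distrib, ← Finset.mul_sum, scalarContraction, e]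
    ring
  rw [h3]
  have h4 : |∑ i, (∑ a, ∑ b, momentDefect v a b * R (e a) (v i) (v i) (e b))|
      ≤ (n + 1) * (n * n * (K * CR) * Q) := by
    refine (Finset.abs_sum_le_sum_abs _ _).trans ?_
    refine (Finset.sum_le_card_nsmul _ _ (n * n * (K * CR) * Q) fun i _ ↦ herr _ fun a b ↦ ?_).trans
      (by simp)
    refine (hb _ _ _ _).trans ?_
    rw [he, he]
    have := hv i
    have h0 := norm_nonneg (v i)
    have : CR * (‖v i‖ * ‖v i‖) ≤ CR * 1 := by gcongr; nlinarith
    linarith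
  have h5 : |∑ a, ∑ b, ∑ d, momentDefect v b d * R (e a) (e b) (e d) (e a)|
      ≤ n * (n * n * (K * CR) * Q) := by
    refine (Finset.abs_sum_le_sum_abs _ _).trans ?_
    refine (Finset.sum_le_card_nsmul _ _ (n * n * (K * CR) * Q) fun i _ ↦ herr _ fun a b ↦ ?_).trans
      (by simp)
    refine (hb _ _ _ _).trans ?_
    simp only [he, mul_one, le_refl]
  refine (abs_add_le _ _).trans ?_
  rw [abs_mul, abs_of_nonneg hc0]
  have := mul_le_mul_of_nonneg_left h5 hc0
  linarith

theorem IsCurvatureLike.sub_outer (hR : IsCurvatureLike R) (u v : EuclideanSpace ℝ (Fin n)) :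
    R (v - u) u u (v - u) = R v u u v := by
  rw [sub_eq_add_neg, hR.add₁, hR.add₄, hR.add₄, ← neg_one_smul ℝ u, hR.smul₁, hR.smul₄,
    hR.smul₁, hR.smul₄, hR.self₁₂, hR.self₁₂, hR.self₃₄]
  ring

/-- Replacing the denominators by the regular edge is harmless even when points nearly collide,
because antisymmetry makes the numerator `O(|v_j-v_i|²)`. -/
theorem IsCurvatureLike.exists_abs_sum_div_sub_le (hn : 1 ≤ n) (hR : IsCurvatureLike R) :
    ∃ C, 0 ≤ C ∧ ∀ v : Fin (n + 1) → EuclideanSpace ℝ (Fin n), (∀ i, ‖v i‖ ≤ 1) →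
      |∑ i, ∑ j, R (v j - v i) (v i) (v i) (v j - v i) / (6 * ‖v j - v i‖)
        - (((n : ℝ) + 1) / n) ^ 2 * scalarContraction R / (6 * simplexEdge n)|
          ≤ C * √(simplexDefect v) := by
  obtain ⟨CR, hCR, hb⟩ := hR.exists_bound
  obtain ⟨C, hC, hsum⟩ := hR.exists_abs_sum_sub_le hn
  have hL := simplexEdge_pos hn
  refine ⟨(n + 1) * (n + 1) * (CR / (3 * simplexEdge n)) + C / (6 * simplexEdge n), by positivity,
    fun v hv ↦ ?_⟩
  set Q := √(simplexDefect v)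
  have hQ : 0 ≤ Q := Real.sqrt_nonneg _
  have hD := simplexDefect_nonneg hn hv
  have h1 : ∀ i j, |R (v j - v i) (v i) (v i) (v j - v i) / (6 * ‖v j - v i‖)
      - R (v j) (v i) (v i) (v j) / (6 * simplexEdge n)| ≤ CR / (3 * simplexEdge n) * Q := by
    intro i j
    rw [hR.sub_outer]
    by_cases hij : v j - v i = 0
    · have : R (v j) (v i) (v i) (v j) = 0 := by
        rw [sub_eq_zero.1 hij, hR.self₁₂]
      rw [this]; simp; positivity
    have hd : 0 < ‖v j - v i‖ := norm_pos_iff.2 hij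
    have hne : i ≠ j := fun h ↦ hij (by rw [h, sub_self])
    have h2 : |simplexEdge n - ‖v j - v i‖| ≤ Q :=
      Real.abs_le_sqrt (sq_edge_sub_le_simplexDefect hn hv hne)
    have h3 : |R (v j) (v i) (v i) (v j)| ≤ CR * ‖v j - v i‖ ^ 2 := by
      rw [← hR.sub_outer]
      refine (hb _ _ _ _).trans ?_
      have h0 := norm_nonneg (v i)
      have : ‖v i‖ * ‖v i‖ ≤ 1 := by nlinarith [hv i]
      calc _ = CR * ‖v j - v i‖ ^ 2 * (‖v i‖ * ‖v i‖) := by ring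
        _ ≤ CR * ‖v j - v i‖ ^ 2 * 1 := by gcongr
        _ = _ := mul_one _
    have hdd : ‖v j - v i‖ ≤ 2 := (norm_sub_le _ _).trans (by linarith [hv i, hv j])
    have h4 : R (v j) (v i) (v i) (v j) / (6 * ‖v j - v i‖)
        - R (v j) (v i) (v i) (v j) / (6 * simplexEdge n)
        = R (v j) (v i) (v i) (v j) * (simplexEdge n - ‖v j - v i‖)
          / (6 * simplexEdge n * ‖v j - v i‖) := by
      field_simp
    rw [h4, abs_div, abs_mul, abs_of_pos (show 0 < 6 * simplexEdge n * ‖v j - v i‖ by positivity),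
      div_le_iff₀ (by positivity)]
    calc _ ≤ (CR * ‖v j - v i‖ ^ 2) * Q := mul_le_mul h3 h2 (abs_nonneg _) (by positivity)
      _ = CR * Q * ‖v j - v i‖ * ‖v j - v i‖ := by ring
      _ ≤ CR * Q * ‖v j - v i‖ * 2 := by gcongr
      _ = _ := by field_simp; ring
  have h5 : |∑ i, ∑ j, (R (v j - v i) (v i) (v i) (v j - v i) / (6 * ‖v j - v i‖)
      - R (v j) (v i) (v i) (v j) / (6 * simplexEdge n))|
        ≤ (n + 1) * ((n + 1) * (CR / (3 * simplexEdge n) * Q)) := by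
    refine (Finset.abs_sum_le_sum_abs _ _).trans ?_
    refine (Finset.sum_le_card_nsmul _ _ ((n + 1) * (CR / (3 * simplexEdge n) * Q))
      fun i _ ↦ ?_).trans (by simp)
    refine (Finset.abs_sum_le_sum_abs _ _).trans ?_
    exact (Finset.sum_le_card_nsmul _ _ _ fun j _ ↦ h1 i j).trans (by simp)
  have h6 := hsum v hv
  have h7 : ∑ i, ∑ j, R (v j - v i) (v i) (v i) (v j - v i) / (6 * ‖v j - v i‖)
      - (((n : ℝ) + 1) / n) ^ 2 * scalarContraction R / (6 * simplexEdge n)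
      = ∑ i, ∑ j, (R (v j - v i) (v i) (v i) (v j - v i) / (6 * ‖v j - v i‖)
        - R (v j) (v i) (v i) (v j) / (6 * simplexEdge n))
      + (∑ i, ∑ j, R (v j) (v i) (v i) (v j) - (((n : ℝ) + 1) / n) ^ 2 * scalarContraction R)
        / (6 * simplexEdge n) := by
    simp_rw [Finset.sum_sub_distrib, ← Finset.sum_div]
    ring
  rw [h7]
  refine (abs_add_le _ _).trans ?_
  rw [abs_div, abs_of_pos (show 0 < 6 * simplexEdge n by positivity)]
  have h8 := div_le_div_of_nonneg_right h6 (show 0 ≤ 6 * simplexEdge n by positivity)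
  calc _ ≤ (n + 1) * ((n + 1) * (CR / (3 * simplexEdge n) * Q))
        + C * Q / (6 * simplexEdge n) := add_le_add h5 h8
    _ = _ := by ring

theorem IsCurvatureLike.distExpansion_smul (hR : IsCurvatureLike R) (ρ : ℝ) (hρ : 0 ≤ ρ)
    (u v : EuclideanSpace ℝ (Fin n)) :
    distExpansion R (ρ • u) (ρ • v)
      = ρ * ‖v - u‖ - ρ ^ 3 * (R (v - u) u u (v - u) / (6 * ‖v - u‖)) := by
  rw [distExpansion, ← smul_sub, norm_smul, Real.norm_of_nonneg hρ, hR.smul₁, hR.smul₂, hR.smul₃,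
    hR.smul₄]
  rcases hρ.eq_or_lt with h | h
  · rw [← h]; simp
  by_cases hw : ‖v - u‖ = 0
  · rw [hw]; simp
  · field_simp

theorem IsCurvatureLike.sum_distExpansion_smul (hR : IsCurvatureLike R) {ρ : ℝ} (hρ : 0 ≤ ρ)
    (v : Fin (n + 1) → EuclideanSpace ℝ (Fin n)) :
    ∑ i, ∑ j, distExpansion R (ρ • v i) (ρ • v j) = ρ * ∑ i, ∑ j, ‖v j - v i‖
      - ρ ^ 3 * ∑ i, ∑ j, R (v j - v i) (v i) (v i) (v j - v i) / (6 * ‖v j - v i‖) := by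
  simp_rw [hR.distExpansion_smul ρ hρ, Finset.sum_sub_distrib, ← Finset.mul_sum]

/-- The sum of the expanded distances of `n + 1` points in a ball of radius `ρ`. -/
theorem IsCurvatureLike.exists_sum_distExpansion_le (hn : 1 ≤ n) (hR : IsCurvatureLike R) :
    ∃ C, 0 ≤ C ∧ ∀ ρ, 0 < ρ → ∀ z : Fin (n + 1) → EuclideanSpace ℝ (Fin n), (∀ i, ‖z i‖ ≤ ρ) →
      ∑ i, ∑ j, distExpansion R (z i) (z j) ≤ n * (n + 1) * simplexEdge n * ρ
        - (((n : ℝ) + 1) / n) ^ 2 * scalarContraction R / (6 * simplexEdge n) * ρ ^ 3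
        + C * ρ ^ 5 := by
  obtain ⟨C, hC, hsum⟩ := hR.exists_abs_sum_div_sub_le hn
  have hL := simplexEdge_pos hn
  refine ⟨C ^ 2 * simplexEdge n / 2, by positivity, fun ρ hρ z hz ↦ ?_⟩
  obtain ⟨v, hv⟩ : ∃ v : Fin (n + 1) → EuclideanSpace ℝ (Fin n), ∀ i, z i = ρ • v i :=
    ⟨fun i ↦ ρ⁻¹ • z i, fun i ↦ by rw [smul_smul, mul_inv_cancel₀ hρ.ne', one_smul]⟩
  have hv1 : ∀ i, ‖v i‖ ≤ 1 := by
    intro i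
    have := hz i
    rw [hv, norm_smul, Real.norm_of_nonneg hρ.le] at this
    exact le_of_mul_le_mul_left (by linarith) hρ
  simp_rw [hv]
  rw [hR.sum_distExpansion_smul hρ.le]
  have h1 := (abs_le.1 (hsum v hv1)).1
  set Y := (((n : ℝ) + 1) / n) ^ 2 * scalarContraction R / (6 * simplexEdge n)
  set K := ∑ i, ∑ j, R (v j - v i) (v i) (v i) (v j - v i) / (6 * ‖v j - v i‖)
  have hD := simplexDefect_nonneg hn hv1
  have hq := Real.sq_sqrt hD
  set q := √(simplexDefect v)
  rw [simplexDefect] at hq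
  set D := ∑ i, ∑ j, ‖v j - v i‖
  have h2 : D = n * (n + 1) * simplexEdge n - q ^ 2 / (2 * simplexEdge n) := by
    rw [hq]; field_simp; ring
  have h3 : ρ ^ 3 * (Y - C * q) ≤ ρ ^ 3 * K := by gcongr; linarith
  -- Completing the square: the first-order loss `ρq²/(2L)` dominates the curvature gain `Cρ³q` up
  -- to `C²Lρ⁵/2`.
  have h4 : ρ * (q ^ 2 / (2 * simplexEdge n)) - ρ ^ 3 * (C * q)
      + C ^ 2 * simplexEdge n / 2 * ρ ^ 5
      = ρ / (2 * simplexEdge n) * (q - C * simplexEdge n * ρ ^ 2) ^ 2 := by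
    field_simp; ring
  have h5 : 0 ≤ ρ / (2 * simplexEdge n) * (q - C * simplexEdge n * ρ ^ 2) ^ 2 := by positivity
  rw [h2]
  nlinarith

/-- Equality for a regular simplex. -/
theorem IsCurvatureLike.sum_distExpansion_simplex (hn : 1 ≤ n) (hR : IsCurvatureLike R)
    {b : Fin (n + 1) → EuclideanSpace ℝ (Fin n)}
    (hb : ∀ i j, inner ℝ (b i) (b j) = if i = j then 1 else -1 / (n : ℝ)) {ρ : ℝ} (hρ : 0 ≤ ρ) :
    ∑ i, ∑ j, distExpansion R (ρ • b i) (ρ • b j) = n * (n + 1) * simplexEdge n * ρ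
        - (((n : ℝ) + 1) / n) ^ 2 * scalarContraction R / (6 * simplexEdge n) * ρ ^ 3 := by
  have hL := simplexEdge_pos hn
  have hdist := sum_norm_sub_simplex hn hb
  -- With zero defect the stability estimate becomes an exact evaluation.
  have hD0 : simplexDefect b = 0 := by rw [simplexDefect, hdist]; ring
  obtain ⟨C, -, hsum⟩ := hR.exists_abs_sum_div_sub_le hn
  have h1 := hsum b fun i ↦ (norm_eq_one_of_simplex hb i).le
  rw [hD0, Real.sqrt_zero, mul_zero] at h1
  have h2 := abs_nonpos_iff.1 h1
  rw [hR.sum_distExpansion_smul hρ, hdist]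
  linear_combination (-ρ ^ 3) * h2

end SecondOrder

end

/-! ### The extent of Euclidean balls and of small metric balls -/

noncomputable section

theorem extent_closedBall_one {n : ℕ} (hn : 1 ≤ n) :
    extent (n + 1) (Metric.closedBall (0 : EuclideanSpace ℝ (Fin n)) 1)
      = ENNReal.ofReal (simplexEdge n) := by
  have hL := simplexEdge_pos hn
  have hdist : ∀ u v : EuclideanSpace ℝ (Fin n), (edist u v).toReal = ‖v - u‖ := fun u v ↦ by
    rw [edist_dist, ENNReal.toReal_ofReal dist_nonneg, dist_comm, dist_eq_norm]
  apply le_antisymm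
  · have : Nonempty (Metric.closedBall (0 : EuclideanSpace ℝ (Fin n)) 1) := ⟨⟨0, by simp⟩⟩
    refine (extent_le_ofReal (by omega) fun p ↦ ⟨fun i j ↦ edist_ne_top _ _, ?_⟩).2
    have h := simplexDefect_nonneg hn (v := fun i ↦ (p i : EuclideanSpace ℝ (Fin n)))
      fun i ↦ mem_closedBall_zero_iff.1 (p i).2
    simp_rw [Subtype.edist_eq, hdist]
    rw [simplexDefect] at h
    have := nonneg_of_mul_nonneg_right h (by positivity)
    push_cast
    linarith
  · obtain ⟨b, hb⟩ := exists_regular_simplex hn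
    refine ofReal_le_extent (by omega) (fun i ↦ ⟨b i, ?_⟩) (fun i j ↦ edist_ne_top _ _) ?_
    · simp [norm_eq_one_of_simplex hb]
    · simp_rw [Subtype.edist_eq, hdist, sum_norm_sub_simplex hn hb]
      push_cast
      exact le_of_eq (by ring)

variable {n : ℕ} {R : EuclideanSpace ℝ (Fin n) → EuclideanSpace ℝ (Fin n) →
  EuclideanSpace ℝ (Fin n) → EuclideanSpace ℝ (Fin n) → ℝ}

theorem IsCurvatureLike.distExpansion_zero_left (hR : IsCurvatureLike R)
    (v : EuclideanSpace ℝ (Fin n)) : distExpansion R 0 v = ‖v‖ := by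
  have h : R v 0 0 v = 0 := by simpa using hR.smul₂ 0 v 0 0 v
  simp [distExpansion, h]

set_option maxHeartbeats 800000 in
/-- If near `x` the distance of `X` is `distExpansion` up to relative error `ρ ^ 3` in suitable
coordinates, then the `(n + 1)`-extent of small balls about `x` is that of the regular simplex,
corrected by the full contraction of `R`. -/
theorem IsCurvatureLike.exists_extent_expansion (hn : 1 ≤ n) (hR : IsCurvatureLike R)
    {X : Type*} [PseudoEMetricSpace X] {x : X} {ψ : EuclideanSpace ℝ (Fin n) → X} (hψ0 : ψ 0 = x)
    {r₀ C : ℝ} (hr₀ : 0 < r₀) (hC : 0 ≤ C)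
    (hdist : ∀ ρ ≤ r₀, ∀ u v, ‖u‖ ≤ ρ → ‖v‖ ≤ ρ → edist (ψ u) (ψ v) ≠ ⊤ ∧
      |(edist (ψ u) (ψ v)).toReal - distExpansion R u v| ≤ C * ρ ^ 3 * ‖v - u‖)
    (hsurj : ∀ ρ > 0, ∃ δ > (0 : ℝ), ∀ p, edist x p < ENNReal.ofReal δ → ∃ z, ‖z‖ < ρ ∧ ψ z = p) :
    ∃ C', ∀ᶠ ε : ℝ in 𝓝[>] 0,
      |(extent (n + 1) (Metric.closedEBall x (ENNReal.ofReal ε))).toReal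
        - (simplexEdge n * ε - (((n : ℝ) + 1) / n) ^ 2 / (6 * simplexEdge n * (n * (n + 1)))
          * scalarContraction R * ε ^ 3)| ≤ C' * ε ^ 4 := by
  have hn0 : (0 : ℝ) < n := by exact_mod_cast hn
  have hL := simplexEdge_pos hn
  obtain ⟨C₁, hC₁, hupper⟩ := hR.exists_sum_distExpansion_le hn
  obtain ⟨b, hb⟩ := exists_regular_simplex hn
  have hb1 := norm_eq_one_of_simplex hb
  set L := simplexEdge n with hLdef
  set N : ℝ := n * (n + 1) with hN
  have hN0 : 0 < N := by positivity
  set κ : ℝ := (((n : ℝ) + 1) / n) ^ 2 * scalarContraction R / (6 * L) with hκ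
  have hκ' : (((n : ℝ) + 1) / n) ^ 2 / (6 * L * N) * scalarContraction R = κ / N := by
    rw [hκ]; field_simp
  rw [hκ']
  -- Radially the curvature term vanishes, so metric and coordinate balls have the same radius up to
  -- fourth order.
  have hrad : ∀ z, ‖z‖ ≤ r₀ → |(edist x (ψ z)).toReal - ‖z‖| ≤ C * ‖z‖ ^ 4 := by
    intro z hz
    have := (hdist ‖z‖ hz 0 z (by simp) le_rfl).2
    rw [hψ0, hR.distExpansion_zero_left, sub_zero] at this
    exact this.trans_eq (by ring)
  -- a radius on which the errors are at most half of the main terms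
  obtain ⟨r₁, hr₁, hr₁₀, hr₁1, hr₁C⟩ : ∃ r₁ > 0, r₁ ≤ r₀ ∧ r₁ ≤ 1 ∧ 16 * C * r₁ ≤ 1 / 2 := by
    refine ⟨min (min r₀ 1) (1 / (32 * (C + 1))), by positivity,
      (min_le_left _ _).trans (min_le_left _ _), (min_le_left _ _).trans (min_le_right _ _), ?_⟩
    calc 16 * C * min (min r₀ 1) (1 / (32 * (C + 1)))
        ≤ 16 * C * (1 / (32 * (C + 1))) := by gcongr; exact min_le_right _ _
      _ = C / (C + 1) / 2 := by field_simp; ring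
      _ ≤ 1 / 2 := by gcongr; rw [div_le_one (by positivity)]; linarith
  obtain ⟨δ, hδ, hδsurj⟩ := hsurj r₁ hr₁
  -- The four summands are the errors from enlarging the radius in the linear and cubic terms, from
  -- the `ρ⁵` remainder, and from the distance expansion.
  set A : ℝ := (N * L * (16 * C) + |κ| * (192 * C) + C₁ * 32 + (n + 1) * (n + 1) * (C * 32)) / N
    with hA
  refine ⟨A, ?_⟩
  have hev : ∀ᶠ ε : ℝ in 𝓝[>] 0, ε < min δ (r₁ / 2) :=
    (eventually_lt_nhds (by positivity)).filter_mono nhdsWithin_le_nhds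
  filter_upwards [hev, self_mem_nhdsWithin] with ε hε hε0
  replace hε0 : 0 < ε := hε0
  have hεδ : ε < δ := hε.trans_le (min_le_left _ _)
  have hεr : ε < r₁ / 2 := hε.trans_le (min_le_right _ _)
  have hε1 : ε ≤ 1 := by linarith
  have hCε : 16 * C * ε ^ 3 ≤ 1 / 2 := by
    calc 16 * C * ε ^ 3 ≤ 16 * C * r₁ := by
          gcongr
          calc ε ^ 3 ≤ ε ^ 1 := pow_le_pow_of_le_one hε0.le hε1 (by norm_num)
            _ ≤ r₁ := by rw [pow_one]; linarith
      _ ≤ _ := hr₁C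
  have hCε4 : 16 * C * ε ^ 4 ≤ ε / 2 := by
    calc 16 * C * ε ^ 4 = 16 * C * ε ^ 3 * ε := by ring
      _ ≤ 1 / 2 * ε := by gcongr
      _ = _ := by ring
  -- the error made by replacing the distances by their expansions
  have hsumerr : ∀ ρ, 0 < ρ → ρ ≤ 2 * ε → ∀ z : Fin (n + 1) → EuclideanSpace ℝ (Fin n),
      (∀ i, ‖z i‖ ≤ ρ) → |∑ i, ∑ j, (edist (ψ (z i)) (ψ (z j))).toReal
        - ∑ i, ∑ j, distExpansion R (z i) (z j)| ≤ (n + 1) * (n + 1) * (C * 32) * ε ^ 4 := by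
    intro ρ hρ0 hρ z hz
    have h1 : ∀ i j, |(edist (ψ (z i)) (ψ (z j))).toReal - distExpansion R (z i) (z j)|
        ≤ C * 32 * ε ^ 4 := by
      intro i j
      refine ((hdist ρ (by linarith) _ _ (hz i) (hz j)).2).trans ?_
      have : ‖z j - z i‖ ≤ 4 * ε := (norm_sub_le _ _).trans (by linarith [hz i, hz j])
      calc C * ρ ^ 3 * ‖z j - z i‖ ≤ C * (2 * ε) ^ 3 * (4 * ε) := by gcongr
        _ = _ := by ring
    simp_rw [← Finset.sum_sub_distrib]
    refine (Finset.abs_sum_le_sum_abs _ _).trans ?_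
    refine (Finset.sum_le_card_nsmul _ _ ((n + 1) * (C * 32 * ε ^ 4)) fun i _ ↦ ?_).trans
      (le_of_eq (by simp; ring))
    refine (Finset.abs_sum_le_sum_abs _ _).trans ?_
    exact (Finset.sum_le_card_nsmul _ _ _ fun j _ ↦ h1 i j).trans (by simp)
  have : Nonempty (Metric.closedEBall x (ENNReal.ofReal ε)) :=
    ⟨⟨x, Metric.mem_closedEBall_self⟩⟩
  obtain ⟨hB, hup⟩ : 0 ≤ L * ε - κ / N * ε ^ 3 + A * ε ^ 4 ∧
      extent (n + 1) (Metric.closedEBall x (ENNReal.ofReal ε))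
        ≤ ENNReal.ofReal (L * ε - κ / N * ε ^ 3 + A * ε ^ 4) := by
    refine extent_le_ofReal (by omega) fun p ↦ ?_
    have hp : ∀ i, edist x (p i) ≤ ENNReal.ofReal ε := fun i ↦ by
      have := (p i).2
      rwa [Metric.mem_closedEBall, edist_comm] at this
    choose z hz hzp using fun i ↦ hδsurj (p i)
      ((hp i).trans_lt ((ENNReal.ofReal_lt_ofReal_iff hδ).2 hεδ))
    -- Bootstrap: `‖z i‖ ≤ 2ε` comes first, and inserting it into the quartic error of `hrad` gives
    -- the sharp radius.
    have hzε : ∀ i, ‖z i‖ ≤ ε + 16 * C * ε ^ 4 := by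
      intro i
      have h1 := (abs_le.1 (hrad (z i) ((hz i).le.trans hr₁₀))).1
      have h2 : (edist x (ψ (z i))).toReal ≤ ε := by
        rw [hzp]; exact ENNReal.toReal_le_of_le_ofReal hε0.le (hp i)
      have h0 := norm_nonneg (z i)
      have h3 : C * ‖z i‖ ^ 4 ≤ 1 / 2 * ‖z i‖ := by
        have h5 : C * ‖z i‖ ^ 3 ≤ 1 / 2 := by
          calc C * ‖z i‖ ^ 3 ≤ C * r₁ := by
                gcongr
                calc ‖z i‖ ^ 3 ≤ ‖z i‖ ^ 1 :=
                      pow_le_pow_of_le_one h0 ((hz i).le.trans hr₁1) (by norm_num)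
                  _ ≤ r₁ := by rw [pow_one]; exact (hz i).le
            _ ≤ 16 * C * r₁ := by nlinarith [mul_nonneg hC hr₁.le]
            _ ≤ _ := hr₁C
        calc C * ‖z i‖ ^ 4 = C * ‖z i‖ ^ 3 * ‖z i‖ := by ring
          _ ≤ _ := by gcongr
      have h4 : ‖z i‖ ≤ 2 * ε := by linarith
      have h6 : C * ‖z i‖ ^ 4 ≤ C * (2 * ε) ^ 4 := by gcongr
      have h7 : C * (2 * ε) ^ 4 = 16 * C * ε ^ 4 := by ring
      linarith
    set ρ := ε + 16 * C * ε ^ 4 with hρ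
    have hρε : ε ≤ ρ := by have : 0 ≤ 16 * C * ε ^ 4 := by positivity
                           linarith
    have hρ0 : 0 < ρ := by linarith
    have hρ2 : ρ ≤ 2 * ε := by linarith
    simp_rw [Subtype.edist_eq, ← hzp]
    refine ⟨fun i j ↦ (hdist ρ (by linarith) _ _ (hzε i) (hzε j)).1, ?_⟩
    have h1 := (abs_le.1 (hsumerr ρ hρ0 hρ2 z hzε)).2
    have h2 := hupper ρ hρ0 z hzε
    have h3 : |ρ ^ 3 - ε ^ 3| ≤ 192 * C * ε ^ 4 := by
      have h4 : ρ ^ 3 - ε ^ 3 = (16 * C * ε ^ 4) * (ρ ^ 2 + ρ * ε + ε ^ 2) := by rw [hρ]; ring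
      rw [h4, abs_of_nonneg (by positivity)]
      have h5 : ρ ^ 2 + ρ * ε + ε ^ 2 ≤ 12 := by nlinarith
      calc _ ≤ (16 * C * ε ^ 4) * 12 := by gcongr
        _ = _ := by ring
    have h4 : -κ * (ρ ^ 3 - ε ^ 3) ≤ |κ| * (192 * C * ε ^ 4) := by
      refine (le_abs_self _).trans ?_
      rw [abs_mul, abs_neg]
      gcongr
    have h5 : C₁ * ρ ^ 5 ≤ C₁ * 32 * ε ^ 4 := by
      calc C₁ * ρ ^ 5 ≤ C₁ * (2 * ε) ^ 5 := by gcongr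
        _ = C₁ * 32 * (ε ^ 4 * ε) := by ring
        _ ≤ C₁ * 32 * (ε ^ 4 * 1) := by gcongr
        _ = _ := by ring
    have h6 : ((n + 1 : ℕ) : ℝ) * ((n + 1 : ℕ) - 1) * (L * ε - κ / N * ε ^ 3 + A * ε ^ 4)
        = N * L * ε - κ * ε ^ 3 + (N * L * (16 * C) + |κ| * (192 * C) + C₁ * 32
          + (n + 1) * (n + 1) * (C * 32)) * ε ^ 4 := by
      rw [hA, hN]; push_cast; field_simp; ring
    rw [h6]
    have h7 : N * L * ρ = N * L * ε + N * L * (16 * C) * ε ^ 4 := by rw [hρ]; ring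
    linarith
  have hlow : ENNReal.ofReal (L * ε - κ / N * ε ^ 3 - A * ε ^ 4)
      ≤ extent (n + 1) (Metric.closedEBall x (ENNReal.ofReal ε)) := by
    -- Shrinking the simplex by the radial error keeps its vertices inside the metric ball.
    set t := ε - C * ε ^ 4 with ht
    have hCp : 0 ≤ C * ε ^ 4 := by positivity
    have htε : t ≤ ε := by linarith
    have ht0 : 0 < t := by linarith
    have hz : ∀ i, ‖t • b i‖ = t := fun i ↦ by
      rw [norm_smul, hb1, mul_one, Real.norm_of_nonneg ht0.le]
    have hmem : ∀ i, ψ (t • b i) ∈ Metric.closedEBall x (ENNReal.ofReal ε) := by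
      intro i
      rw [Metric.mem_closedEBall, edist_comm]
      have h1 := (abs_le.1 (hrad (t • b i) (by rw [hz]; linarith))).2
      have h2 : edist x (ψ (t • b i)) ≠ ⊤ := by
        rw [← hψ0]; exact (hdist t (by linarith) _ _ (by simpa using ht0.le) (hz i).le).1
      rw [← ENNReal.ofReal_toReal h2]
      apply ENNReal.ofReal_le_ofReal
      rw [hz] at h1
      have : C * t ^ 4 ≤ C * ε ^ 4 := by gcongr
      linarith
    refine ofReal_le_extent (by omega) (fun i ↦ ⟨ψ (t • b i), hmem i⟩)
      (fun i j ↦ (hdist t (by linarith) _ _ (hz i).le (hz j).le).1) ?_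
    simp_rw [Subtype.edist_eq]
    have h1 := (abs_le.1 (hsumerr t ht0 (by linarith) (fun i ↦ t • b i) fun i ↦ (hz i).le)).1
    rw [hR.sum_distExpansion_simplex hn hb ht0.le] at h1
    have h3 : |t ^ 3 - ε ^ 3| ≤ 192 * C * ε ^ 4 := by
      have h4 : t ^ 3 - ε ^ 3 = -((C * ε ^ 4) * (t ^ 2 + t * ε + ε ^ 2)) := by rw [ht]; ring
      rw [h4, abs_neg, abs_of_nonneg (by positivity)]
      have h5 : t ^ 2 + t * ε + ε ^ 2 ≤ 192 := by nlinarith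
      calc _ ≤ (C * ε ^ 4) * 192 := by gcongr
        _ = _ := by ring
    have h4 : κ * (t ^ 3 - ε ^ 3) ≤ |κ| * (192 * C * ε ^ 4) := by
      refine (le_abs_self _).trans ?_
      rw [abs_mul]
      gcongr
    have h5 : 0 ≤ C₁ * 32 * ε ^ 4 := by positivity
    have h6 : ((n + 1 : ℕ) : ℝ) * ((n + 1 : ℕ) - 1) * (L * ε - κ / N * ε ^ 3 - A * ε ^ 4)
        = N * L * ε - κ * ε ^ 3 - (N * L * (16 * C) + |κ| * (192 * C) + C₁ * 32
          + (n + 1) * (n + 1) * (C * 32)) * ε ^ 4 := by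
      rw [hA, hN]; push_cast; field_simp; ring
    rw [h6]
    have h7 : N * L * t = N * L * ε - N * L * C * ε ^ 4 := by rw [ht]; ring
    have h8 : N * L * C * ε ^ 4 ≤ N * L * (16 * C) * ε ^ 4 := by gcongr; linarith
    have h9 : n * (n + 1) * simplexEdge n * t = N * L * t := by rw [hN]
    simp only [h9] at h1
    linarith
  have htop : extent (n + 1) (Metric.closedEBall x (ENNReal.ofReal ε)) ≠ ⊤ :=
    ne_top_of_le_ne_top ENNReal.ofReal_ne_top hup
  have hA0 : 0 ≤ A := by positivity
  have hlow' := (ENNReal.ofReal_le_iff_le_toReal htop).1 hlow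
  have hup' := ENNReal.toReal_le_of_le_ofReal hB hup
  rw [abs_le]; constructor <;> linarith

end

noncomputable section

/-! ### Smoothness of inverse matrices -/

section MatrixSmooth

variable {E ι : Type*} [NormedAddCommGroup E] [NormedSpace ℝ E] [Fintype ι] [DecidableEq ι]

theorem ContDiffAt.matrix_det {m : E → Matrix ι ι ℝ} {k : ℕ∞ω} {y : E}
    (h : ∀ i j, ContDiffAt ℝ k (fun z ↦ m z i j) y) : ContDiffAt ℝ k (fun z ↦ (m z).det) y := by
  simp_rw [Matrix.det_apply']
  exact ContDiffAt.sum fun σ _ ↦ contDiffAt_const.mul (contDiffAt_prod fun i _ ↦ h _ _)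

/-- Cramer's rule: the entries are polynomials in those of `m`, divided by the determinant. -/
theorem ContDiffAt.matrix_inv {m : E → Matrix ι ι ℝ} {k : ℕ∞ω} {y : E}
    (h : ∀ i j, ContDiffAt ℝ k (fun z ↦ m z i j) y) (hdet : (m y).det ≠ 0) (i j : ι) :
    ContDiffAt ℝ k (fun z ↦ (m z)⁻¹ i j) y := by
  have hadj : ContDiffAt ℝ k (fun z ↦ (m z).adjugate i j) y := by
    simp_rw [Matrix.adjugate_apply]
    refine ContDiffAt.matrix_det fun a b ↦ ?_
    by_cases hab : a = j
    · subst hab; simp only [Matrix.updateRow_self]; exact contDiffAt_const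
    · simp only [Matrix.updateRow_ne hab]; exact h a b
  simp_rw [Matrix.inv_def, Ring.inverse_eq_inv', Matrix.smul_apply, smul_eq_mul]
  exact ((ContDiffAt.matrix_det h).inv hdet).mul hadj

end MatrixSmooth

/-! ### Orthonormal frames and jets of a metric -/

section Jets

variable {n : ℕ}

theorem sum_sum_sum_rotate {ι κ τ : Type*} [Fintype ι] [Fintype κ] [Fintype τ]
    (f : ι → κ → τ → ℝ) : ∑ i, ∑ j, ∑ k, f i j k = ∑ k, ∑ i, ∑ j, f i j k :=
  (Finset.sum_congr rfl fun _ _ ↦ Finset.sum_comm).trans Finset.sum_comm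

open scoped MatrixOrder Matrix.Norms.L2Operator in
/-- An orthonormal frame for a positive definite matrix. -/
theorem Matrix.PosDef.exists_orthonormal_frame {m : Matrix (Fin n) (Fin n) ℝ} (hm : m.PosDef) :
    ∃ A : EuclideanSpace ℝ (Fin n) ≃L[ℝ] EuclideanSpace ℝ (Fin n),
      (∀ v w, ∑ i, ∑ j, m i j * A v i * A w j = inner ℝ v w) ∧
      ∀ i j, ∑ c, A (EuclideanSpace.single c 1) i * A (EuclideanSpace.single c 1) j = m⁻¹ i j := by
  -- Factor `m = Bᵀ B`; the frame is `B⁻¹`, so the Gram identity and the formula for `m⁻¹` are both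
  -- immediate.
  obtain ⟨B, hB⟩ := CStarAlgebra.nonneg_iff_eq_star_mul_self.1
    (Matrix.nonneg_iff_posSemidef.2 hm.posSemidef)
  rw [Matrix.star_eq_conjTranspose, Matrix.conjTranspose_eq_transpose_of_trivial] at hB
  have hdet : IsUnit B.det := by
    have h := hm.det_pos
    rw [hB, Matrix.det_mul] at h
    exact isUnit_iff_ne_zero.2 fun h0 ↦ by rw [h0, mul_zero] at h; exact lt_irrefl _ h
  let f := Matrix.toEuclideanCLM (n := Fin n) (𝕜 := ℝ)
  have hfg : f B⁻¹ * f B = 1 := by rw [← map_mul, Matrix.nonsing_inv_mul _ hdet, map_one]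
  have hgf : f B * f B⁻¹ = 1 := by rw [← map_mul, Matrix.mul_nonsing_inv _ hdet, map_one]
  let A : EuclideanSpace ℝ (Fin n) ≃L[ℝ] EuclideanSpace ℝ (Fin n) :=
    ContinuousLinearEquiv.equivOfInverse (f B⁻¹) (f B) (fun v ↦ DFunLike.congr_fun hgf v)
      (fun v ↦ DFunLike.congr_fun hfg v)
  have hA : ∀ v i, A v i = ∑ j, B⁻¹ i j * v j := fun v i ↦ rfl
  refine ⟨A, fun v w ↦ ?_, fun i j ↦ ?_⟩
  · have h1 : ∀ v i, ∑ j, B i j * A v j = v i := fun v i ↦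
      congrArg (fun z : EuclideanSpace ℝ (Fin n) ↦ z i) (A.symm_apply_apply v)
    rw [PiLp.inner_apply]
    simp_rw [RCLike.inner_apply, conj_trivial]
    calc _ = ∑ i, ∑ j, ∑ k, B k i * A v i * (B k j * A w j) := by
          refine Finset.sum_congr rfl fun i _ ↦ Finset.sum_congr rfl fun j _ ↦ ?_
          rw [hB, Matrix.mul_apply, Finset.sum_mul, Finset.sum_mul]
          exact Finset.sum_congr rfl fun k _ ↦ by rw [Matrix.transpose_apply]; ring
      _ = ∑ k, ∑ i, ∑ j, B k i * A v i * (B k j * A w j) := by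
          rw [sum_sum_sum_rotate]
      _ = _ := by
          refine Finset.sum_congr rfl fun k _ ↦ ?_
          rw [← Finset.sum_mul_sum, h1, h1, mul_comm]
  · have h2 : ∀ c i, A (EuclideanSpace.single c 1) i = B⁻¹ i c := fun c i ↦ by
      rw [hA]; simp
    simp_rw [h2]
    rw [hB, Matrix.mul_inv_rev, ← Matrix.transpose_nonsing_inv, Matrix.mul_apply]
    rfl

/-- The bilinear form of a matrix. -/
def matrixBilin (m : Matrix (Fin n) (Fin n) ℝ) :
    EuclideanSpace ℝ (Fin n) →ₗ[ℝ] EuclideanSpace ℝ (Fin n) →ₗ[ℝ] ℝ :=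
  LinearMap.mk₂ ℝ (fun v w ↦ ∑ i, ∑ j, m i j * v i * w j)
    (fun v v' w ↦ by
      simp_rw [← Finset.sum_add_distrib, PiLp.add_apply]
      exact Finset.sum_congr rfl fun i _ ↦ Finset.sum_congr rfl fun j _ ↦ by ring)
    (fun s v w ↦ by
      simp_rw [smul_eq_mul, Finset.mul_sum, PiLp.smul_apply, smul_eq_mul]
      exact Finset.sum_congr rfl fun i _ ↦ Finset.sum_congr rfl fun j _ ↦ by ring)
    (fun v w w' ↦ by
      simp_rw [← Finset.sum_add_distrib, PiLp.add_apply]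
      exact Finset.sum_congr rfl fun i _ ↦ Finset.sum_congr rfl fun j _ ↦ by ring)
    (fun s v w ↦ by
      simp_rw [smul_eq_mul, Finset.mul_sum, PiLp.smul_apply, smul_eq_mul]
      exact Finset.sum_congr rfl fun i _ ↦ Finset.sum_congr rfl fun j _ ↦ by ring)

theorem matrixBilin_apply (m : Matrix (Fin n) (Fin n) ℝ) (v w : EuclideanSpace ℝ (Fin n)) :
    matrixBilin m v w = ∑ i, ∑ j, m i j * v i * w j := rfl

theorem matrixBilin_single (m : Matrix (Fin n) (Fin n) ℝ) (i j : Fin n) :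
    matrixBilin m (EuclideanSpace.single i 1) (EuclideanSpace.single j 1) = m i j := by
  simp [matrixBilin_apply]

variable (A : EuclideanSpace ℝ (Fin n) ≃L[ℝ] EuclideanSpace ℝ (Fin n))

/-- The `i`-th coordinate of `A v`. -/
def frameCoord (i : Fin n) : EuclideanSpace ℝ (Fin n) →ₗ[ℝ] ℝ :=
  (EuclideanSpace.proj i : EuclideanSpace ℝ (Fin n) →L[ℝ] ℝ).toLinearMap ∘ₗ
    (A : EuclideanSpace ℝ (Fin n) →ₗ[ℝ] EuclideanSpace ℝ (Fin n))

theorem frameCoord_apply (i : Fin n) (v : EuclideanSpace ℝ (Fin n)) :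
    frameCoord A i v = A v i := rfl

/-- The bilinear form of a matrix in the frame `A`. -/
def frameBilin (m : Matrix (Fin n) (Fin n) ℝ) :
    EuclideanSpace ℝ (Fin n) →ₗ[ℝ] EuclideanSpace ℝ (Fin n) →ₗ[ℝ] ℝ :=
  (matrixBilin m).compl₁₂ (A : EuclideanSpace ℝ (Fin n) →ₗ[ℝ] EuclideanSpace ℝ (Fin n))
    (A : EuclideanSpace ℝ (Fin n) →ₗ[ℝ] EuclideanSpace ℝ (Fin n))

theorem frameBilin_apply (m : Matrix (Fin n) (Fin n) ℝ) (v w : EuclideanSpace ℝ (Fin n)) :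
    frameBilin A m v w = ∑ i, ∑ j, m i j * A v i * A w j := rfl

theorem frameBilin_eq (m : Matrix (Fin n) (Fin n) ℝ) (v w : EuclideanSpace ℝ (Fin n)) :
    frameBilin A m v w = matrixBilin m (A v) (A w) := rfl

/-- The trilinear form with coefficients `d` in the frame `A`. -/
def frameTrilin (d : Fin n → Matrix (Fin n) (Fin n) ℝ) :
    EuclideanSpace ℝ (Fin n) →ₗ[ℝ] EuclideanSpace ℝ (Fin n) →ₗ[ℝ]
      EuclideanSpace ℝ (Fin n) →ₗ[ℝ] ℝ :=
  ∑ i, (frameCoord A i).smulRight (frameBilin A (d i))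

theorem frameTrilin_apply (d : Fin n → Matrix (Fin n) (Fin n) ℝ)
    (a v w : EuclideanSpace ℝ (Fin n)) :
    frameTrilin A d a v w = ∑ i, A a i * frameBilin A (d i) v w := by
  simp [frameTrilin, LinearMap.sum_apply, frameCoord_apply]

/-- The quadrilinear form with coefficients `d` in the frame `A`. -/
def frameQuadrilin (d : Fin n → Fin n → Matrix (Fin n) (Fin n) ℝ) :
    EuclideanSpace ℝ (Fin n) →ₗ[ℝ] EuclideanSpace ℝ (Fin n) →ₗ[ℝ]
      EuclideanSpace ℝ (Fin n) →ₗ[ℝ] EuclideanSpace ℝ (Fin n) →ₗ[ℝ] ℝ :=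
  ∑ i, (frameCoord A i).smulRight (frameTrilin A (d i))

theorem frameQuadrilin_apply (d : Fin n → Fin n → Matrix (Fin n) (Fin n) ℝ)
    (a b v w : EuclideanSpace ℝ (Fin n)) :
    frameQuadrilin A d a b v w = ∑ i, A a i * frameTrilin A (d i) b v w := by
  simp [frameQuadrilin, LinearMap.sum_apply, frameCoord_apply]

theorem frameTrilin_symm_single (d : Fin n → Matrix (Fin n) (Fin n) ℝ) (i j k : Fin n) :
    frameTrilin A d (A.symm (EuclideanSpace.single i 1)) (A.symm (EuclideanSpace.single j 1))
      (A.symm (EuclideanSpace.single k 1)) = d i j k := by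
  simp [frameTrilin_apply, frameBilin_eq, matrixBilin_single]

theorem frameQuadrilin_symm_single (d : Fin n → Fin n → Matrix (Fin n) (Fin n) ℝ)
    (i j k l : Fin n) :
    frameQuadrilin A d (A.symm (EuclideanSpace.single i 1)) (A.symm (EuclideanSpace.single j 1))
      (A.symm (EuclideanSpace.single k 1)) (A.symm (EuclideanSpace.single l 1)) = d i j k l := by
  simp [frameQuadrilin_apply, frameTrilin_symm_single]

/-- The array of first partial derivatives of a matrix field. -/
def matrixDeriv (m : EuclideanSpace ℝ (Fin n) → Matrix (Fin n) (Fin n) ℝ)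
    (y : EuclideanSpace ℝ (Fin n)) (i : Fin n) : Matrix (Fin n) (Fin n) ℝ :=
  Matrix.of fun j k ↦ fderiv ℝ (fun z ↦ m z j k) y (EuclideanSpace.single i 1)

/-- The array of second partial derivatives of a matrix field. -/
def matrixDeriv₂ (m : EuclideanSpace ℝ (Fin n) → Matrix (Fin n) (Fin n) ℝ)
    (y : EuclideanSpace ℝ (Fin n)) (i j : Fin n) : Matrix (Fin n) (Fin n) ℝ :=
  Matrix.of fun k l ↦ fderiv ℝ (fderiv ℝ fun z ↦ m z k l) y (EuclideanSpace.single i 1)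
    (EuclideanSpace.single j 1)

theorem fderiv_comp_affine {F : Type*} [NormedAddCommGroup F] [NormedSpace ℝ F]
    (h : EuclideanSpace ℝ (Fin n) → F) (y z a : EuclideanSpace ℝ (Fin n)) :
    fderiv ℝ (fun z ↦ h (y + A z)) z a = fderiv ℝ h (y + A z) (A a) := by
  have h1 := A.comp_right_fderiv (f := fun z ↦ h (y + z)) (x := z)
  rw [show (fun z ↦ h (y + A z)) = (fun z ↦ h (y + z)) ∘ A from rfl, h1, fderiv_comp_add_left]
  rfl

theorem contDiffAt_frameBilin {m : EuclideanSpace ℝ (Fin n) → Matrix (Fin n) (Fin n) ℝ}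
    {y z : EuclideanSpace ℝ (Fin n)} {k : ℕ∞ω}
    (hm : ∀ i j, ContDiffAt ℝ k (fun z ↦ m z i j) (y + A z))
    (v w : EuclideanSpace ℝ (Fin n)) :
    ContDiffAt ℝ k (fun z ↦ frameBilin A (m (y + A z)) v w) z := by
  simp_rw [frameBilin_apply]
  refine ContDiffAt.sum fun i _ ↦ ContDiffAt.sum fun j _ ↦ ?_
  have h1 : ContDiffAt ℝ k (fun z ↦ m (y + A z) i j) z :=
    (hm i j).comp z (contDiff_const.add A.contDiff).contDiffAt
  exact (h1.mul contDiffAt_const).mul contDiffAt_const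

theorem fderiv_frameBilin {m : EuclideanSpace ℝ (Fin n) → Matrix (Fin n) (Fin n) ℝ}
    {y z : EuclideanSpace ℝ (Fin n)}
    (hm : ∀ i j, DifferentiableAt ℝ (fun z ↦ m z i j) (y + A z))
    (a v w : EuclideanSpace ℝ (Fin n)) :
    fderiv ℝ (fun z ↦ frameBilin A (m (y + A z)) v w) z a
      = ∑ i, ∑ j, fderiv ℝ (fun z ↦ m z i j) (y + A z) (A a) * A v i * A w j := by
  simp_rw [frameBilin_apply]
  have h1 : ∀ i j, DifferentiableAt ℝ (fun z ↦ m (y + A z) i j) z := fun i j ↦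
    (hm i j).fun_comp' z (A.differentiableAt.const_add y)
  rw [fderiv_fun_sum fun i _ ↦ DifferentiableAt.fun_sum fun j _ ↦
    ((h1 i j).mul_const _).mul_const _, _root_.sum_apply]
  refine Finset.sum_congr rfl fun i _ ↦ ?_
  rw [fderiv_fun_sum fun j _ ↦ ((h1 i j).mul_const _).mul_const _, _root_.sum_apply]
  refine Finset.sum_congr rfl fun j _ ↦ ?_
  rw [fderiv_mul_const ((h1 i j).mul_const _), fderiv_mul_const (h1 i j), smul_apply, smul_apply,
    fderiv_comp_affine A (fun z ↦ m z i j), smul_eq_mul, smul_eq_mul]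
  ring

/-- Linearity in the differentiated direction replaces the array of axis derivatives by the
derivative in the direction `A a`. -/
theorem frameTrilin_of_linear (L : Fin n → Fin n → EuclideanSpace ℝ (Fin n) →L[ℝ] ℝ)
    (a v w : EuclideanSpace ℝ (Fin n)) :
    frameTrilin A (fun i ↦ Matrix.of fun j k ↦ L j k (EuclideanSpace.single i 1)) a v w
      = frameBilin A (Matrix.of fun j k ↦ L j k (A a)) v w := by
  have h1 : ∀ j k, L j k (A a) = ∑ i, A a i * L j k (EuclideanSpace.single i 1) := fun j k ↦
    LinearMap.apply_eq_sum_single (L j k : EuclideanSpace ℝ (Fin n) →ₗ[ℝ] ℝ) (A a)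
  simp_rw [frameTrilin_apply, frameBilin_apply, Matrix.of_apply, h1, Finset.sum_mul,
    Finset.mul_sum]
  rw [sum_sum_sum_rotate (fun j k i ↦ A a i * L j k (EuclideanSpace.single i 1) * A v j * A w k)]
  exact Finset.sum_congr rfl fun i _ ↦ Finset.sum_congr rfl fun j _ ↦
    Finset.sum_congr rfl fun k _ ↦ by ring

theorem fderiv_frameBilin_zero {m : EuclideanSpace ℝ (Fin n) → Matrix (Fin n) (Fin n) ℝ}
    {y : EuclideanSpace ℝ (Fin n)} (hm : ∀ i j, DifferentiableAt ℝ (fun z ↦ m z i j) y)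
    (a v w : EuclideanSpace ℝ (Fin n)) :
    fderiv ℝ (fun z ↦ frameBilin A (m (y + A z)) v w) 0 a
      = frameTrilin A (matrixDeriv m y) a v w := by
  rw [fderiv_frameBilin A (by simpa using hm), map_zero, add_zero]
  exact (frameTrilin_of_linear A (fun j k ↦ fderiv ℝ (fun z ↦ m z j k) y) a v w).symm

theorem fderiv_fderiv_frameBilin_zero
    {m : EuclideanSpace ℝ (Fin n) → Matrix (Fin n) (Fin n) ℝ}
    {y : EuclideanSpace ℝ (Fin n)} (hm : ∀ i j, ContDiffAt ℝ 2 (fun z ↦ m z i j) y)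
    (a b v w : EuclideanSpace ℝ (Fin n)) :
    fderiv ℝ (fderiv ℝ fun z ↦ frameBilin A (m (y + A z)) v w) 0 a b
      = frameQuadrilin A (matrixDeriv₂ m y) a b v w := by
  have hdd : ∀ i j, DifferentiableAt ℝ (fderiv ℝ fun z ↦ m z i j) y := fun i j ↦
    ((hm i j).fderiv_right (m := 1) (by norm_num)).differentiableAt (by norm_num)
  have hf : ContDiffAt ℝ 2 (fun z ↦ frameBilin A (m (y + A z)) v w) 0 :=
    contDiffAt_frameBilin A (by simpa using hm) v w
  have hH : DifferentiableAt ℝ (fderiv ℝ fun z ↦ frameBilin A (m (y + A z)) v w) 0 :=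
    (hf.fderiv_right (m := 1) (by norm_num)).differentiableAt (by norm_num)
  have hev : ∀ᶠ z in 𝓝 (0 : EuclideanSpace ℝ (Fin n)), ∀ i j,
      DifferentiableAt ℝ (fun z ↦ m z i j) (y + A z) := by
    have hc : ContinuousAt (fun z ↦ y + A z) 0 := by fun_prop
    refine eventually_all.2 fun i ↦ eventually_all.2 fun j ↦ ?_
    have h1 : ∀ᶠ z in 𝓝 (y + A 0), DifferentiableAt ℝ (fun z ↦ m z i j) z := by
      rw [map_zero, add_zero]
      filter_upwards [(hm i j).eventually (by simp)] with z hz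
      exact hz.differentiableAt (by norm_num)
    exact hc.eventually h1
  have h1 : fderiv ℝ (fderiv ℝ fun z ↦ frameBilin A (m (y + A z)) v w) 0 a b
      = fderiv ℝ (fun z ↦ fderiv ℝ (fun z ↦ frameBilin A (m (y + A z)) v w) z b) 0 a := by
    rw [fderiv_clm_apply hH (differentiableAt_const b)]
    simp
  -- With `b` fixed, the first derivative is again a matrix field read in the frame, so the
  -- first-order formula applies a second time.
  have h2 : (fun z ↦ fderiv ℝ (fun z ↦ frameBilin A (m (y + A z)) v w) z b) =ᶠ[𝓝 0]
      fun z ↦ frameBilin A ((fun y' ↦ Matrix.of fun i j ↦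
        fderiv ℝ (fun z ↦ m z i j) y' (A b)) (y + A z)) v w := by
    filter_upwards [hev] with z hz
    exact fderiv_frameBilin A hz b v w
  rw [h1, h2.fderiv_eq, fderiv_frameBilin_zero A
    (m := fun y' ↦ Matrix.of fun i j ↦ fderiv ℝ (fun z ↦ m z i j) y' (A b))
    (fun i j ↦ by simpa using (hdd i j).clm_apply (differentiableAt_const (A b))),
    frameTrilin_apply, frameQuadrilin_apply]
  refine Finset.sum_congr rfl fun i _ ↦ ?_
  congr 1
  refine Eq.trans ?_ (frameTrilin_of_linear A (fun k l ↦
    fderiv ℝ (fderiv ℝ fun z ↦ m z k l) y (EuclideanSpace.single i 1)) b v w).symm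
  congr 1
  refine congrFun (congrArg _ (congrArg (frameBilin A) ?_)) v
  ext k l
  simp only [matrixDeriv, Matrix.of_apply]
  rw [fderiv_clm_apply (hdd k l) (differentiableAt_const (A b))]
  simp

end Jets

end

noncomputable section

/-! ### The curvature of a jet in coordinates -/

section FrameCurvature

variable {n : ℕ} (A : EuclideanSpace ℝ (Fin n) ≃L[ℝ] EuclideanSpace ℝ (Fin n))

theorem linearMap_eq_sum_symm_single {V : Type*} [AddCommGroup V] [Module ℝ V]
    (l : EuclideanSpace ℝ (Fin n) →ₗ[ℝ] V) (v : EuclideanSpace ℝ (Fin n)) :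
    l v = ∑ i, A v i • l (A.symm (EuclideanSpace.single i 1)) := by
  have h := LinearMap.apply_eq_sum_single
    (l ∘ₗ (A.symm : EuclideanSpace ℝ (Fin n) →ₗ[ℝ] EuclideanSpace ℝ (Fin n))) (A v)
  simpa using h

variable {A} {m' : Matrix (Fin n) (Fin n) ℝ}

/-- Raising an index: the vectors `A.symm (single r 1)` are the coordinate fields seen in the
orthonormal frame, and `m'` plays the role of the inverse metric. -/
theorem frame_apply_eq_sum_inner
    (hA : ∀ i j, ∑ c, A (EuclideanSpace.single c 1) i * A (EuclideanSpace.single c 1) j = m' i j)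
    (v : EuclideanSpace ℝ (Fin n)) (l : Fin n) :
    A v l = ∑ r, m' l r * inner ℝ v (A.symm (EuclideanSpace.single r 1)) := by
  have h1 : A v l = ∑ c, v c * A (EuclideanSpace.single c 1) l :=
    LinearMap.apply_eq_sum_single (frameCoord A l) v
  have h2 : ∀ c, v c = ∑ r, A (EuclideanSpace.single c 1) r
      * inner ℝ v (A.symm (EuclideanSpace.single r 1)) := fun c ↦ by
    have := linearMap_eq_sum_symm_single A (innerₗ (EuclideanSpace ℝ (Fin n)) v)
      (EuclideanSpace.single c 1)
    simpa [innerₗ_apply_apply, EuclideanSpace.inner_single_right] using this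
  rw [h1]
  simp_rw [← hA, Finset.sum_mul]
  rw [Finset.sum_comm]
  refine Finset.sum_congr rfl fun c _ ↦ ?_
  rw [h2 c, Finset.sum_mul]
  exact Finset.sum_congr rfl fun r _ ↦ by ring

theorem inner_eq_sum_frame (v w : EuclideanSpace ℝ (Fin n)) :
    inner ℝ v w = ∑ l, A w l * inner ℝ v (A.symm (EuclideanSpace.single l 1)) :=
  linearMap_eq_sum_symm_single A (innerₗ (EuclideanSpace ℝ (Fin n)) v) w

/-- The metric trace in the coordinate basis is the plain trace in the orthonormal frame; this
carries both traces in the scalar curvature. -/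
theorem sum_mul_bilin_symm_single
    (hA : ∀ i j, ∑ c, A (EuclideanSpace.single c 1) i * A (EuclideanSpace.single c 1) j = m' i j)
    (B : EuclideanSpace ℝ (Fin n) →ₗ[ℝ] EuclideanSpace ℝ (Fin n) →ₗ[ℝ] ℝ) :
    ∑ i, ∑ j, m' i j * B (A.symm (EuclideanSpace.single i 1)) (A.symm (EuclideanSpace.single j 1))
      = ∑ a, B (EuclideanSpace.single a 1) (EuclideanSpace.single a 1) := by
  have h1 : ∀ v, B v v = ∑ i, ∑ j, A v i * A v j
      * B (A.symm (EuclideanSpace.single i 1)) (A.symm (EuclideanSpace.single j 1)) := fun v ↦ by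
    rw [linearMap_eq_sum_symm_single A B v, LinearMap.sum_apply]
    refine Finset.sum_congr rfl fun i _ ↦ ?_
    rw [LinearMap.smul_apply, linearMap_eq_sum_symm_single A (B _) v, Finset.smul_sum]
    exact Finset.sum_congr rfl fun j _ ↦ by simp only [smul_eq_mul]; ring
  simp_rw [h1, ← hA, Finset.sum_mul]
  rw [sum_sum_sum_rotate]

/-- First kind Christoffel symbols (twice). -/
def christoffelFirst (d : Fin n → Matrix (Fin n) (Fin n) ℝ) (i j l : Fin n) : ℝ :=
  d i j l + d j i l - d l i j

/-- Evaluating the invariant tensor on the coordinate fields gives the classical formula in second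
derivatives of the metric and Christoffel symbols, which `sum_metric_mul_riemann` also reaches. -/
theorem curvatureOfJet_frame
    (hA : ∀ i j, ∑ c, A (EuclideanSpace.single c 1) i * A (EuclideanSpace.single c 1) j = m' i j)
    (d : Fin n → Matrix (Fin n) (Fin n) ℝ) (dd : Fin n → Fin n → Matrix (Fin n) (Fin n) ℝ)
    (i j k p : Fin n) :
    curvatureOfJet (frameTrilin A d) (frameQuadrilin A dd)
      (A.symm (EuclideanSpace.single i 1)) (A.symm (EuclideanSpace.single j 1))
      (A.symm (EuclideanSpace.single k 1)) (A.symm (EuclideanSpace.single p 1))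
    = 1 / 2 * (dd i k j p - dd i p j k - dd j k i p + dd j p i k)
      - ∑ l, (1 / 2 * ∑ r, m' l r * christoffelFirst d j k r)
        * (1 / 2 * christoffelFirst d i p l)
      + ∑ l, (1 / 2 * ∑ r, m' l r * christoffelFirst d i k r)
        * (1 / 2 * christoffelFirst d j p l) := by
  have h1 : ∀ a b c, inner ℝ (leviCivita (frameTrilin A d) (A.symm (EuclideanSpace.single a 1))
      (A.symm (EuclideanSpace.single b 1))) (A.symm (EuclideanSpace.single c 1))
      = 1 / 2 * christoffelFirst d a b c := fun a b c ↦ by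
    rw [inner_leviCivita]; simp only [frameTrilin_symm_single, christoffelFirst]
  have h2 : ∀ a b l, A (leviCivita (frameTrilin A d) (A.symm (EuclideanSpace.single a 1))
      (A.symm (EuclideanSpace.single b 1))) l
      = 1 / 2 * ∑ r, m' l r * christoffelFirst d a b r := fun a b l ↦ by
    rw [frame_apply_eq_sum_inner hA, Finset.mul_sum]
    exact Finset.sum_congr rfl fun r _ ↦ by rw [h1]; ring
  rw [curvatureOfJet, real_inner_comm, inner_eq_sum_frame (A := A),
    real_inner_comm (leviCivita _ _ _), inner_eq_sum_frame (A := A)]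
  simp only [frameQuadrilin_symm_single, h1, h2]

end FrameCurvature

/-! ### The scalar curvature of the manifold -/

section ScalarCurvature

variable {n : ℕ} {H : Type*} [TopologicalSpace H]
  {I : ModelWithCorners ℝ (EuclideanSpace ℝ (Fin n)) H}
  {M : Type*} [TopologicalSpace M] [ChartedSpace H M] [IsManifold I ∞ M]
  [RiemannianBundle (fun p : M ↦ TangentSpace I p)]

open RiemannianCoord

theorem pderiv_eq_fderiv {y : EuclideanSpace ℝ (Fin n)} (hy : range I ∈ 𝓝 y) (i : Fin n)
    (f : EuclideanSpace ℝ (Fin n) → ℝ) :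
    pderiv I i f y = fderiv ℝ f y (EuclideanSpace.single i 1) := by
  rw [pderiv, fderivWithin_of_mem_nhds hy]

theorem range_mem_nhds_of_mem_interior_target {x : M} {y : EuclideanSpace ℝ (Fin n)}
    (hy : y ∈ interior (extChartAt I x).target) : range I ∈ 𝓝 y :=
  mem_of_superset (mem_interior_iff_mem_nhds.1 hy) (extChartAt_target_subset_range x)

theorem christoffel_eq {x : M} {y : EuclideanSpace ℝ (Fin n)}
    (hy : y ∈ interior (extChartAt I x).target) (k i j : Fin n) :
    christoffel I x k i j y = 1 / 2 * ∑ l, (metric I x y)⁻¹ k l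
      * christoffelFirst (matrixDeriv (metric I x) y) i j l := by
  have hr := range_mem_nhds_of_mem_interior_target hy
  simp only [christoffel, pderiv_eq_fderiv hr, christoffelFirst, matrixDeriv, Matrix.of_apply]

/-- This lowered form is the one differentiated later, which avoids any formula for the derivative
of the inverse metric. -/
theorem sum_metric_mul_christoffel {x : M} {y : EuclideanSpace ℝ (Fin n)}
    (hy : y ∈ interior (extChartAt I x).target) (q i j : Fin n) :
    ∑ k, metric I x y q k * christoffel I x k i j y
      = 1 / 2 * christoffelFirst (matrixDeriv (metric I x) y) i j q := by
  have hdet : IsUnit (metric I x y).det :=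
    isUnit_iff_ne_zero.2 (posDef_metric x (interior_subset hy)).det_pos.ne'
  simp_rw [christoffel_eq hy]
  have h1 : ∀ l, ∑ k, metric I x y q k * (metric I x y)⁻¹ k l = if q = l then 1 else 0 := by
    intro l
    rw [← Matrix.mul_apply, Matrix.mul_nonsing_inv _ hdet, Matrix.one_apply]
  calc _ = 1 / 2 * ∑ l, (∑ k, metric I x y q k * (metric I x y)⁻¹ k l)
        * christoffelFirst (matrixDeriv (metric I x) y) i j l := by
        simp_rw [Finset.mul_sum, Finset.sum_mul, Finset.mul_sum]
        rw [Finset.sum_comm]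
        exact Finset.sum_congr rfl fun l _ ↦ Finset.sum_congr rfl fun k _ ↦ by ring
    _ = _ := by simp [h1]

theorem matrixDeriv_metric_symm (x : M) (y : EuclideanSpace ℝ (Fin n)) (i j k : Fin n) :
    matrixDeriv (metric I x) y i j k = matrixDeriv (metric I x) y i k j := by
  simp only [matrixDeriv, Matrix.of_apply]
  congr 2
  exact funext fun z ↦ metric_symm x z j k

variable [IsContMDiffRiemannianBundle I ∞ (EuclideanSpace ℝ (Fin n))
  (fun p : M ↦ TangentSpace I p)]

theorem fderiv_matrixDeriv_metric {x : M} {y : EuclideanSpace ℝ (Fin n)}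
    (hy : y ∈ interior (extChartAt I x).target) (i j k : Fin n) :
    DifferentiableAt ℝ (fun z ↦ matrixDeriv (metric I x) z i j k) y ∧
    ∀ p, fderiv ℝ (fun z ↦ matrixDeriv (metric I x) z i j k) y (EuclideanSpace.single p 1)
      = matrixDeriv₂ (metric I x) y p i j k := by
  have h := ((contDiffAt_infty.1 (contDiffAt_metric x hy j k) 2).fderiv_right (m := 1)
    le_rfl).differentiableAt one_ne_zero
  refine ⟨h.clm_apply (differentiableAt_const _), fun p ↦ ?_⟩
  simp only [matrixDeriv, matrixDeriv₂, Matrix.of_apply]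
  rw [fderiv_clm_apply h (differentiableAt_const _)]
  simp

theorem differentiableAt_christoffel {x : M} {y : EuclideanSpace ℝ (Fin n)}
    (hy : y ∈ interior (extChartAt I x).target) (k i j : Fin n) :
    DifferentiableAt ℝ (christoffel I x k i j) y := by
  have hev : christoffel I x k i j =ᶠ[𝓝 y] fun z ↦ 1 / 2 * ∑ l, (metric I x z)⁻¹ k l
      * christoffelFirst (matrixDeriv (metric I x) z) i j l := by
    filter_upwards [isOpen_interior.mem_nhds hy] with z hz using christoffel_eq hz k i j
  refine DifferentiableAt.congr_of_eventuallyEq ?_ hev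
  refine (DifferentiableAt.fun_sum fun l _ ↦ ?_).const_mul _
  refine DifferentiableAt.fun_mul ?_ ?_
  · exact (ContDiffAt.matrix_inv (fun a b ↦ contDiffAt_metric x hy a b)
      (posDef_metric x (interior_subset hy)).det_pos.ne' k l).differentiableAt (by simp)
  · exact ((fderiv_matrixDeriv_metric hy i j l).1.fun_add
      (fderiv_matrixDeriv_metric hy j i l).1).fun_sub
      (fderiv_matrixDeriv_metric hy l i j).1

/-- The derivative of `g_{qk} Γ^k_{ij} = Γ_{ij,q}`. -/
theorem sum_metric_mul_pderiv_christoffel {x : M} {y : EuclideanSpace ℝ (Fin n)}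
    (hy : y ∈ interior (extChartAt I x).target) (p q i j : Fin n) :
    ∑ k, (matrixDeriv (metric I x) y p q k * christoffel I x k i j y
      + metric I x y q k * pderiv I p (christoffel I x k i j) y)
    = 1 / 2 * (matrixDeriv₂ (metric I x) y p i j q + matrixDeriv₂ (metric I x) y p j i q
      - matrixDeriv₂ (metric I x) y p q i j) := by
  have hev : (fun z ↦ ∑ k, metric I x z q k * christoffel I x k i j z) =ᶠ[𝓝 y]
      fun z ↦ 1 / 2 * (matrixDeriv (metric I x) z i j q + matrixDeriv (metric I x) z j i q
        - matrixDeriv (metric I x) z q i j) := by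
    filter_upwards [isOpen_interior.mem_nhds hy] with z hz using sum_metric_mul_christoffel hz q i j
  have h := DFunLike.congr_fun (hev.fderiv_eq (𝕜 := ℝ)) (EuclideanSpace.single p 1)
  have hm : ∀ k, DifferentiableAt ℝ (fun z ↦ metric I x z q k) y := fun k ↦
    (contDiffAt_metric x hy q k).differentiableAt (by simp)
  have hΓ := fun k ↦ differentiableAt_christoffel hy k i j
  obtain ⟨h1, h1'⟩ := fderiv_matrixDeriv_metric hy i j q
  obtain ⟨h2, h2'⟩ := fderiv_matrixDeriv_metric hy j i q
  obtain ⟨h3, h3'⟩ := fderiv_matrixDeriv_metric hy q i j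
  have hmul : ∀ k ∈ Finset.univ,
      DifferentiableAt ℝ (fun z ↦ metric I x z q k * christoffel I x k i j z) y :=
    fun k _ ↦ (hm k).fun_mul (hΓ k)
  rw [fderiv_fun_sum hmul, _root_.sum_apply,
    fderiv_const_mul ((h1.fun_add h2).fun_sub h3), smul_apply, fderiv_fun_sub (h1.fun_add h2) h3,
    sub_apply, fderiv_fun_add h1 h2, add_apply, h1', h2', h3', smul_eq_mul] at h
  rw [← h]
  refine Finset.sum_congr rfl fun k _ ↦ ?_
  rw [fderiv_fun_mul (hm k) (hΓ k), pderiv_eq_fderiv (range_mem_nhds_of_mem_interior_target hy)]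
  simp only [add_apply, smul_apply, smul_eq_mul, matrixDeriv, Matrix.of_apply]
  ring

theorem matrixDeriv₂_metric_comm {x : M} {y : EuclideanSpace ℝ (Fin n)}
    (hy : y ∈ interior (extChartAt I x).target) (i j k l : Fin n) :
    matrixDeriv₂ (metric I x) y i j k l = matrixDeriv₂ (metric I x) y j i k l := by
  simp only [matrixDeriv₂, Matrix.of_apply]
  exact ((contDiffAt_infty.1 (contDiffAt_metric x hy k l) 2).isSymmSndFDerivAt (by simp)).eq _ _

/-- The Riemann tensor with its upper index lowered. -/
theorem sum_metric_mul_riemann {x : M} {y : EuclideanSpace ℝ (Fin n)}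
    (hy : y ∈ interior (extChartAt I x).target) (q k i j : Fin n) :
    ∑ l, metric I x y q l * riemann I x l k i j y
      = 1 / 2 * (matrixDeriv₂ (metric I x) y i k j q - matrixDeriv₂ (metric I x) y i q j k
          - matrixDeriv₂ (metric I x) y j k i q + matrixDeriv₂ (metric I x) y j q i k)
      - ∑ l, christoffel I x l j k y
        * (1 / 2 * christoffelFirst (matrixDeriv (metric I x) y) i q l)
      + ∑ l, christoffel I x l i k y
        * (1 / 2 * christoffelFirst (matrixDeriv (metric I x) y) j q l) := by
  have h1 := sum_metric_mul_pderiv_christoffel hy i q j k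
  have h2 := sum_metric_mul_pderiv_christoffel hy j q i k
  rw [Finset.sum_add_distrib] at h1 h2
  have hquad : ∀ i j, ∑ l, metric I x y q l
      * ∑ m, christoffel I x l i m y * christoffel I x m j k y
      = ∑ m, 1 / 2 * christoffelFirst (matrixDeriv (metric I x) y) i m q
        * christoffel I x m j k y := by
    intro i j
    simp_rw [← sum_metric_mul_christoffel hy, Finset.mul_sum, Finset.sum_mul]
    rw [Finset.sum_comm]
    exact Finset.sum_congr rfl fun l _ ↦ Finset.sum_congr rfl fun k _ ↦ by ring
  -- Metric compatibility in coordinates: `Γ_{il,q} - ∂_i g_{ql} = -Γ_{iq,l}`.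
  have hcompat : ∀ i j, ∑ m, 1 / 2 * christoffelFirst (matrixDeriv (metric I x) y) i m q
        * christoffel I x m j k y - ∑ l, matrixDeriv (metric I x) y i q l * christoffel I x l j k y
      = - ∑ l, christoffel I x l j k y
        * (1 / 2 * christoffelFirst (matrixDeriv (metric I x) y) i q l) := by
    intro i j
    rw [← Finset.sum_sub_distrib, ← Finset.sum_neg_distrib]
    refine Finset.sum_congr rfl fun l _ ↦ ?_
    simp only [christoffelFirst]
    rw [matrixDeriv_metric_symm x y i q l, matrixDeriv_metric_symm x y l i q,
      matrixDeriv_metric_symm x y q i l]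
    ring
  have hexp : ∑ l, metric I x y q l * riemann I x l k i j y
      = ∑ l, metric I x y q l * pderiv I i (christoffel I x l j k) y
        - ∑ l, metric I x y q l * pderiv I j (christoffel I x l i k) y
        + ∑ l, metric I x y q l * ∑ m, christoffel I x l i m y * christoffel I x m j k y
        - ∑ l, metric I x y q l * ∑ m, christoffel I x l j m y * christoffel I x m i k y := by
    rw [← Finset.sum_sub_distrib, ← Finset.sum_add_distrib, ← Finset.sum_sub_distrib]
    refine Finset.sum_congr rfl fun l _ ↦ ?_
    rw [riemann, Finset.sum_sub_distrib]
    ring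
  rw [hexp, hquad, hquad]
  have h3 := hcompat i j
  have h4 := hcompat j i
  have h5 := matrixDeriv₂_metric_comm hy i j k q
  linear_combination h1 - h2 + h3 - h4 + 1 / 2 * h5

/-- The scalar curvature as the full contraction of the curvature of the metric jet in an
orthonormal frame. -/
theorem scalarCurvature_eq_scalarContraction {x : M}
    (hx : extChartAt I x x ∈ interior (extChartAt I x).target)
    {A : EuclideanSpace ℝ (Fin n) ≃L[ℝ] EuclideanSpace ℝ (Fin n)}
    (hA : ∀ i j, ∑ c, A (EuclideanSpace.single c 1) i * A (EuclideanSpace.single c 1) j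
      = (metric I x (extChartAt I x x))⁻¹ i j) :
    scalarCurvature I x = scalarContraction (curvatureOfJet
      (frameTrilin A (matrixDeriv (metric I x) (extChartAt I x x)))
      (frameQuadrilin A (matrixDeriv₂ (metric I x) (extChartAt I x x)))) := by
  set y := extChartAt I x x
  set R := curvatureOfJet (frameTrilin A (matrixDeriv (metric I x) y))
    (frameQuadrilin A (matrixDeriv₂ (metric I x) y)) with hRdef
  have hR : IsCurvatureLike R := isCurvatureLike_curvatureOfJet _ _
  let f : Fin n → EuclideanSpace ℝ (Fin n) := fun i ↦ A.symm (EuclideanSpace.single i 1)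
  have hdet : IsUnit (metric I x y).det :=
    isUnit_iff_ne_zero.2 (posDef_metric x (interior_subset hx)).det_pos.ne'
  have h1 : ∀ q k i j, ∑ l, metric I x y q l * riemann I x l k i j y
      = R (f i) (f j) (f k) (f q) := by
    intro q k i j
    rw [sum_metric_mul_riemann hx, hRdef, curvatureOfJet_frame hA]
    simp_rw [christoffel_eq hx]
  have h2 : ∀ k i j l, riemann I x l k i j y
      = ∑ q, (metric I x y)⁻¹ l q * R (f i) (f j) (f k) (f q) := by
    intro k i j l
    have h3 : ∀ l', ∑ q, (metric I x y)⁻¹ l q * metric I x y q l' = if l = l' then 1 else 0 := by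
      intro l'
      rw [← Matrix.mul_apply, Matrix.nonsing_inv_mul _ hdet, Matrix.one_apply]
    simp_rw [← h1, Finset.mul_sum]
    rw [Finset.sum_comm]
    simp_rw [← mul_assoc, ← Finset.sum_mul, h3]
    simp
  have h3 : ∀ j k, ricci I x j k y
      = ∑ a, R (EuclideanSpace.single a 1) (f j) (f k) (EuclideanSpace.single a 1) := by
    intro j k
    simp_rw [ricci, h2]
    exact sum_mul_bilin_symm_single hA (hR.outer (f j) (f k))
  change ∑ j, ∑ k, (metric I x y)⁻¹ j k * ricci I x j k y = _
  simp_rw [h3, Finset.mul_sum]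
  rw [sum_sum_sum_rotate, scalarContraction]
  exact Finset.sum_congr rfl fun a _ ↦ sum_mul_bilin_symm_single hA
    (hR.inner₂₃ (EuclideanSpace.single a 1) (EuclideanSpace.single a 1))

end ScalarCurvature

end

/-! ### Normal parametrization of the manifold and conclusion -/

noncomputable section

open RiemannianCoord in
/-- Normal coordinates at an interior point of a Riemannian manifold, up to order three. -/
theorem exists_normal_parametrization {n : ℕ} {H : Type*} [TopologicalSpace H]
    {I : ModelWithCorners ℝ (EuclideanSpace ℝ (Fin n)) H}
    {M : Type*} [TopologicalSpace M] [ChartedSpace H M] [IsManifold I ∞ M]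
    [RiemannianBundle (fun p : M ↦ TangentSpace I p)]
    [IsContMDiffRiemannianBundle I ∞ (EuclideanSpace ℝ (Fin n)) (fun p : M ↦ TangentSpace I p)]
    (x : M) (hx : I.IsInteriorPoint x) :
    ∃ (R : EuclideanSpace ℝ (Fin n) → EuclideanSpace ℝ (Fin n) → EuclideanSpace ℝ (Fin n) →
        EuclideanSpace ℝ (Fin n) → ℝ)
      (Φ : EuclideanSpace ℝ (Fin n) → EuclideanSpace ℝ (Fin n))
      (A : EuclideanSpace ℝ (Fin n) ≃L[ℝ] EuclideanSpace ℝ (Fin n)),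
      IsCurvatureLike R ∧ scalarCurvature I x = scalarContraction R ∧ ContDiff ℝ 1 Φ ∧
      Φ 0 = extChartAt I x x ∧ fderiv ℝ Φ 0 = A ∧
      ∃ C₀, 0 ≤ C₀ ∧ ∀ᶠ z in 𝓝 0, ∀ w,
        |pullbackForm (I := I) x Φ z w - (‖w‖ ^ 2 - R w z z w / 3)| ≤ C₀ * ‖z‖ ^ 3 * ‖w‖ ^ 2 := by
  have hy : extChartAt I x x ∈ interior (extChartAt I x).target := I.isInteriorPoint_iff.1 hx
  obtain ⟨A, hA₁, hA₂⟩ := (posDef_metric x (interior_subset hy)).exists_orthonormal_frame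
  set y := extChartAt I x x
  set g₁ := frameTrilin A (matrixDeriv (metric I x) y) with hg₁
  set g₂ := frameQuadrilin A (matrixDeriv₂ (metric I x) y) with hg₂
  have hm : ∀ k : ℕ, ∀ i j, ContDiffAt ℝ k (fun z ↦ metric I x z i j) y := fun k i j ↦
    contDiffAt_infty.1 (contDiffAt_metric x hy i j) k
  have hsymm : ∀ z v w, frameBilin A (metric I x (y + A z)) v w
      = frameBilin A (metric I x (y + A z)) w v := by
    intro z v w
    rw [frameBilin_apply, frameBilin_apply, Finset.sum_comm]
    refine Finset.sum_congr rfl fun i _ ↦ Finset.sum_congr rfl fun j _ ↦ ?_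
    rw [metric_symm x _ j i]
    ring
  have hd₁ : ∀ a v w, fderiv ℝ (fun z ↦ frameBilin A (metric I x (y + A z)) v w) 0 a
      = g₁ a v w := fun a v w ↦
    fderiv_frameBilin_zero A (fun i j ↦ (hm 1 i j).differentiableAt (by simp)) a v w
  have hd₂ : ∀ a b v w,
      fderiv ℝ (fderiv ℝ fun z ↦ frameBilin A (metric I x (y + A z)) v w) 0 a b = g₂ a b v w :=
    fun a b v w ↦ fderiv_fderiv_frameBilin_zero A (hm 2) a b v w
  have hs₁ : ∀ a v w, g₁ a v w = g₁ a w v := by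
    intro a v w
    rw [← hd₁, ← hd₁]
    congr 2
    exact funext fun z ↦ hsymm z v w
  obtain ⟨C₀, hC₀, hexp⟩ := normalMap_metric_expansion (g₁ := g₁) (g₂ := g₂)
    (G := fun z ↦ frameBilin A (metric I x (y + A z)))
    (fun v w ↦ contDiffAt_frameBilin A (by simpa using hm 3) v w) hsymm
    (fun v w ↦ by rw [map_zero, add_zero, frameBilin_apply]; exact hA₁ v w) hd₁ hd₂
  have hφ : ∀ z, DifferentiableAt ℝ (normalMap g₁ g₂) z := fun z ↦
    (contDiff_normalMap g₁ g₂ (k := 1)).differentiable one_ne_zero z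
  have hΦ' : ∀ z, HasFDerivAt (fun z ↦ y + A (normalMap g₁ g₂ z))
      ((A : EuclideanSpace ℝ (Fin n) →L[ℝ] EuclideanSpace ℝ (Fin n)).comp
        (fderiv ℝ (normalMap g₁ g₂) z)) z := fun z ↦
    (A.hasFDerivAt.comp z (hφ z).hasFDerivAt).const_add y
  -- `A` makes the metric Euclidean at the origin, and `normalMap` then removes its first
  -- derivatives and normalizes the second ones.
  refine ⟨curvatureOfJet g₁ g₂, fun z ↦ y + A (normalMap g₁ g₂ z), A,
    isCurvatureLike_curvatureOfJet _ _, scalarCurvature_eq_scalarContraction hy hA₂,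
    contDiff_const.add (A.contDiff.comp (contDiff_normalMap g₁ g₂)), ?_, ?_, C₀, hC₀, ?_⟩
  · simp [normalMap_zero]
  · rw [(hΦ' 0).fderiv, fderiv_normalMap_zero g₁ g₂ hs₁]
    rfl
  · filter_upwards [hexp] with z hz w
    rw [pullbackForm, (hΦ' z).fderiv]
    exact hz w

theorem simplexEdge_coefficient {n : ℕ} (hn : 1 ≤ n) :
    (((n : ℝ) + 1) / n) ^ 2 / (6 * simplexEdge n * (n * (n + 1)))
      = simplexEdge n * (1 / (12 * (n : ℝ) ^ 2)) := by
  have hn0 : (0 : ℝ) < n := by exact_mod_cast hn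
  have hL := simplexEdge_pos hn
  have hL2 := simplexEdge_sq (n := n)
  rw [div_eq_iff (by positivity)]
  have h1 : simplexEdge n * (1 / (12 * (n : ℝ) ^ 2)) * (6 * simplexEdge n * (n * (n + 1)))
      = simplexEdge n ^ 2 * (n * (n + 1)) / (2 * n ^ 2) := by field_simp; norm_num
  rw [h1, hL2]
  field_simp

theorem simplexEdge_mul_eq_sqrt {n : ℕ} (hn : 1 ≤ n) :
    1 / 6 * √(((n : ℝ) + 1) / (2 * (n : ℝ) ^ 5)) = simplexEdge n * (1 / (12 * (n : ℝ) ^ 2)) := by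
  have hn0 : (0 : ℝ) < n := by exact_mod_cast hn
  have hL := simplexEdge_pos hn
  have h1 : √(((n : ℝ) + 1) / (2 * (n : ℝ) ^ 5)) = simplexEdge n / (2 * (n : ℝ) ^ 2) := by
    rw [Real.sqrt_eq_iff_eq_sq (by positivity) (by positivity), div_pow, simplexEdge_sq]
    field_simp
  rw [h1]
  field_simp
  norm_num

end

theorem theorem1p1 {n : ℕ} (hn : 1 ≤ n) {H : Type*} [TopologicalSpace H]
    (I : ModelWithCorners ℝ (EuclideanSpace ℝ (Fin n)) H)
    {M : Type*} [EMetricSpace M] [ChartedSpace H M] [IsManifold I ∞ M]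
    [RiemannianBundle (fun p : M ↦ TangentSpace I p)]
    [IsContMDiffRiemannianBundle I ∞ (EuclideanSpace ℝ (Fin n)) (fun p : M ↦ TangentSpace I p)]
    [IsRiemannianManifold I M]
    (x : M) (hx : I.IsInteriorPoint x) :
    ((fun ε : ℝ ↦ (extent (n + 1) (Metric.closedEBall x (ENNReal.ofReal ε))).toReal
        - ((extent (n + 1) (Metric.closedBall (0 : EuclideanSpace ℝ (Fin n)) 1)).toReal * ε
          - 1 / 6 * √(((n : ℝ) + 1) / (2 * (n : ℝ) ^ 5)) * scalarCurvature I x * ε ^ 3))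
      =O[𝓝[>] 0] fun ε : ℝ ↦ ε ^ 4) ∧
    (∃ r : ℝ → ℝ, (r =O[𝓝[>] 0] fun ε : ℝ ↦ ε ^ 3) ∧
      ∀ᶠ ε : ℝ in 𝓝[>] 0,
        (extent (n + 1) (Metric.closedEBall x (ENNReal.ofReal ε))).toReal
          = √(2 * (((n : ℝ) + 1) / n)) * ε
            * (1 - 1 / (12 * (n : ℝ) ^ 2) * scalarCurvature I x * ε ^ 2 + r ε)) := by
  have hn0 : (0 : ℝ) < n := by exact_mod_cast hn
  have hL := simplexEdge_pos hn
  obtain ⟨R, Φ, A, hR, hscal, hΦ, hΦ0, hΦ', C₀, hC₀, hexp⟩ :=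
    exists_normal_parametrization (I := I) x hx
  obtain ⟨ψ, hψ0, r₀, hr₀, C, hC, hdist, hsurj⟩ :=
    exists_distance_expansion (I := I) x hx hΦ hΦ0 hΦ' hR hC₀ hexp
  obtain ⟨C', hC'⟩ := hR.exists_extent_expansion hn hψ0 hr₀ hC hdist hsurj
  rw [simplexEdge_coefficient hn, ← hscal] at hC'
  rw [extent_closedBall_one hn, ENNReal.toReal_ofReal hL.le, simplexEdge_mul_eq_sqrt hn]
  have hmain : (fun ε : ℝ ↦ (extent (n + 1) (Metric.closedEBall x (ENNReal.ofReal ε))).toReal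
      - (simplexEdge n * ε - simplexEdge n * (1 / (12 * (n : ℝ) ^ 2)) * scalarCurvature I x
        * ε ^ 3)) =O[𝓝[>] 0] fun ε : ℝ ↦ ε ^ 4 := by
    refine IsBigO.of_bound C' ?_
    filter_upwards [hC'] with ε hε
    rwa [Real.norm_eq_abs, Real.norm_eq_abs, abs_of_nonneg (by positivity : 0 ≤ ε ^ 4)]
  -- The relative remainder is the absolute one divided by the leading term `Lε`, which lowers the
  -- order from four to three.
  refine ⟨hmain, fun ε ↦ ((extent (n + 1) (Metric.closedEBall x (ENNReal.ofReal ε))).toReal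
      - (simplexEdge n * ε - simplexEdge n * (1 / (12 * (n : ℝ) ^ 2)) * scalarCurvature I x
        * ε ^ 3)) * (simplexEdge n * ε)⁻¹, ?_, ?_⟩
  · refine (hmain.mul (isBigO_refl (fun ε ↦ (simplexEdge n * ε)⁻¹) _)).trans ?_
    refine IsBigO.of_bound (simplexEdge n)⁻¹ ?_
    filter_upwards [self_mem_nhdsWithin] with ε hε
    have hε0 : 0 < ε := hε
    rw [Real.norm_of_nonneg (by positivity), Real.norm_of_nonneg (by positivity)]
    exact le_of_eq (by field_simp)
  · filter_upwards [self_mem_nhdsWithin] with ε hε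
    have hε0 : 0 < ε := hε
    rw [← simplexEdge]
    field_simp
    ring
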